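/- Let $\tau\ge 1$ be a real number and let $P$ be a set of $n\ge 2$ points in $\mathbb R^d$, each of which has a colour. A colour $c$ \emph{dominates} an axis-parallel rectangle $Q=[a_1,b_1]\times\dots\times[a_d,b_d]$ if $c$ occurs in $Q$ and at least a fraction $1/\tau$ of the points of $P\cap Q$ have colour $c$, i.e. $|\{p\in P\cap Q : \mathrm{col}(p)=c\}|\ge |P\cap Q|/\tau>0$. For every constant dimension $d\ge 1$ there is a static data structure that uses $O(n\log^{d-1}n)$ space and, for every query rectangle $Q$, reports exactly the colours that dominate $Q$ in $O(\tau\log^d n)$ time. Here $\tau$ is fixed when the data structure is built, and the constants in the $O$-bounds depend only on $d$. The model is the word RAM with words of $\Omega(\log n)$ bits, in which a colour fits into one word and coordinates are real numbers that occupy one memory cell each and are accessed only by comparisons of unit cost; space is counted in memory cells, and time in executed instructions. -/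

import Mathlib

/-!
# Domination queries on a word RAM

Colours and all integers are words of `w` bits.  Coordinates are real numbers that the machine can
only compare (at unit cost); they are never combined arithmetically or turned into integers.
-/

namespace Domination

/-! ## The geometric notions -/

/-- The closed axis-parallel rectangle `[lo 0, hi 0] × ⋯ × [lo (d-1), hi (d-1)]`. -/
def rect {d : ℕ} (lo hi : Fin d → ℝ) : Set (Fin d → ℝ) :=
  {p | ∀ j, lo j ≤ p j ∧ p j ≤ hi j}

/-- The number of the given points that lie in `Q`. -/
noncomputable def count {n d : ℕ} (pt : Fin n → Fin d → ℝ) (Q : Set (Fin d → ℝ)) : ℕ :=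
  {i | pt i ∈ Q}.ncard

/-- The number of the given points of colour `c` that lie in `Q`. -/
noncomputable def colorCount {n d : ℕ} (pt : Fin n → Fin d → ℝ) (col : Fin n → ℕ)
    (Q : Set (Fin d → ℝ)) (c : ℕ) : ℕ :=
  {i | pt i ∈ Q ∧ col i = c}.ncard

/-- Colour `c` dominates `Q`: it occurs in `Q`, and at least a fraction `1 / τ` of the points in `Q`
have colour `c`.  (The first condition matters only if there is no point in `Q`; then no colour
dominates.) -/
def Dominates {n d : ℕ} (τ : ℝ) (pt : Fin n → Fin d → ℝ) (col : Fin n → ℕ)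
    (Q : Set (Fin d → ℝ)) (c : ℕ) : Prop :=
  0 < colorCount pt col Q c ∧ (count pt Q : ℝ) / τ ≤ (colorCount pt col Q c : ℝ)

/-! ## The machine -/

/-- Binary operations on words. -/
inductive BinOp where
  | add | sub | mul | div | mod | band | bor | bxor | shl | shr | lt | eq

/-- The value of a binary operation on words of `w` bits: arithmetic is modulo `2 ^ w`, and a
comparison gives `1` or `0`. -/
def BinOp.eval (w : ℕ) : BinOp → ℕ → ℕ → ℕ
  | add, a, b => (a + b) % 2 ^ w
  | sub, a, b => (a + (2 ^ w - b)) % 2 ^ w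
  | mul, a, b => (a * b) % 2 ^ w
  | div, a, b => (a / b) % 2 ^ w
  | mod, a, b => (a % b) % 2 ^ w
  | band, a, b => (a &&& b) % 2 ^ w
  | bor, a, b => (a ||| b) % 2 ^ w
  | bxor, a, b => (a ^^^ b) % 2 ^ w
  | shl, a, b => (a <<< b) % 2 ^ w
  | shr, a, b => (a >>> b) % 2 ^ w
  | lt, a, b => (if a < b then 1 else 0) % 2 ^ w
  | eq, a, b => (if a = b then 1 else 0) % 2 ^ w

/-- Programs.  Registers are numbered by natural numbers; a program is a finite object and mentions
only finitely many of them.  `ι` indexes the real numbers that form the query. -/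
inductive Cmd (ι : Type) where
  /-- do nothing -/
  | skip : Cmd ι
  /-- register `r` := the constant `k` -/
  | const (r k : ℕ) : Cmd ι
  /-- register `r` := `o` applied to registers `a` and `b` -/
  | op (o : BinOp) (r a b : ℕ) : Cmd ι
  /-- register `r` := the memory word whose address is in register `a` -/
  | load (r a : ℕ) : Cmd ι
  /-- the memory word whose address is in register `a` := register `r` -/
  | store (a r : ℕ) : Cmd ι
  /-- register `r` := whether the stored coordinate whose address is in register `a` is less than
  the query value `j` -/
  | keyLT (r a : ℕ) (j : ι) : Cmd ι
  /-- the same with "at most" instead of "less than" -/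
  | keyLE (r a : ℕ) (j : ι) : Cmd ι
  /-- report the word in register `r` -/
  | emit (r : ℕ) : Cmd ι
  /-- `p`, then `q` -/
  | seq (p q : Cmd ι) : Cmd ι
  /-- `p` if register `r` is nonzero, and `q` otherwise -/
  | branch (r : ℕ) (p q : Cmd ι) : Cmd ι
  /-- repeat `p` as long as register `r` is nonzero -/
  | loop (r : ℕ) (p : Cmd ι) : Cmd ι

/-- A machine state: registers, the memory (a block of words with addresses `0, 1, 2, …`), and the
list of words reported so far. -/
@[ext]
structure State where
  reg : ℕ → ℕ
  mem : List ℕ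
  out : List ℕ

/-- The state with register `r` set to `v`. -/
def State.setReg (s : State) (r v : ℕ) : State :=
  { s with reg := Function.update s.reg r v }

/-- `Exec w key x p s t s'`: on words of `w` bits, with the read-only list `key` of stored
coordinates and the query values `x`, the program `p` started in state `s` halts in state `s'` after
exactly `t` steps.  Every instruction and every test of a branch or loop is one step.  An access
outside the memory or outside `key` has no successor state. -/
inductive Exec {ι : Type} (w : ℕ) (key : List ℝ) (x : ι → ℝ) :
    Cmd ι → State → ℕ → State → Prop where
  | skip (s : State) : Exec w key x .skip s 1 s
  | const (s : State) (r k : ℕ) : Exec w key x (.const r k) s 1 (s.setReg r (k % 2 ^ w))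
  | op (s : State) (o : BinOp) (r a b : ℕ) :
      Exec w key x (.op o r a b) s 1 (s.setReg r (o.eval w (s.reg a) (s.reg b)))
  | load (s : State) (r a v : ℕ) (h : s.mem[s.reg a]? = some v) :
      Exec w key x (.load r a) s 1 (s.setReg r v)
  | store (s : State) (a r : ℕ) (h : s.reg a < s.mem.length) :
      Exec w key x (.store a r) s 1 { s with mem := s.mem.set (s.reg a) (s.reg r) }
  | keyLT_true (s : State) (r a : ℕ) (j : ι) (y : ℝ) (h : key[s.reg a]? = some y) (hy : y < x j) :
      Exec w key x (.keyLT r a j) s 1 (s.setReg r (1 % 2 ^ w))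
  | keyLT_false (s : State) (r a : ℕ) (j : ι) (y : ℝ) (h : key[s.reg a]? = some y)
      (hy : ¬ y < x j) : Exec w key x (.keyLT r a j) s 1 (s.setReg r 0)
  | keyLE_true (s : State) (r a : ℕ) (j : ι) (y : ℝ) (h : key[s.reg a]? = some y) (hy : y ≤ x j) :
      Exec w key x (.keyLE r a j) s 1 (s.setReg r (1 % 2 ^ w))
  | keyLE_false (s : State) (r a : ℕ) (j : ι) (y : ℝ) (h : key[s.reg a]? = some y)
      (hy : ¬ y ≤ x j) : Exec w key x (.keyLE r a j) s 1 (s.setReg r 0)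
  | emit (s : State) (r : ℕ) : Exec w key x (.emit r) s 1 { s with out := s.out ++ [s.reg r] }
  | seq {p q : Cmd ι} {s s' s'' : State} {t t' : ℕ}
      (hp : Exec w key x p s t s') (hq : Exec w key x q s' t' s'') :
      Exec w key x (.seq p q) s (t + t') s''
  | branch_true {p q : Cmd ι} {r : ℕ} {s s' : State} {t : ℕ} (hr : s.reg r ≠ 0)
      (hp : Exec w key x p s t s') : Exec w key x (.branch r p q) s (t + 1) s'
  | branch_false {p q : Cmd ι} {r : ℕ} {s s' : State} {t : ℕ} (hr : s.reg r = 0)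
      (hq : Exec w key x q s t s') : Exec w key x (.branch r p q) s (t + 1) s'
  | loop_done {p : Cmd ι} {r : ℕ} {s : State} (hr : s.reg r = 0) :
      Exec w key x (.loop r p) s 1 s
  | loop_step {p : Cmd ι} {r : ℕ} {s s' s'' : State} {t t' : ℕ} (hr : s.reg r ≠ 0)
      (hp : Exec w key x p s t s') (hl : Exec w key x (.loop r p) s' t' s'') :
      Exec w key x (.loop r p) s (t + t' + 1) s''

/-! ## Data structures -/

/-- A static data structure as it lies in memory: a block of words and a block of coordinates.  The
block of words also contains all the working space that queries use. -/
structure Image where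
  words : List ℕ
  keys : List ℝ

/-- The space used by a data structure: the number of its words and stored coordinates. -/
def Image.space (D : Image) : ℕ :=
  D.words.length + D.keys.length

/-- All words have at most `w` bits. -/
def Image.IsWordSized (D : Image) (w : ℕ) : Prop :=
  ∀ v ∈ D.words, v < 2 ^ w

/-- The query program `prog`, run on the data structure `D` (from zero registers and an empty
output) with the query rectangle `rect lo hi`, halts after exactly `t` steps, reports the list `out`
and leaves the data structure as it was. -/
def Answers {d : ℕ} (prog : Cmd (Fin d ⊕ Fin d)) (w : ℕ) (D : Image) (lo hi : Fin d → ℝ)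
    (t : ℕ) (out : List ℕ) : Prop :=
  ∃ reg : ℕ → ℕ,
    Exec w D.keys (Sum.elim lo hi) prog ⟨fun _ => 0, D.words, []⟩ t ⟨reg, D.words, out⟩

end Domination

/-! Put h = ⌊log₂ n⌋ + 1 and e = d - 1. The structure is a range tree flattened into arrays, with a
wavelet matrix on the colours of its last layer.

Layer 0 lists the points by coordinate 0. Layer j + 1 consists of h copies of layer j, where copy s
has its aligned blocks of length 2^s sorted by coordinate j + 1; so layer j has n h^j entries. A
query carries a list of intervals of the current layer. An interval shorter than 2^h splits into at
most two aligned blocks of each length 2^s with s < h. Such a block occurs, sorted, in copy s of the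
next layer, and two binary searches there cut it down to the points whose next coordinate is in
range. Sorting only permutes a block, so no point is lost or duplicated (`blocks_good`,
`slice_cut`). After the last coordinate, L = (2h)^e intervals contain exactly the points of the
query rectangle. This phase takes O(L h) = O(log^d n) steps.

Colours are replaced by codes below n, which have h bits. Level l of the wavelet matrix is the list
of codes after stable partitions by bits 0, …, l - 1. The elements of an interval with a prescribed
bit l form an interval of level l + 1, whose ends are found by counting bits in prefixes
(`slice_posMap`). A node of level l is a residue modulo 2^l together with L intervals that hold the
codes in the rectangle with this residue. Call a node heavy if it is nonempty and has at least a
fraction 1/τ of all points in the rectangle. A parent's class contains those of its children, so a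
descent through heavy nodes reaches every dominating colour (`mem_heavyNodes_succ`). Classes on one
level are disjoint, so at most τ of them are heavy (`length_heavyNodes_le`). Over h levels, O(τ L h)
= O(τ log^d n) interval ends are mapped.

Each end is mapped in constant time: the bits of a level are packed into words of b = ⌊log₂ n⌋ bits,
prefix counts are stored at word boundaries, and the remainder is looked up in a table of bit counts
with n + 1 entries. With M = n h^e, the h levels need h (M / b + 1) = O(M) words per table, so
packing keeps the space at O(n log^(d-1) n). The comparison with τ is a look-up as well
(`lt_threshold`).

To run this on the machine, programs are written in a small structured language over natural numbers
and compiled; `Machine.Wp` is its total-correctness predicate with exact step counts, whose side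
conditions exclude overflow. All numbers in play are at most a constant times n^(3e+4)
(`build_bounds`), which the word length accommodates. `Machine.Wp.query` verifies the program, and
`report_spec` identifies its output with the dominating colours. -/

namespace Domination

/-! ## A structured language with expressions, compiled to `Cmd` -/

/-- The variables of the structured language. -/
inductive Var where
  | vN | vH | vB | vM | vNB | vThr | vCol | vPop | vBits | vZ0 | vZ1 | vWB | vWC | vEnd
  | vX | vY | vLen | vMj | vKb | vNl | vAcc | vLev | vPw | vSrc | vDst | vRem | vNum
  | vl | vr | vHi | vMid | vc | vs | vCnt | vJ | vPos
  deriving DecidableEq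

/-- The register that holds a variable. -/
def Var.idx (v : Var) : ℕ := v.ctorIdx

theorem Var.idx_injective : Function.Injective Var.idx := by
  intro a b h
  have := congrArg Var.ofNat h
  simpa [Var.idx, Var.ofNat_ctorIdx] using this

/-- Registers from 64 on are therefore free for the temporaries of compiled expressions. -/
theorem Var.idx_lt (v : Var) : v.idx < 64 := by
  cases v <;> decide

/-- The value of a binary operation if there is no overflow. -/
def BinOp.val : BinOp → ℕ → ℕ → ℕ
  | add, a, b => a + b
  | sub, a, b => a - b
  | mul, a, b => a * b
  | div, a, b => a / b
  | mod, a, b => a % b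
  | shl, a, b => a * 2 ^ b
  | lt, a, b => if a < b then 1 else 0
  | _, _, _ => 0

/-- No overflow occurs. -/
def BinOp.Fits (w : ℕ) : BinOp → ℕ → ℕ → Prop
  | add, a, b => a + b < 2 ^ w
  | sub, a, b => b ≤ a
  | mul, a, b => a * b < 2 ^ w
  | div, _, _ => True
  | mod, _, _ => True
  | shl, a, b => a * 2 ^ b < 2 ^ w
  | lt, _, _ => True
  | _, _, _ => False

/-- Programs are verified over natural numbers; this transfers the result to words modulo 2^w.
Operations that the programs do not use are excluded by making `Fits` false for them. -/
theorem BinOp.eval_eq_val {w : ℕ} (hw : 0 < w) (o : BinOp) {a b : ℕ} (ha : a < 2 ^ w)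
    (h : o.Fits w a b) : o.eval w a b = o.val a b ∧ o.val a b < 2 ^ w := by
  have h1 : 1 < 2 ^ w := Nat.one_lt_two_pow hw.ne'
  cases o <;> simp only [BinOp.Fits] at h <;> simp only [BinOp.eval, BinOp.val]
  · exact ⟨Nat.mod_eq_of_lt h, h⟩
  · refine ⟨?_, by omega⟩
    rw [show a + (2 ^ w - b) = (a - b) + 2 ^ w by omega, Nat.add_mod_right,
      Nat.mod_eq_of_lt (by omega)]
  · exact ⟨Nat.mod_eq_of_lt h, h⟩
  · have := Nat.div_le_self a b
    exact ⟨Nat.mod_eq_of_lt (by omega), by omega⟩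
  · have := Nat.mod_le a b
    exact ⟨Nat.mod_eq_of_lt (by omega), by omega⟩
  · rw [Nat.shiftLeft_eq]
    exact ⟨Nat.mod_eq_of_lt h, h⟩
  · split_ifs <;> simp [Nat.mod_eq_of_lt h1, h1]

/-- Expressions over variables and memory. -/
inductive Expr where
  | var (x : Var)
  | const (k : ℕ)
  | load (e : Expr)
  | bin (o : BinOp) (e f : Expr)

instance : Coe Var Expr := ⟨Expr.var⟩
instance : Add Expr := ⟨Expr.bin .add⟩
instance : Sub Expr := ⟨Expr.bin .sub⟩
instance : Mul Expr := ⟨Expr.bin .mul⟩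
instance : Div Expr := ⟨Expr.bin .div⟩
instance : Mod Expr := ⟨Expr.bin .mod⟩

/-- The value `2 ^ e`. -/
def Expr.pow2 (e : Expr) : Expr := .bin .shl (.const 1) e

/-- The truth value of `e < f`. -/
def Expr.less (e f : Expr) : Expr := .bin .lt e f

/-- States of the structured language. -/
@[ext]
structure St where
  env : Var → ℕ
  mem : ℕ → ℕ
  out : List ℕ

/-- Assignment to a variable. -/
def St.set (s : St) (x : Var) (v : ℕ) : St := { s with env := Function.update s.env x v }

/-- Assignment to a memory cell. -/
def St.put (s : St) (a v : ℕ) : St := { s with mem := Function.update s.mem a v }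

@[simp] theorem St.env_set (s : St) (x y : Var) (v : ℕ) :
    (s.set x v).env y = if y = x then v else s.env y := by
  simp [St.set, Function.update_apply]

@[simp] theorem St.mem_set (s : St) (x : Var) (v : ℕ) : (s.set x v).mem = s.mem := rfl
@[simp] theorem St.out_set (s : St) (x : Var) (v : ℕ) : (s.set x v).out = s.out := rfl
@[simp] theorem St.env_put (s : St) (a v : ℕ) : (s.put a v).env = s.env := rfl
@[simp] theorem St.out_put (s : St) (a v : ℕ) : (s.put a v).out = s.out := rfl
theorem St.mem_put (s : St) (a v y : ℕ) :
    (s.put a v).mem y = if y = a then v else s.mem y := by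
  simp [St.put, Function.update_apply]

/-- What is fixed during a run: the word size, the sizes of the memory and of the block of
coordinates, the coordinates, and the query. -/
structure Machine (ι : Type) where
  w : ℕ
  size : ℕ
  keySize : ℕ
  key : ℕ → ℝ
  q : ι → ℝ
  w_pos : 0 < w

/-- The value of an expression. -/
def Expr.eval (s : St) : Expr → ℕ
  | var x => s.env x
  | const k => k
  | load e => s.mem (e.eval s)
  | bin o e f => o.val (e.eval s) (f.eval s)

/-- An expression is evaluated without overflow and without access outside the memory. -/
def Expr.Ok {ι : Type} (μ : Machine ι) (s : St) : Expr → Prop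
  | var _ => True
  | const k => k < 2 ^ μ.w
  | load e => e.Ok μ s ∧ e.eval s < μ.size
  | bin o e f => e.Ok μ s ∧ f.Ok μ s ∧ o.Fits μ.w (e.eval s) (f.eval s)

/-- The number of instructions that evaluate an expression. -/
def Expr.cost : Expr → ℕ
  | var _ => 2
  | const _ => 1
  | load e => e.cost + 1
  | bin _ e f => e.cost + f.cost + 1

section ExprSimp
variable {ι : Type} (μ : Machine ι) (st : St) (e f : Expr) (k : ℕ) (x : Var)

@[simp] theorem Expr.eval_var : (Expr.var x).eval st = st.env x := rfl
@[simp] theorem Expr.eval_const : (Expr.const k).eval st = k := rfl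
@[simp] theorem Expr.eval_load : (Expr.load e).eval st = st.mem (e.eval st) := rfl
@[simp] theorem Expr.eval_add : (e + f).eval st = e.eval st + f.eval st := rfl
@[simp] theorem Expr.eval_sub : (e - f).eval st = e.eval st - f.eval st := rfl
@[simp] theorem Expr.eval_mul : (e * f).eval st = e.eval st * f.eval st := rfl
@[simp] theorem Expr.eval_div : (e / f).eval st = e.eval st / f.eval st := rfl
@[simp] theorem Expr.eval_mod : (e % f).eval st = e.eval st % f.eval st := rfl
@[simp] theorem Expr.eval_pow2 : e.pow2.eval st = 2 ^ e.eval st := Nat.one_mul _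
@[simp] theorem Expr.eval_less :
    (e.less f).eval st = if e.eval st < f.eval st then 1 else 0 := rfl

@[simp] theorem Expr.ok_var : (Expr.var x).Ok μ st := trivial
@[simp] theorem Expr.ok_const : (Expr.const k).Ok μ st ↔ k < 2 ^ μ.w := Iff.rfl
@[simp] theorem Expr.ok_load :
    (Expr.load e).Ok μ st ↔ e.Ok μ st ∧ e.eval st < μ.size := Iff.rfl
@[simp] theorem Expr.ok_add :
    (e + f).Ok μ st ↔ e.Ok μ st ∧ f.Ok μ st ∧ e.eval st + f.eval st < 2 ^ μ.w := Iff.rfl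
@[simp] theorem Expr.ok_sub :
    (e - f).Ok μ st ↔ e.Ok μ st ∧ f.Ok μ st ∧ f.eval st ≤ e.eval st := Iff.rfl
@[simp] theorem Expr.ok_mul :
    (e * f).Ok μ st ↔ e.Ok μ st ∧ f.Ok μ st ∧ e.eval st * f.eval st < 2 ^ μ.w := Iff.rfl
@[simp] theorem Expr.ok_div : (e / f).Ok μ st ↔ e.Ok μ st ∧ f.Ok μ st :=
  ⟨fun h => ⟨h.1, h.2.1⟩, fun h => ⟨h.1, h.2, trivial⟩⟩
@[simp] theorem Expr.ok_mod : (e % f).Ok μ st ↔ e.Ok μ st ∧ f.Ok μ st :=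
  ⟨fun h => ⟨h.1, h.2.1⟩, fun h => ⟨h.1, h.2, trivial⟩⟩
@[simp] theorem Expr.ok_pow2 :
    e.pow2.Ok μ st ↔ e.Ok μ st ∧ 2 ^ e.eval st < 2 ^ μ.w := by
  have h1 : 1 < 2 ^ μ.w := Nat.one_lt_two_pow μ.w_pos.ne'
  simp only [Expr.pow2, Expr.Ok, BinOp.Fits, Expr.eval, one_mul]
  tauto
@[simp] theorem Expr.ok_less : (e.less f).Ok μ st ↔ e.Ok μ st ∧ f.Ok μ st :=
  ⟨fun h => ⟨h.1, h.2.1⟩, fun h => ⟨h.1, h.2, trivial⟩⟩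

@[simp] theorem Expr.cost_var : (Expr.var x).cost = 2 := rfl
@[simp] theorem Expr.cost_const : (Expr.const k).cost = 1 := rfl
@[simp] theorem Expr.cost_load : (Expr.load e).cost = e.cost + 1 := rfl
@[simp] theorem Expr.cost_add : (e + f).cost = e.cost + f.cost + 1 := rfl
@[simp] theorem Expr.cost_sub : (e - f).cost = e.cost + f.cost + 1 := rfl
@[simp] theorem Expr.cost_mul : (e * f).cost = e.cost + f.cost + 1 := rfl
@[simp] theorem Expr.cost_div : (e / f).cost = e.cost + f.cost + 1 := rfl
@[simp] theorem Expr.cost_mod : (e % f).cost = e.cost + f.cost + 1 := rfl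
@[simp] theorem Expr.cost_pow2 : e.pow2.cost = e.cost + 2 := by
  simp only [Expr.pow2, Expr.cost]; omega
@[simp] theorem Expr.cost_less : (e.less f).cost = e.cost + f.cost + 1 := rfl

end ExprSimp

/-- The code that puts the value of an expression into register `t`; it changes no register below
`t`. -/
def Expr.code (ι : Type) : Expr → ℕ → Cmd ι
  | var x, t => .seq (.const t 0) (.op .add t t x.idx)
  | const k, t => .const t k
  | load e, t => .seq (e.code ι t) (.load t t)
  | bin o e f, t => .seq (.seq (e.code ι t) (f.code ι (t + 1))) (.op o t t (t + 1))

/-- Programs of the structured language. -/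
inductive Prog (ι : Type) where
  | skip : Prog ι
  | assign (x : Var) (e : Expr) : Prog ι
  | store (a e : Expr) : Prog ι
  | keyLT (x : Var) (a : Expr) (j : ι) : Prog ι
  | keyLE (x : Var) (a : Expr) (j : ι) : Prog ι
  | emit (e : Expr) : Prog ι
  | seq (p q : Prog ι) : Prog ι
  | ite (e : Expr) (p q : Prog ι) : Prog ι
  | loop (e : Expr) (p : Prog ι) : Prog ι

infix:55 " ::= " => Prog.assign
infixr:50 " ;; " => Prog.seq

/-- Compilation of programs. -/
def Prog.code {ι : Type} : Prog ι → Cmd ι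
  | skip => .skip
  | assign x e => .seq (e.code ι 64) (.seq (.const 65 0) (.op .add x.idx 64 65))
  | store a e => .seq (.seq (a.code ι 64) (e.code ι 65)) (.store 64 65)
  | keyLT x a j => .seq (a.code ι 64) (.keyLT x.idx 64 j)
  | keyLE x a j => .seq (a.code ι 64) (.keyLE x.idx 64 j)
  | emit e => .seq (e.code ι 64) (.emit 64)
  | seq p q => .seq p.code q.code
  | ite e p q => .seq (e.code ι 64) (.branch 64 p.code q.code)
  | loop e p => .seq (e.code ι 64) (.loop 64 (.seq p.code (e.code ι 64)))

/-- A machine state represents a state of the structured language. -/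
structure Rep {ι : Type} (μ : Machine ι) (s : St) (σ : State) : Prop where
  mem_eq : σ.mem = (List.range μ.size).map s.mem
  out_eq : σ.out = s.out
  reg_eq : ∀ v : Var, σ.reg v.idx = s.env v
  env_lt : ∀ v, s.env v < 2 ^ μ.w
  mem_lt : ∀ a < μ.size, s.mem a < 2 ^ μ.w

/-! ### Total correctness with step counts -/

namespace Machine
variable {ι : Type} (μ : Machine ι)

/-- The block of coordinates. -/
def keys : List ℝ := (List.range μ.keySize).map μ.key

/-- `Runs` is execution on the given machine. -/
abbrev Runs (c : Cmd ι) (σ : State) (t : ℕ) (σ' : State) : Prop :=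
  Exec μ.w μ.keys μ.q c σ t σ'

variable {μ}

/-- Code for target `t` touches only registers from `t` on. So the left operand, kept in `t`,
survives the evaluation of the right one in `t + 1`, and the variables, which live below 64, are
untouched. -/
theorem runs_expr (e : Expr) : ∀ (t : ℕ) {s : St} {σ : State}, 64 ≤ t → e.Ok μ s → Rep μ s σ →
    ∃ ρ : ℕ → ℕ, μ.Runs (e.code ι t) σ e.cost ⟨ρ, σ.mem, σ.out⟩ ∧ ρ t = e.eval s ∧
      e.eval s < 2 ^ μ.w ∧ ∀ r < t, ρ r = σ.reg r := by
  induction e with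
  | var x =>
    intro t s σ ht _ hσ
    have hx := x.idx_lt
    -- There is no move instruction: copying is addition to a cleared register, which is why a
    -- variable costs two steps.
    refine ⟨_, .seq (.const σ t 0) (.op _ .add t t x.idx), ?_, hσ.env_lt x, ?_⟩
    · have := hσ.env_lt x
      have h0 : 0 < 2 ^ μ.w := by positivity
      simp [State.setReg, BinOp.eval, show x.idx ≠ t by omega,
        hσ.reg_eq x, Nat.mod_eq_of_lt this]
    · intro r hr
      simp [State.setReg, hr.ne]
  | const k =>
    intro t s σ ht h hσ
    refine ⟨_, .const σ t k, ?_, h, ?_⟩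
    · simpa using Nat.mod_eq_of_lt h
    · intro r hr
      simp [hr.ne]
  | load e ih =>
    intro t s σ ht h hσ
    obtain ⟨ρ, h1, h2, h3, h4⟩ := ih t ht h.1 hσ
    refine ⟨_, .seq h1 (.load _ t t (s.mem (e.eval s)) ?_), ?_, hσ.mem_lt _ h.2, ?_⟩
    · simp [hσ.mem_eq, h2, h.2]
    · simp
    · intro r hr
      simp [hr.ne, h4 r hr]
  | bin o e f ihe ihf =>
    intro t s σ ht h hσ
    obtain ⟨ρ, h1, h2, h3, h4⟩ := ihe t ht h.1 hσ
    have hσ' : Rep μ s ⟨ρ, σ.mem, σ.out⟩ :=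
      ⟨hσ.mem_eq, hσ.out_eq, fun v => by
        rw [← hσ.reg_eq v]; exact h4 _ (by have := v.idx_lt; omega), hσ.env_lt, hσ.mem_lt⟩
    obtain ⟨ρ', g1, g2, g3, g4⟩ := ihf (t + 1) (by omega) h.2.1 hσ'
    have g5 : ρ' t = e.eval s := by rw [g4 t (by omega)]; exact h2
    obtain ⟨e1, e2⟩ := BinOp.eval_eq_val μ.w_pos o h3 h.2.2
    refine ⟨_, .seq (.seq h1 g1) (.op _ o t t (t + 1)), ?_, e2, ?_⟩
    · simp [g5, g2, e1, Expr.eval]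
    · intro r hr
      simp [hr.ne, g4 r (by omega), h4 r hr]

/-- From state `s` the program halts, and the final state and the number of steps satisfy `Q`. -/
def Wp (μ : Machine ι) (p : Prog ι) (s : St) (Q : St → ℕ → Prop) : Prop :=
  ∀ σ, Rep μ s σ → ∃ s' t σ', μ.Runs p.code σ t σ' ∧ Rep μ s' σ' ∧ Q s' t

theorem Wp.mono {p : Prog ι} {s : St} {Q Q' : St → ℕ → Prop} (h : μ.Wp p s Q)
    (hQ : ∀ s' t, Q s' t → Q' s' t) : μ.Wp p s Q' := by
  intro σ hσ
  obtain ⟨s', t, σ', h1, h2, h3⟩ := h σ hσ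
  exact ⟨s', t, σ', h1, h2, hQ _ _ h3⟩

theorem Wp.seq {p q : Prog ι} {s : St} {Q : St → ℕ → Prop}
    (h : μ.Wp p s fun s1 t1 => μ.Wp q s1 fun s2 t2 => Q s2 (t1 + t2)) : μ.Wp (.seq p q) s Q := by
  intro σ hσ
  obtain ⟨s', t, σ', h1, h2, h3⟩ := h σ hσ
  obtain ⟨s'', t', σ'', g1, g2, g3⟩ := h3 σ' h2
  exact ⟨s'', t + t', σ'', .seq h1 g1, g2, g3⟩

theorem _root_.Domination.Rep.of_reg {s : St} {σ : State} (hσ : Rep μ s σ) {ρ : ℕ → ℕ}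
    (h : ∀ r < 64, ρ r = σ.reg r) : Rep μ s ⟨ρ, σ.mem, σ.out⟩ :=
  ⟨hσ.mem_eq, hσ.out_eq, fun v => by rw [← hσ.reg_eq v]; exact h _ v.idx_lt, hσ.env_lt, hσ.mem_lt⟩

theorem _root_.Domination.Rep.set {s : St} {σ : State} (hσ : Rep μ s σ) {ρ : ℕ → ℕ}
    (x : Var) {v : ℕ} (hv : v < 2 ^ μ.w) (hx : ρ x.idx = v) (h : ∀ r < 64, r ≠ x.idx → ρ r = σ.reg r) :
    Rep μ (s.set x v) ⟨ρ, σ.mem, σ.out⟩ := by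
  refine ⟨hσ.mem_eq, hσ.out_eq, fun y => ?_, fun y => ?_, hσ.mem_lt⟩
  · rw [St.env_set]
    split_ifs with hy
    · subst hy; exact hx
    · rw [← hσ.reg_eq y]; exact h _ y.idx_lt fun e => hy (Var.idx_injective e)
  · rw [St.env_set]
    split_ifs
    · exact hv
    · exact hσ.env_lt y

theorem Wp.assign {x : Var} {e : Expr} {s : St} {Q : St → ℕ → Prop} (he : e.Ok μ s)
    (h : Q (s.set x (e.eval s)) (e.cost + (1 + 1))) : μ.Wp (.assign x e) s Q := by
  intro σ hσ
  obtain ⟨ρ, h1, h2, h3, h4⟩ := runs_expr e 64 le_rfl he hσ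
  refine ⟨_, _, _, .seq h1 (.seq (.const _ 65 0) (.op _ .add x.idx 64 65)),
    hσ.set x h3 ?_ ?_, h⟩
  · simp [State.setReg, BinOp.eval, h2, Nat.mod_eq_of_lt h3]
  · intro r hr hx
    simp [State.setReg, hx, show r ≠ 65 by omega, h4 r hr]

theorem Wp.store {a e : Expr} {s : St} {Q : St → ℕ → Prop} (ha : a.Ok μ s)
    (ha' : a.eval s < μ.size) (he : e.Ok μ s)
    (h : Q (s.put (a.eval s) (e.eval s)) (a.cost + e.cost + 1)) : μ.Wp (.store a e) s Q := by
  intro σ hσ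
  obtain ⟨ρ, h1, h2, h3, h4⟩ := runs_expr a 64 le_rfl ha hσ
  obtain ⟨ρ', g1, g2, g3, g4⟩ := runs_expr e 65 (by omega) he (Rep.of_reg hσ h4)
  have g5 : ρ' 64 = a.eval s := by rw [g4 64 (by omega)]; exact h2
  refine ⟨_, _, _, .seq (.seq h1 g1) (.store _ 64 65 ?_), ?_, h⟩
  · simpa [g5, hσ.mem_eq] using ha'
  · refine ⟨?_, hσ.out_eq, fun v => ?_, hσ.env_lt, fun y hy => ?_⟩
    · apply List.ext_getElem
      · simp [hσ.mem_eq]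
      · intro i hi hi'
        simp only [g2, g5, hσ.mem_eq, List.getElem_set, List.getElem_map, List.getElem_range,
          St.mem_put]
        by_cases hia : a.eval s = i
        · simp [hia]
        · simp [hia, Ne.symm hia]
    · have := v.idx_lt
      change ρ' v.idx = _
      rw [g4 _ (by omega)]
      change ρ v.idx = _
      rw [h4 _ this, hσ.reg_eq v, St.env_put]
    · rw [St.mem_put]
      split_ifs
      · exact g3
      · exact hσ.mem_lt y hy

theorem getElem?_keys {i : ℕ} (h : i < μ.keySize) : μ.keys[i]? = some (μ.key i) := by
  simp [keys, h]

open Classical in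
theorem Wp.keyLT {x : Var} {a : Expr} {j : ι} {s : St} {Q : St → ℕ → Prop} (ha : a.Ok μ s)
    (ha' : a.eval s < μ.keySize)
    (h : Q (s.set x (if μ.key (a.eval s) < μ.q j then 1 else 0)) (a.cost + 1)) :
    μ.Wp (.keyLT x a j) s Q := by
  intro σ hσ
  obtain ⟨ρ, h1, h2, h3, h4⟩ := runs_expr a 64 le_rfl ha hσ
  have h5 : μ.keys[ρ 64]? = some (μ.key (a.eval s)) := by rw [h2]; exact getElem?_keys ha'
  have one_lt : 1 < 2 ^ μ.w := Nat.one_lt_two_pow μ.w_pos.ne'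
  split_ifs at h with hk
  · refine ⟨_, _, _, .seq h1 (.keyLT_true _ x.idx 64 j _ h5 hk), hσ.set x one_lt ?_ ?_, h⟩
    · simp [Nat.mod_eq_of_lt one_lt]
    · intro r hr hx
      simp [hx, h4 r hr]
  · refine ⟨_, _, _, .seq h1 (.keyLT_false _ x.idx 64 j _ h5 hk), hσ.set x (by omega) ?_ ?_, h⟩
    · simp
    · intro r hr hx
      simp [hx, h4 r hr]

open Classical in
theorem Wp.keyLE {x : Var} {a : Expr} {j : ι} {s : St} {Q : St → ℕ → Prop} (ha : a.Ok μ s)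
    (ha' : a.eval s < μ.keySize)
    (h : Q (s.set x (if μ.key (a.eval s) ≤ μ.q j then 1 else 0)) (a.cost + 1)) :
    μ.Wp (.keyLE x a j) s Q := by
  intro σ hσ
  obtain ⟨ρ, h1, h2, h3, h4⟩ := runs_expr a 64 le_rfl ha hσ
  have h5 : μ.keys[ρ 64]? = some (μ.key (a.eval s)) := by rw [h2]; exact getElem?_keys ha'
  have one_lt : 1 < 2 ^ μ.w := Nat.one_lt_two_pow μ.w_pos.ne'
  split_ifs at h with hk
  · refine ⟨_, _, _, .seq h1 (.keyLE_true _ x.idx 64 j _ h5 hk), hσ.set x one_lt ?_ ?_, h⟩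
    · simp [Nat.mod_eq_of_lt one_lt]
    · intro r hr hx
      simp [hx, h4 r hr]
  · refine ⟨_, _, _, .seq h1 (.keyLE_false _ x.idx 64 j _ h5 hk), hσ.set x (by omega) ?_ ?_, h⟩
    · simp
    · intro r hr hx
      simp [hx, h4 r hr]

theorem Wp.emit {e : Expr} {s : St} {Q : St → ℕ → Prop} (he : e.Ok μ s)
    (h : Q { s with out := s.out ++ [e.eval s] } (e.cost + 1)) : μ.Wp (.emit e) s Q := by
  intro σ hσ
  obtain ⟨ρ, h1, h2, h3, h4⟩ := runs_expr e 64 le_rfl he hσ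
  refine ⟨_, _, _, .seq h1 (.emit _ 64), ?_, h⟩
  have := Rep.of_reg hσ h4
  exact ⟨this.mem_eq, by simp [hσ.out_eq, h2], this.reg_eq, this.env_lt, this.mem_lt⟩

theorem Wp.skip {s : St} {Q : St → ℕ → Prop} (h : Q s 1) : μ.Wp .skip s Q :=
  fun σ hσ => ⟨s, 1, σ, .skip σ, hσ, h⟩

theorem Wp.ite {e : Expr} {p q : Prog ι} {s : St} {Q : St → ℕ → Prop} (he : e.Ok μ s)
    (hp : e.eval s ≠ 0 → μ.Wp p s fun s' t => Q s' (e.cost + (t + 1)))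
    (hq : e.eval s = 0 → μ.Wp q s fun s' t => Q s' (e.cost + (t + 1))) :
    μ.Wp (.ite e p q) s Q := by
  intro σ hσ
  obtain ⟨ρ, h1, h2, h3, h4⟩ := runs_expr e 64 le_rfl he hσ
  by_cases h0 : e.eval s = 0
  · obtain ⟨s', t, σ', g1, g2, g3⟩ := hq h0 _ (Rep.of_reg hσ h4)
    exact ⟨s', _, σ', .seq h1 (.branch_false (by simpa [h2] using h0) g1), g2, g3⟩
  · obtain ⟨s', t, σ', g1, g2, g3⟩ := hp h0 _ (Rep.of_reg hσ h4)
    exact ⟨s', _, σ', .seq h1 (.branch_true (by simpa [h2] using h0) g1), g2, g3⟩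

/-- The rule for loops.  The index of the invariant bounds the number of iterations to come. -/
theorem Wp.loop {e : Expr} {p : Prog ι} (I : ℕ → St → Prop) (T : ℕ)
    (he : ∀ k s, I k s → e.Ok μ s)
    (hp : ∀ k s, I k s → e.eval s ≠ 0 →
      0 < k ∧ μ.Wp p s fun s' t => t ≤ T ∧ I (k - 1) s') {k : ℕ} {s : St} (h : I k s) :
    μ.Wp (.loop e p) s fun s' t =>
      t ≤ k * (T + e.cost + 1) + e.cost + 1 ∧ e.eval s' = 0 ∧ ∃ k', I k' s' := by
  -- The compiled loop tests register 64, so the induction carries along that this register holds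
  -- the current value of the condition; the compiled body ends by evaluating the condition anew.
  have key : ∀ (k : ℕ) (s : St) (σ : State), Rep μ s σ → I k s → σ.reg 64 = e.eval s →
      ∃ s' t σ', μ.Runs (.loop 64 (.seq p.code (e.code ι 64))) σ t σ' ∧ Rep μ s' σ' ∧
        t ≤ k * (T + e.cost + 1) + 1 ∧ e.eval s' = 0 ∧ ∃ k', I k' s' := by
    intro k
    induction k with
    | zero =>
      intro s σ hσ hI hr
      have h0 : e.eval s = 0 := by
        by_contra h0
        exact (lt_irrefl 0 (hp 0 s hI h0).1)
      exact ⟨s, 1, σ, .loop_done (hr.trans h0), hσ, by omega, h0, 0, hI⟩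
    | succ k ih =>
      intro s σ hσ hI hr
      by_cases h0 : e.eval s = 0
      · exact ⟨s, 1, σ, .loop_done (hr.trans h0), hσ, by omega, h0, _, hI⟩
      · obtain ⟨s1, t1, σ1, r1, rep1, ht1, hI1⟩ := (hp _ s hI h0).2 σ hσ
        obtain ⟨ρ, h1, h2, h3, h4⟩ := runs_expr e 64 le_rfl (he _ _ hI1) rep1
        obtain ⟨s', t, σ', g1, g2, g3, g4⟩ := ih s1 _ (Rep.of_reg rep1 h4) hI1 h2
        refine ⟨s', _, σ', .loop_step (by rwa [hr]) (.seq r1 h1) g1, g2, ?_, g4⟩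
        nlinarith
  intro σ hσ
  obtain ⟨ρ, h1, h2, h3, h4⟩ := runs_expr e 64 le_rfl (he _ _ h) hσ
  obtain ⟨s', t, σ', g1, g2, g3, g4⟩ := key k s _ (Rep.of_reg hσ h4) h h2
  exact ⟨s', _, σ', .seq h1 g1, g2, by omega, g4⟩

open Classical in
/-- The verification condition of a program; loops are left to `Wp`. -/
def Vc (μ : Machine ι) : Prog ι → (St → ℕ → Prop) → St → Prop
  | .skip, Q, s => Q s 1
  | .assign x e, Q, s => e.Ok μ s ∧ Q (s.set x (e.eval s)) (e.cost + 2)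
  | .store a e, Q, s => a.Ok μ s ∧ a.eval s < μ.size ∧ e.Ok μ s ∧
      Q (s.put (a.eval s) (e.eval s)) (a.cost + e.cost + 1)
  | .keyLT x a j, Q, s => a.Ok μ s ∧ a.eval s < μ.keySize ∧
      Q (s.set x (if μ.key (a.eval s) < μ.q j then 1 else 0)) (a.cost + 1)
  | .keyLE x a j, Q, s => a.Ok μ s ∧ a.eval s < μ.keySize ∧
      Q (s.set x (if μ.key (a.eval s) ≤ μ.q j then 1 else 0)) (a.cost + 1)
  | .emit e, Q, s => e.Ok μ s ∧ Q { s with out := s.out ++ [e.eval s] } (e.cost + 1)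
  | .seq p q, Q, s => Vc μ p (fun s1 t1 => Vc μ q (fun s2 t2 => Q s2 (t1 + t2)) s1) s
  | .ite e p q, Q, s => e.Ok μ s ∧
      (e.eval s ≠ 0 → Vc μ p (fun s' t => Q s' (e.cost + (t + 1))) s) ∧
      (e.eval s = 0 → Vc μ q (fun s' t => Q s' (e.cost + (t + 1))) s)
  | .loop e p, Q, s => μ.Wp (.loop e p) s Q

/-- With this, a piece of straight-line code is verified by unfolding `Vc` with `simp` and
discharging the resulting arithmetic, instead of applying one rule per instruction. -/
theorem Vc.wp {p : Prog ι} {Q : St → ℕ → Prop} {s : St} (h : μ.Vc p Q s) : μ.Wp p s Q := by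
  induction p generalizing Q s with
  | skip => exact Wp.skip h
  | assign x e => exact Wp.assign h.1 h.2
  | store a e => exact Wp.store h.1 h.2.1 h.2.2.1 h.2.2.2
  | keyLT x a j => exact Wp.keyLT h.1 h.2.1 h.2.2
  | keyLE x a j => exact Wp.keyLE h.1 h.2.1 h.2.2
  | emit e => exact Wp.emit h.1 h.2
  | seq p q ihp ihq => exact Wp.seq ((ihp h).mono fun _ _ h => ihq h)
  | ite e p q ihp ihq => exact Wp.ite h.1 (fun h0 => ihp (h.2.1 h0)) (fun h0 => ihq (h.2.2 h0))
  | loop e p => exact h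

end Machine

/-! ## Contiguous parts of lists -/

section Slice
variable {α β : Type*}

/-- The part of a list from position `l` (inclusive) to position `r` (exclusive). -/
def slice (xs : List α) (l r : ℕ) : List α := (xs.take r).drop l

theorem slice_eq_take_drop (xs : List α) (l r : ℕ) : slice xs l r = (xs.drop l).take (r - l) := by
  rw [slice, List.drop_take]

theorem length_slice {xs : List α} {l r : ℕ} (hr : r ≤ xs.length) :
    (slice xs l r).length = r - l := by
  simp [slice, Nat.min_eq_left hr]

theorem slice_self (xs : List α) (l : ℕ) : slice xs l l = [] := by
  simp [slice_eq_take_drop]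

theorem slice_append {xs : List α} {l m r : ℕ} (h1 : l ≤ m) (h2 : m ≤ r) :
    slice xs l m ++ slice xs m r = slice xs l r := by
  rw [slice_eq_take_drop, slice_eq_take_drop, slice_eq_take_drop,
    show r - l = (m - l) + (r - m) by omega, List.take_add, List.drop_drop,
    show l + (m - l) = m by omega]

theorem map_slice (f : α → β) (xs : List α) (l r : ℕ) :
    (slice xs l r).map f = slice (xs.map f) l r := by
  simp [slice, List.map_drop, List.map_take]

theorem mem_slice {xs : List α} {l r : ℕ} {a : α} :
    a ∈ slice xs l r ↔ ∃ i, l ≤ i ∧ i < r ∧ xs[i]? = some a := by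
  rw [slice_eq_take_drop, List.mem_iff_getElem?]
  constructor
  · rintro ⟨i, hi⟩
    rw [List.getElem?_take] at hi
    split_ifs at hi with h
    rw [List.getElem?_drop] at hi
    exact ⟨l + i, by omega, by omega, hi⟩
  · rintro ⟨i, h1, h2, h3⟩
    refine ⟨i - l, ?_⟩
    rw [List.getElem?_take, if_pos (by omega), List.getElem?_drop, show l + (i - l) = i by omega]
    exact h3

theorem slice_append_right {xs : List α} {k : ℕ} (hk : xs.length = k) (ys : List α) (l r : ℕ) :
    slice (xs ++ ys) (k + l) (k + r) = slice ys l r := by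
  subst hk
  simp [slice_eq_take_drop, Nat.add_sub_add_left]

theorem slice_append_left {xs ys : List α} {l r : ℕ} (h : r ≤ xs.length) :
    slice (xs ++ ys) l r = slice xs l r := by
  rw [slice, slice, List.take_append_of_le_length h]

/-- A sublist cut out by filtering is found by counting. -/
theorem slice_filter (p : α → Bool) (xs : List α) {l r : ℕ} (h : l ≤ r) :
    slice (xs.filter p) ((xs.take l).countP p) ((xs.take r).countP p) =
      (slice xs l r).filter p := by
  -- Cutting the filtered list at the image of `r` and then at the image of `l` isolates the
  -- filtered middle part, because the two counts are the lengths of the filtered prefixes.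
  have h1 : (xs.take r).filter p ++ (xs.drop r).filter p = xs.filter p := by
    rw [← List.filter_append, List.take_append_drop]
  have h2 : (xs.take l).filter p ++ (slice xs l r).filter p = (xs.take r).filter p := by
    rw [← List.filter_append]
    congr 1
    conv_rhs => rw [← List.take_append_drop l (xs.take r)]
    rw [List.take_take, Nat.min_eq_left h, slice]
  rw [List.countP_eq_length_filter, List.countP_eq_length_filter, ← h1,
    slice_append_left le_rfl, ← h2, slice, List.take_length, List.drop_left]

end Slice

/-! ## Sorting blocks -/

section ChunkSort
variable {α : Type*} (f : α → ℝ)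

/-- Sort a list by a real key. -/
noncomputable def sortBy (xs : List α) : List α :=
  open Classical in xs.insertionSort fun a b => f a ≤ f b

theorem sortBy_perm (xs : List α) : (sortBy f xs).Perm xs := by
  classical
  exact List.perm_insertionSort _ xs

theorem sortBy_pairwise (xs : List α) : (sortBy f xs).Pairwise fun a b => f a ≤ f b := by
  classical
  have : Std.Total fun a b : α => f a ≤ f b := ⟨fun a b => le_total (f a) (f b)⟩
  have : IsTrans α fun a b : α => f a ≤ f b := ⟨fun _ _ _ h h' => le_trans h h'⟩
  exact List.pairwise_insertionSort _ xs

/-- Sort each of the first `m` blocks of length `k`. -/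
noncomputable def chunkSort (k : ℕ) : ℕ → List α → List α
  | 0, xs => xs
  | m + 1, xs => sortBy f (xs.take k) ++ chunkSort k m (xs.drop k)

theorem length_chunkSort (k m : ℕ) (xs : List α) : (chunkSort f k m xs).length = xs.length := by
  induction m generalizing xs with
  | zero => rfl
  | succ m ih =>
    rw [chunkSort, List.length_append, (sortBy_perm f _).length_eq, ih, ← List.length_append,
      List.take_append_drop]

/-- Peeling off the first block lowers `i` by one. Only complete blocks are covered: the layers
leave an incomplete last block unsorted, and no query ever uses it. -/
theorem slice_chunkSort (k m : ℕ) (xs : List α) {i : ℕ} (hi : i < m)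
    (h : (i + 1) * k ≤ xs.length) :
    slice (chunkSort f k m xs) (i * k) ((i + 1) * k) =
      sortBy f (slice xs (i * k) ((i + 1) * k)) := by
  induction i generalizing m xs with
  | zero =>
    obtain ⟨m, rfl⟩ := Nat.exists_eq_succ_of_ne_zero hi.ne'
    have : (sortBy f (xs.take k)).length = k := by
      rw [(sortBy_perm f _).length_eq, List.length_take]; omega
    simp only [chunkSort, zero_mul, zero_add, one_mul]
    rw [slice_append_left (by omega)]
    simp [slice, this]
  | succ i ih =>
    obtain ⟨m, rfl⟩ := Nat.exists_eq_succ_of_ne_zero (by omega : m ≠ 0)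
    have hk : k ≤ xs.length := by nlinarith
    have h1 : (sortBy f (xs.take k)).length = k := by
      rw [(sortBy_perm f _).length_eq, List.length_take]; omega
    have h2 : (xs.take k).length = k := by simp [hk]
    have h3 : slice xs (k + i * k) (k + (i + 1) * k) =
        slice (xs.drop k) (i * k) ((i + 1) * k) := by
      conv_lhs => rw [← List.take_append_drop k xs]
      rw [slice_append_right h2]
    rw [chunkSort, show (i + 1 + 1) * k = k + (i + 1) * k by ring,
      show (i + 1) * k = k + i * k by ring, slice_append_right h1,
      show k + i * k = (i + 1) * k by ring, ih m _ (by omega)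
        (by simp only [List.length_drop]; nlinarith [Nat.sub_add_cancel hk]), ← h3,
      show k + i * k = (i + 1) * k by ring]

end ChunkSort

/-! ## Lists in memory -/

/-- The list `xs` lies in memory from address `a` on. -/
def Holds (m : ℕ → ℕ) (a : ℕ) (xs : List ℕ) : Prop :=
  ∀ i (hi : i < xs.length), m (a + i) = xs[i]

theorem holds_nil (m : ℕ → ℕ) (a : ℕ) : Holds m a [] := fun i hi => absurd hi (by simp)

theorem holds_append {m : ℕ → ℕ} {a : ℕ} {xs ys : List ℕ} :
    Holds m a (xs ++ ys) ↔ Holds m a xs ∧ Holds m (a + xs.length) ys := by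
  constructor
  · refine fun h => ⟨fun i hi => ?_, fun i hi => ?_⟩
    · rw [h i (by simp; omega), List.getElem_append_left hi]
    · rw [add_assoc, h (xs.length + i) (by simp; omega), List.getElem_append_right (by omega)]
      simp
  · rintro ⟨h1, h2⟩ i hi
    by_cases hlt : i < xs.length
    · rw [List.getElem_append_left hlt, h1 i hlt]
    · rw [List.getElem_append_right (by omega), ← h2, add_assoc,
        show xs.length + (i - xs.length) = i by omega]

theorem holds_cons {m : ℕ → ℕ} {a v : ℕ} {xs : List ℕ} :
    Holds m a (v :: xs) ↔ m a = v ∧ Holds m (a + 1) xs := by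
  rw [show v :: xs = [v] ++ xs from rfl, holds_append]
  simp [Holds]

theorem Holds.congr {m m' : ℕ → ℕ} {a : ℕ} {xs : List ℕ} (h : Holds m a xs)
    (hm : ∀ y, a ≤ y → y < a + xs.length → m' y = m y) : Holds m' a xs := fun i hi => by
  rw [hm _ (by omega) (by omega), h i hi]

/-- A list of intervals as a list of words. -/
def flat (I : List (ℕ × ℕ)) : List ℕ := I.flatMap fun p => [p.1, p.2]

@[simp] theorem flat_nil : flat [] = [] := rfl
@[simp] theorem flat_cons (p : ℕ × ℕ) (I : List (ℕ × ℕ)) : flat (p :: I) = p.1 :: p.2 :: flat I :=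
  rfl
@[simp] theorem flat_append (I J : List (ℕ × ℕ)) : flat (I ++ J) = flat I ++ flat J := by
  simp [flat]
@[simp] theorem length_flat (I : List (ℕ × ℕ)) : (flat I).length = 2 * I.length := by
  induction I with
  | nil => rfl
  | cons p I ih => simp [ih]; omega

open Var
open Domination.Expr (const)

/-! ## Loops over a list in one buffer that write to the other -/

/-- Run `body` for each item of the buffer at `vX`; items have length `K`.  The body appends its
output at `vDst`, in the buffer at `vY`.  Afterwards the buffers are swapped. -/
def forEach {ι : Type} (K : Expr) (body : Prog ι) : Prog ι :=
  vSrc ::= vX ;; vDst ::= vY ;; vRem ::= vLen ;; vNum ::= const 0 ;;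
  .loop vRem (body ;; vSrc ::= vSrc + K ;; vRem ::= vRem - const 1) ;;
  vPos ::= vX ;; vX ::= vY ;; vY ::= vPos

/-- The states `s0` and `s` differ at most in the variables from `W` and in the memory cells of the
buffer of length `B` at `Y`. -/
structure Frame (W : List Var) (Y B : ℕ) (s0 s : St) : Prop where
  env : ∀ v, v ∉ W → s.env v = s0.env v
  mem : ∀ a, a < Y ∨ Y + B ≤ a → s.mem a = s0.mem a

theorem Frame.refl (W : List Var) (Y B : ℕ) (s : St) : Frame W Y B s s :=
  ⟨fun _ _ => rfl, fun _ _ => rfl⟩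

theorem Frame.trans {W W' : List Var} {Y B : ℕ} {s0 s s' : St} (h : Frame W Y B s0 s)
    (h' : Frame W' Y B s s') (hW : ∀ v ∈ W', v ∈ W) : Frame W Y B s0 s' :=
  ⟨fun v hv => by rw [h'.env v fun hv' => hv (hW v hv'), h.env v hv],
    fun a ha => by rw [h'.mem a ha, h.mem a ha]⟩

theorem Frame.set {W : List Var} {Y B : ℕ} {s0 s : St} (h : Frame W Y B s0 s) {x : Var}
    (hx : x ∈ W) (v : ℕ) : Frame W Y B s0 (s.set x v) := by
  refine ⟨fun y hy => ?_, h.mem⟩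
  rw [St.env_set, if_neg (by rintro rfl; exact hy hx), h.env y hy]

theorem Frame.put {W : List Var} {Y B : ℕ} {s0 s : St} (h : Frame W Y B s0 s) {a : ℕ}
    (ha : Y ≤ a) (ha' : a < Y + B) (v : ℕ) : Frame W Y B s0 (s.put a v) := by
  refine ⟨h.env, fun y hy => ?_⟩
  rw [St.mem_put, if_neg (by omega), h.mem y hy]

namespace Machine
variable {ι : Type} {μ : Machine ι}

theorem one_lt_two_pow (μ : Machine ι) : 1 < 2 ^ μ.w := Nat.one_lt_two_pow μ.w_pos.ne'

/-- `P done outs num out` is the invariant of the client: it relates the items treated so far to the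
words written, the counter and the report. The input stays readable because the body writes only
into the other, disjoint buffer. All encodings have the same length, so the number of treated items
determines the reading position. `K` must have the value `kv` in every state the frame allows,
because it is evaluated after each run of the body. -/
theorem Wp.forEach {α : Type*} (xs : List α) (enc : α → List ℕ) (kv : ℕ) (K : Expr)
    (body : Prog ι) (W : List Var) (B T : ℕ) (s0 : St)
    (P : List α → List ℕ → ℕ → List ℕ → Prop)
    (henc : ∀ x ∈ xs, (enc x).length = kv)
    (hW : vSrc ∈ W ∧ vDst ∈ W ∧ vRem ∈ W ∧ vNum ∈ W ∧ vPos ∈ W) (hW' : vX ∉ W ∧ vY ∉ W)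
    (hXY : s0.env vX + B ≤ s0.env vY ∨ s0.env vY + B ≤ s0.env vX)
    (hlen : s0.env vLen = xs.length)
    (hX : Holds s0.mem (s0.env vX) (xs.flatMap enc))
    (hB : kv * xs.length ≤ B)
    (hlt : s0.env vX + B < 2 ^ μ.w)
    (hK : ∀ s, Frame W (s0.env vY) B s0 s → K.Ok μ s ∧ K.eval s = kv)
    (h0 : P [] [] 0 s0.out)
    (hbody : ∀ done x todo outs s, xs = done ++ x :: todo →
      P done outs (s.env vNum) s.out → Frame W (s0.env vY) B s0 s →
      Holds s.mem (s0.env vY) outs → s.env vDst = s0.env vY + outs.length →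
      s.env vSrc + kv ≤ s0.env vX + B → s0.env vX ≤ s.env vSrc →
      Holds s.mem (s.env vSrc) (enc x) →
      μ.Wp body s fun s' t => t ≤ T ∧ Frame W (s0.env vY) B s0 s' ∧
        s'.env vSrc = s.env vSrc ∧ s'.env vRem = s.env vRem ∧ ∃ o,
          Holds s'.mem (s0.env vY) (outs ++ o) ∧
          s'.env vDst = s0.env vY + (outs ++ o).length ∧
          P (done ++ [x]) (outs ++ o) (s'.env vNum) s'.out) :
    μ.Wp (Domination.forEach K body) s0 fun s' t =>
      t ≤ xs.length * (T + K.cost + 20) + 50 ∧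
      (∀ v, v ∉ W → v ≠ vX → v ≠ vY → s'.env v = s0.env v) ∧
      (∀ a, a < s0.env vY ∨ s0.env vY + B ≤ a → s'.mem a = s0.mem a) ∧
      s'.env vX = s0.env vY ∧ s'.env vY = s0.env vX ∧
      ∃ outs, Holds s'.mem (s0.env vY) outs ∧ P xs outs (s'.env vNum) s'.out := by
  obtain ⟨hSrc, hDst, hRem, hNum, hPos⟩ := hW
  have one_lt := μ.one_lt_two_pow
  set Y := s0.env vY with hY
  set X := s0.env vX with hXdef
  have hlenflat : ∀ ys : List α, (∀ y ∈ ys, y ∈ xs) →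
      (ys.flatMap enc).length = kv * ys.length := by
    intro ys
    induction ys with
    | nil => simp
    | cons y ys ih =>
      intro h
      rw [List.flatMap_cons, List.length_append, ih fun z hz => h z (by simp [hz]),
        henc y (h y (by simp)), List.length_cons]
      ring
  let J : ℕ → St → Prop := fun k s => ∃ done todo outs, xs = done ++ todo ∧ todo.length = k ∧
    Frame W Y B s0 s ∧ Holds s.mem Y outs ∧ s.env vDst = Y + outs.length ∧
    P done outs (s.env vNum) s.out ∧ s.env vSrc = X + kv * done.length ∧ s.env vRem = k
  have hloop : ∀ k s, J k s → μ.Wp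
      (.loop vRem (body ;; vSrc ::= vSrc + K ;; vRem ::= vRem - const 1)) s fun s' t =>
        t ≤ k * ((T + K.cost + 14) + 2 + 1) + 2 + 1 ∧ (Expr.var vRem).eval s' = 0 ∧
          ∃ k', J k' s' := by
    intro k s hJ
    refine Wp.loop J (T + K.cost + 14) (fun _ _ _ => Expr.ok_var _ _ _) ?_ hJ
    rintro k s ⟨done, todo, outs, e, hk, hF, hH, hd, hP, hs, hr⟩ hne
    rw [Expr.eval_var, hr] at hne
    obtain ⟨x, todo, rfl⟩ : ∃ x l, todo = x :: l := by
      cases todo with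
      | nil => exact absurd hk.symm hne
      | cons x l => exact ⟨x, l, rfl⟩
    have hlx : kv * done.length + kv ≤ kv * xs.length := by
      rw [e]; simp only [List.length_append, List.length_cons]; nlinarith
    refine ⟨by omega, Wp.seq (Wp.mono (hbody done x todo outs s e hP hF hH hd (by omega)
      (by omega) ?_) ?_)⟩
    · have h1 : Holds s.mem X (xs.flatMap enc) := by
        refine hX.congr fun y h1 h2 => hF.mem y ?_
        rw [hlenflat xs fun _ h => h] at h2
        omega
      rw [e, List.flatMap_append, holds_append, List.flatMap_cons, holds_append,
        hlenflat done fun y hy => by rw [e]; simp [hy], ← hs] at h1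
      exact h1.2.1
    · rintro s' t ⟨ht, hF', hs', hr', o, ho, hd', hP'⟩
      obtain ⟨hK1, hK2⟩ := hK s' hF'
      apply Vc.wp
      have hr1 : s'.env vRem = todo.length + 1 := by rw [hr', hr, ← hk]; rfl
      have hK3 : K.eval (s'.set vSrc (s'.env vSrc + kv)) = K.eval s' := by
        rw [(hK _ (hF'.set hSrc _)).2, hK2]
      simp only [Vc, Expr.ok_add, Expr.ok_var, Expr.ok_sub, Expr.ok_const, Expr.eval_add,
        Expr.eval_var, Expr.eval_sub, Expr.eval_const, St.env_set, hK2, hK1, hs', hs, hr1,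
        Expr.cost_add, Expr.cost_sub, Expr.cost_var, Expr.cost_const, true_and, reduceCtorEq,
        if_false]
      refine ⟨by omega, ⟨one_lt, by omega⟩, by omega, done ++ [x], todo, outs ++ o, by simp [e],
        by simp at hk; omega, (hF'.set hSrc _).set hRem _, ho, by simpa using hd', by simpa using hP',
        ?_, ?_⟩
      · simp; ring
      · simp at hk; simp; omega
  apply Wp.seq; apply Wp.assign (Expr.ok_var _ _ _)
  apply Wp.seq; apply Wp.assign (Expr.ok_var _ _ _)
  apply Wp.seq; apply Wp.assign (Expr.ok_var _ _ _)
  apply Wp.seq; apply Wp.assign (by simp)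
  apply Wp.seq
  refine (hloop xs.length _ ⟨[], xs, [], rfl, rfl, ?_, holds_nil _ _, ?_, ?_, ?_, ?_⟩).mono ?_
  · exact ((((Frame.refl W Y B s0).set hSrc _).set hDst _).set hRem _).set hNum _
  · simp [hY]
  · simpa using h0
  · simp [hXdef]
  · simp [hlen]
  rintro s t ⟨ht, hz, k, done, todo, outs, e, hk, hF, hH, hd, hP, hs, hr⟩
  rw [Expr.eval_var, hr] at hz
  subst hz
  obtain rfl : todo = [] := List.length_eq_zero_iff.1 hk
  obtain rfl : xs = done := by simpa using e
  apply Vc.wp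
  simp only [Vc, Expr.ok_var, Expr.eval_var, St.env_set, Expr.cost_var, Expr.cost_const, true_and,
    reduceCtorEq, if_false, St.mem_set, St.out_set, if_true]
  refine ⟨?_, ?_, hF.mem, ?_, ?_, outs, hH, hP⟩
  · have : xs.length * (T + K.cost + 14 + 2 + 1) ≤ xs.length * (T + K.cost + 20) :=
      Nat.mul_le_mul_left _ (by omega)
    omega
  · intro v h1 h2 h3
    simp only [h2, h3, if_false, show v ≠ vPos by rintro rfl; exact h1 hPos, hF.env v h1]
  · exact hF.env vY hW'.2
  · exact hF.env vX hW'.1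

end Machine

/-! ## Binary search -/

/-- Binary search between `vl` and `vr`.  The program `cmp` sets `vc` to the truth value at `vMid`
of a predicate that is true on an initial part; `vl` becomes the end of that part. -/
def bsearch {ι : Type} (cmp : Prog ι) : Prog ι :=
  vHi ::= vr ;;
  .loop (.less vl vHi)
    (vMid ::= (vl + vHi) / const 2 ;; cmp ;;
      .ite vc (vl ::= vMid + const 1) (vHi ::= vMid))

/-- Restrict each block in the buffer at `vX` to the part in which the `j`-th coordinate lies
between the bounds of the query. -/
def search {d : ℕ} (j : Fin d) : Prog (Fin d ⊕ Fin d) :=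
  forEach (const 2)
    (vl ::= .load vSrc ;; vr ::= .load (vSrc + const 1) ;;
      bsearch (.keyLT vc (vKb + vMid) (.inl j)) ;; .store vDst vl ;;
      bsearch (.keyLE vc (vKb + vMid) (.inr j)) ;; .store (vDst + const 1) vl ;;
      vNum ::= vNum + (vl - .load vDst) ;; vDst ::= vDst + const 2)

namespace Machine
variable {ι : Type} {μ : Machine ι}

-- The index of the loop invariant is the exponent in `vHi - vl < 2 ^ k`. Each round at least halves
-- this length, so a range shorter than 2^k takes at most `k` rounds. The bound on `2 * r` prevents
-- overflow in the computation of the midpoint.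
open Classical in
theorem Wp.bsearch (cmp : Prog ι) (s0 : St) (P : ℕ → Prop) {l r k T : ℕ} (hl : s0.env vl = l)
    (hr : s0.env vr = r) (hlr : l ≤ r) (hk : r - l < 2 ^ k) (hw : 2 * r + 2 < 2 ^ μ.w)
    (hmono : ∀ a b, l ≤ a → a ≤ b → b < r → P b → P a)
    (hcmp : ∀ s Q, (∀ v, v ∉ [vl, vHi, vMid, vc] → s.env v = s0.env v) → s.env vMid < r →
      Q (s.set vc (if P (s.env vMid) then 1 else 0)) T → μ.Wp cmp s Q) :
    μ.Wp (Domination.bsearch cmp) s0 fun s' t => t ≤ k * (T + 30) + 20 ∧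
      (∀ v, v ∉ [vl, vHi, vMid, vc] → s'.env v = s0.env v) ∧ s'.mem = s0.mem ∧
      s'.out = s0.out ∧ l ≤ s'.env vl ∧ s'.env vl ≤ r ∧ (∀ a, l ≤ a → a < s'.env vl → P a) ∧
      ∀ a, s'.env vl ≤ a → a < r → ¬ P a := by
  have one_lt := μ.one_lt_two_pow
  let I : ℕ → St → Prop := fun k s => s.env vHi - s.env vl < 2 ^ k ∧ l ≤ s.env vl ∧
    s.env vl ≤ s.env vHi ∧ s.env vHi ≤ r ∧
    (∀ v, v ∉ [vl, vHi, vMid, vc] → s.env v = s0.env v) ∧ s.mem = s0.mem ∧ s.out = s0.out ∧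
    (∀ a, l ≤ a → a < s.env vl → P a) ∧ ∀ a, s.env vHi ≤ a → a < r → ¬ P a
  have hloop : ∀ s, I k s → μ.Wp (.loop (.less vl vHi)
      (vMid ::= (vl + vHi) / const 2 ;; cmp ;;
        .ite vc (vl ::= vMid + const 1) (vHi ::= vMid))) s fun s' t =>
      t ≤ k * ((T + 20) + 5 + 1) + 5 + 1 ∧ (Expr.less vl vHi).eval s' = 0 ∧ ∃ k', I k' s' := by
    intro s hI
    refine Wp.loop I (T + 20) (by simp) ?_ hI
    rintro k s ⟨h1, h2, h3, h4, h5, h6, h7, h8, h9⟩ hne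
    have hlt : s.env vl < s.env vHi := by
      by_contra hlt
      simp [hlt] at hne
    obtain ⟨k, rfl⟩ : ∃ k', k = k' + 1 := by
      refine Nat.exists_eq_succ_of_ne_zero ?_
      rintro rfl
      simp at h1; omega
    rw [pow_succ] at h1
    refine ⟨by omega, ?_⟩
    apply Wp.seq
    refine Wp.assign ?_ ?_
    · simp
      omega
    apply Wp.seq
    refine hcmp _ _ ?_ ?_ ?_
    · intro v hv
      rw [St.env_set, if_neg (by rintro rfl; simp at hv), h5 v hv]
    · simp; omega
    · set m := (s.env vl + s.env vHi) / 2 with hm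
      have hm' : ((vl + vHi) / const 2 : Expr).eval s = m := by simp [hm]
      rw [hm']
      apply Vc.wp
      simp only [Vc, Expr.ok_add, Expr.ok_var, Expr.ok_const, Expr.eval_add,
        Expr.eval_var, Expr.eval_const, St.env_set, true_and, reduceCtorEq, if_false, if_true,
        Expr.cost_add, Expr.cost_var, Expr.cost_const, Expr.cost_div, St.mem_set, St.out_set, I]
      constructor
      · intro hne
        have hP : P m := by by_contra hP; simp [hP] at hne
        refine ⟨by omega, by omega, by simp; omega, by omega, by omega, h4, ?_, h6, h7, ?_, h9⟩
        · intro v hv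
          have := h5 v hv
          simp only [List.mem_cons, not_or] at hv
          simp [hv, this]
        · intro a ha ha'
          by_cases h : a < s.env vl
          · exact h8 a ha h
          · exact hmono a m ha (by omega) (by omega) hP
      · intro hne
        have hP : ¬ P m := by intro hP; simp [hP] at hne
        refine ⟨by omega, by simp; omega, h2, by omega, by omega, ?_, h6, h7, h8, ?_⟩
        · intro v hv
          have := h5 v hv
          simp only [List.mem_cons, not_or] at hv
          simp [hv, this]
        · intro a ha ha' hPa
          exact hP (hmono m a (by omega) ha ha' hPa)
  apply Wp.seq
  apply Wp.assign (Expr.ok_var _ _ _)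
  refine (hloop (s0.set vHi _) ⟨?_, ?_, ?_, ?_, ?_, rfl, rfl, ?_, ?_⟩).mono ?_
  · simpa [hl, hr] using hk
  · simp [hl]
  · simp [hl, hr, hlr]
  · simp [hr]
  · intro v hv
    rw [St.env_set, if_neg (by rintro rfl; simp at hv)]
  · intro a h1 h2
    simp [hl] at h2
    omega
  · intro a h1 h2
    simp [hr] at h1
    omega
  · rintro s t ⟨ht, hz, k', h1, h2, h3, h4, h5, h6, h7, h8, h9⟩
    have hle : s.env vHi ≤ s.env vl := by
      by_contra hle
      simp [show s.env vl < s.env vHi by omega] at hz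
    refine ⟨?_, h5, h6, h7, h2, by omega, h8, fun a h => h9 a (by omega)⟩
    have : k * (T + 20 + 5 + 1) ≤ k * (T + 30) := Nat.mul_le_mul_left _ (by omega)
    simp only [Expr.cost_var]
    omega

end Machine

/-- The relation between a block and the part of it in which the key lies between two bounds. -/
def Cut (κ : ℕ → ℝ) (lo hi : ℝ) (p p' : ℕ × ℕ) : Prop :=
  p.1 ≤ p'.1 ∧ p'.1 ≤ p'.2 ∧ p'.2 ≤ p.2 ∧
    ∀ a, p.1 ≤ a → a < p.2 → ((p'.1 ≤ a ∧ a < p'.2) ↔ (lo ≤ κ a ∧ κ a ≤ hi))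

/-- The variables that searching changes. -/
def searchVars : List Var := [vSrc, vDst, vRem, vNum, vPos, vl, vr, vHi, vMid, vc]

namespace Machine

/-- Since a block is sorted, "less than the lower bound" and "at most the upper bound" hold on
initial parts of it, so two binary searches suffice; the second starts where the first ended. The
lengths are summed in `vNum` because, after the last coordinate, the sum is the number of points in
the query rectangle. -/
theorem Wp.search {d : ℕ} {μ : Machine (Fin d ⊕ Fin d)} (j : Fin d) (s0 : St)
    (I : List (ℕ × ℕ)) (B k R : ℕ)
    (hXY : s0.env vX + B ≤ s0.env vY ∨ s0.env vY + B ≤ s0.env vX)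
    (hlen : s0.env vLen = I.length) (hX : Holds s0.mem (s0.env vX) (flat I))
    (hB : 2 * I.length ≤ B) (hXs : s0.env vX + B ≤ μ.size) (hYs : s0.env vY + B ≤ μ.size)
    (hw : μ.size + 2 < 2 ^ μ.w)
    (hI : ∀ p ∈ I, p.1 ≤ p.2 ∧ p.2 - p.1 < 2 ^ k ∧ p.2 ≤ R ∧
      ∀ a b, p.1 ≤ a → a ≤ b → b < p.2 → μ.key (s0.env vKb + a) ≤ μ.key (s0.env vKb + b))
    (hR : 2 * R + 2 < 2 ^ μ.w) (hkey : s0.env vKb + R ≤ μ.keySize)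
    (hkw : μ.keySize < 2 ^ μ.w) (hsum : I.length * R < 2 ^ μ.w) :
    μ.Wp (Domination.search j) s0 fun s' t => t ≤ I.length * (100 * k + 200) + 50 ∧
      (∀ v, v ∉ searchVars → v ≠ vX → v ≠ vY → s'.env v = s0.env v) ∧
      (∀ a, a < s0.env vY ∨ s0.env vY + B ≤ a → s'.mem a = s0.mem a) ∧
      s'.env vX = s0.env vY ∧ s'.env vY = s0.env vX ∧ s'.out = s0.out ∧
      ∃ J, Holds s'.mem (s0.env vY) (flat J) ∧
        List.Forall₂ (Cut (fun a => μ.key (s0.env vKb + a)) (μ.q (.inl j)) (μ.q (.inr j))) I J ∧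
        s'.env vNum = (J.map fun p => p.2 - p.1).sum := by
  classical
  have one_lt := μ.one_lt_two_pow
  refine Wp.mono (Wp.forEach I (fun p => [p.1, p.2]) 2 (const 2) _ searchVars B
    (80 * k + 150) s0 (fun done outs num out => out = s0.out ∧ ∃ J, outs = flat J ∧
      List.Forall₂ (Cut (fun a => μ.key (s0.env vKb + a)) (μ.q (.inl j)) (μ.q (.inr j))) done J ∧
        num = (J.map fun p => p.2 - p.1).sum ∧ num ≤ done.length * R)
    (by simp) (by simp [searchVars]) (by simp [searchVars]) hXY hlen hX hB (by omega)
    (fun _ _ => ⟨by simp; omega, rfl⟩) ⟨rfl, [], rfl, .nil, rfl, by simp⟩ ?_) ?_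
  · rintro done x todo outs s e ⟨hout, J, rfl, hJ, hnum, hnumR⟩ hF hH hd hs1 hs2 hx
    have hxI := hI x (by rw [e]; simp)
    obtain ⟨hx1, hx2, hx3, hx4⟩ := hxI
    rw [holds_cons, holds_cons] at hx
    obtain ⟨e1, e2, -⟩ := hx
    have hKb : s.env vKb = s0.env vKb := hF.env _ (by simp [searchVars])
    have hdoneI : done.length + 1 ≤ I.length := by rw [e]; simp
    have hJl : J.length = done.length := hJ.length_eq.symm
    have hdst : s.env vDst + 2 ≤ s0.env vY + B := by
      rw [hd, length_flat]; omega
    apply Wp.seq; apply Wp.assign (by simp; omega)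
    apply Wp.seq; apply Wp.assign (by simp [μ.w_pos.ne']; omega)
    apply Wp.seq
    refine Wp.mono (Wp.bsearch (T := 6) (k := k) _ _
      (fun a => μ.key (s0.env vKb + a) < μ.q (.inl j)) (l := x.1) (r := x.2) (by simp [e1])
      (by simp [e2]) hx1 hx2 (by omega)
      (fun a b h1 h2 h3 h4 => (hx4 a b h1 h2 h3).trans_lt h4) ?_) ?_
    · intro s1 Q h1 h2 hQ
      have h3 : s1.env vKb = s0.env vKb := by rw [h1 vKb (by simp)]; simpa using hKb
      refine Wp.keyLT (by simp [h3]; omega) (by simp [h3]; omega) ?_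
      simpa [h3] using hQ
    rintro s1 t1 ⟨ht1, hv1, hm1, ho1, hl1, hl2, hl3, hl4⟩
    set l' := s1.env vl with hl'
    have hd1 : s1.env vDst = s.env vDst := by rw [hv1 _ (by simp)]; simp
    apply Wp.seq
    apply Wp.store (Expr.ok_var _ _ _) (by simp [hd1]; omega) (Expr.ok_var _ _ _)
    apply Wp.seq
    refine Wp.mono (Wp.bsearch (T := 6) (k := k) _ _
      (fun a => μ.key (s0.env vKb + a) ≤ μ.q (.inr j)) (l := l') (r := x.2) (by simp [hl'])
      (by simp [hv1, e2]) hl2 (by omega) (by omega)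
      (fun a b h1 h2 h3 h4 => (hx4 a b (by omega) h2 h3).trans h4) ?_) ?_
    · intro s2 Q h1 h2 hQ
      have h3 : s2.env vKb = s0.env vKb := by
        rw [h1 vKb (by simp), St.env_put, hv1 _ (by simp)]; simpa using hKb
      refine Wp.keyLE (by simp [h3]; omega) (by simp [h3]; omega) ?_
      simpa [h3] using hQ
    rintro s2 t2 ⟨ht2, hv2, hm2, ho2, gl1, gl2, gl3, gl4⟩
    set r' := s2.env vl with hr'
    have hd2 : s2.env vDst = s.env vDst := by rw [hv2 _ (by simp), St.env_put, hd1]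
    have hn2 : s2.env vNum = s.env vNum := by
      rw [hv2 _ (by simp), St.env_put, hv1 _ (by simp)]; simp
    have hload : s2.mem (s.env vDst) = l' := by
      rw [hm2, St.mem_put]; simp [hd1, hl']
    have hsR : s.env vNum + R ≤ I.length * R := by
      have := Nat.mul_le_mul_right R hdoneI
      rw [Nat.add_mul, one_mul] at this
      omega
    apply Vc.wp
    simp only [Vc, Expr.ok_add, Expr.ok_var, Expr.ok_const, Expr.eval_add, Expr.ok_sub,
      Expr.eval_var, Expr.eval_const, St.env_set, St.env_put, true_and, reduceCtorEq, if_false,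
      if_true, Expr.eval_sub, Expr.eval_load, Expr.ok_load, St.mem_set,
      Expr.cost_add, Expr.cost_var, Expr.cost_const, Expr.cost_sub, Expr.cost_load, St.out_set,
      ← hr', hd2, hn2, St.mem_put, show s.env vDst ≠ s.env vDst + 1 by omega, hload]
    refine ⟨⟨by omega, by omega⟩, by omega, ⟨⟨by omega, gl1⟩, by omega⟩, ⟨by omega, by omega⟩,
      by omega, ⟨?_, ?_⟩, ?_, ?_, flat [(l', r')], ?_, ?_, ?_, ?_⟩
    · intro v hv
      simp only [searchVars, List.mem_cons, not_or, List.not_mem_nil, not_false_eq_true,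
        and_true] at hv
      simp only [St.env_set, St.env_put, hv, if_false]
      rw [hv2 _ (by simp [hv]), St.env_put, hv1 _ (by simp [hv])]
      simp only [St.env_set, hv, if_false]
      exact hF.env v (by simp [searchVars, hv])
    · intro a ha
      rw [St.mem_set, St.mem_set, St.mem_put, if_neg (by omega), hm2, St.mem_put,
        if_neg (by simp [hd1]; omega), hm1]
      exact hF.mem a ha
    · rw [hv2 _ (by simp), St.env_put, hv1 _ (by simp)]; simp
    · rw [hv2 _ (by simp), St.env_put, hv1 _ (by simp)]; simp
    · rw [holds_append]
      constructor
      · refine hH.congr fun y h1 h2 => ?_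
        rw [St.mem_put, if_neg (by omega), hm2, St.mem_put,
          if_neg (by simp [hd1]; omega), hm1]
        rfl
      · rw [← hd]
        simp only [flat_cons, flat_nil, holds_cons]
        refine ⟨?_, ?_, holds_nil _ _⟩
        · rw [St.mem_put, if_neg (by omega), hload]
        · rw [St.mem_put, if_pos rfl]
    · rw [hd]; simp; omega
    · simp only [ho2, St.out_put, ho1, St.out_set, hout]
    · refine ⟨J ++ [(l', r')], by simp, List.rel_append hJ (.cons ?_ .nil), ?_, ?_⟩
      · refine ⟨hl1, gl1, gl2, fun a ha ha' => ⟨fun h => ⟨?_, gl3 a h.1 h.2⟩, fun h => ⟨?_, ?_⟩⟩⟩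
        · exact not_lt.1 (hl4 a h.1 ha')
        · by_contra hlt
          exact absurd (hl3 a ha (by omega)) (not_lt.2 h.1)
        · by_contra hlt
          exact gl4 a (by omega) ha' h.2
      · simp [hnum]
      · simp only [List.length_append, List.length_cons, List.length_nil]
        rw [show (done.length + (0 + 1)) * R = done.length * R + R by ring]
        omega
  · rintro s' t ⟨h1, h2, h3, h4, h5, outs, h6, h7, J, rfl, h8, h9, -⟩
    refine ⟨?_, h2, h3, h4, h5, h7, J, h6, h8, h9⟩
    have : I.length * (80 * k + 150 + 1 + 20) ≤ I.length * (100 * k + 200) :=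
      Nat.mul_le_mul_left _ (by omega)
    simp only [Expr.cost_const] at h1
    omega

end Machine

/-! ## Cutting intervals into aligned blocks -/

/-- One step of cutting an interval into aligned blocks: cut off blocks of length `2 ^ s` at both
ends where the ends are odd multiples of `2 ^ s`. -/
def cutEnds (s : ℕ) (p : ℕ × ℕ) : ℕ × ℕ :=
  let l := p.1 + p.1 / 2 ^ s % 2 * (if p.1 < p.2 then 1 else 0) * 2 ^ s
  (l, p.2 - p.2 / 2 ^ s % 2 * (if l < p.2 then 1 else 0) * 2 ^ s)

/-- What remains of an interval after `s` steps. -/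
def ladder (p : ℕ × ℕ) : ℕ → ℕ × ℕ
  | 0 => p
  | s + 1 => cutEnds s (ladder p s)

/-- The blocks that step `s` cuts off, shifted by `s * M`. -/
def rungs (M : ℕ) (p : ℕ × ℕ) (s : ℕ) : List (ℕ × ℕ) :=
  [(s * M + (ladder p s).1, s * M + (ladder p (s + 1)).1),
    (s * M + (ladder p (s + 1)).2, s * M + (ladder p s).2)]

/-- All blocks of an interval. -/
def blocks (h M : ℕ) (p : ℕ × ℕ) : List (ℕ × ℕ) := (List.range h).flatMap (rungs M p)

@[simp] theorem length_blocks (h M : ℕ) (p : ℕ × ℕ) : (blocks h M p).length = 2 * h := by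
  simp [blocks, rungs, List.length_flatMap, mul_comm]

/-- An interval is empty, or its ends are multiples of `2 ^ s`. -/
def Aligned (s : ℕ) (p : ℕ × ℕ) : Prop :=
  p.1 ≤ p.2 ∧ (p.1 = p.2 ∨ 2 ^ s ∣ p.1 ∧ 2 ^ s ∣ p.2)

/-- Write the ends of a nonempty interval as 2^s a and 2^s b. Cutting off a block at each odd end
leaves even multiples of 2^s. An empty interval is left where it is, aligned or not; this is why
`Aligned` has a separate case for it. -/
theorem cutEnds_spec {s : ℕ} {p : ℕ × ℕ} (h : Aligned s p) :
    Aligned (s + 1) (cutEnds s p) ∧ p.1 ≤ (cutEnds s p).1 ∧ (cutEnds s p).2 ≤ p.2 ∧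
      ((cutEnds s p).1 = p.1 ∨ (cutEnds s p).1 = p.1 + 2 ^ s ∧ 2 ^ s ∣ p.1) ∧
      ((cutEnds s p).2 = p.2 ∨ p.2 = (cutEnds s p).2 + 2 ^ s ∧ 2 ^ s ∣ (cutEnds s p).2) := by
  obtain ⟨l, r⟩ := p
  obtain ⟨hlr, h⟩ := h
  have hpos : 0 < 2 ^ s := by positivity
  simp only at hlr h
  rcases hlr.eq_or_lt with rfl | hlt
  · simp [cutEnds, Aligned]
  · obtain ⟨⟨a, rfl⟩, ⟨b, rfl⟩⟩ := h.resolve_left hlt.ne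
    have hab : a < b := lt_of_mul_lt_mul_left hlt (Nat.zero_le _)
    have ha := Nat.mod_two_eq_zero_or_one a
    have hb := Nat.mod_two_eq_zero_or_one b
    have h1 : 2 ^ s * a + a % 2 * 2 ^ s = 2 ^ s * (a + a % 2) := by ring
    have h2 : 2 ^ s * b - b % 2 * 2 ^ s = 2 ^ s * (b - b % 2) := by
      rw [Nat.mul_sub, mul_comm (b % 2)]
    have even_a : a + a % 2 = 2 * ((a + 1) / 2) := by omega
    have even_b : b - b % 2 = 2 * (b / 2) := by omega
    have d1 : 2 ^ (s + 1) ∣ 2 ^ s * (a + a % 2) := by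
      rw [even_a, pow_succ, ← mul_assoc]; exact dvd_mul_right _ _
    have d2 : 2 ^ (s + 1) ∣ 2 ^ s * (b - b % 2) := by
      rw [even_b, pow_succ, ← mul_assoc]; exact dvd_mul_right _ _
    have e1 : (cutEnds s (2 ^ s * a, 2 ^ s * b)).1 = 2 ^ s * (a + a % 2) := by
      simp [cutEnds, hlt, Nat.mul_div_cancel_left _ hpos, h1]
    have e2 : (cutEnds s (2 ^ s * a, 2 ^ s * b)).2 =
        if a + a % 2 < b then 2 ^ s * (b - b % 2) else 2 ^ s * b := by
      have : (cutEnds s (2 ^ s * a, 2 ^ s * b)).2 = 2 ^ s * b - 2 ^ s * b / 2 ^ s % 2 *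
        (if (cutEnds s (2 ^ s * a, 2 ^ s * b)).1 < 2 ^ s * b then 1 else 0) * 2 ^ s := rfl
      rw [this, e1, Nat.mul_div_cancel_left _ hpos]
      simp only [Nat.mul_lt_mul_left hpos]
      split_ifs
      · rw [mul_one, h2]
      · simp
    refine ⟨⟨?_, ?_⟩, ?_, ?_, ?_, ?_⟩
    · rw [e1, e2]
      split_ifs
      · exact Nat.mul_le_mul_left _ (by omega)
      · exact Nat.mul_le_mul_left _ (by omega)
    · rw [e1, e2]
      split_ifs
      · exact Or.inr ⟨d1, d2⟩
      -- Here a < b ≤ a + a % 2, so a is odd and b = a + 1: the left cut has consumed the whole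
      -- interval.
      · left
        congr 1
        omega
    · rw [e1]
      exact Nat.mul_le_mul_left _ (by omega)
    · rw [e2]
      split_ifs
      · exact Nat.mul_le_mul_left _ (by omega)
      · exact le_rfl
    · rw [e1]
      rcases ha with ha | ha
      · left; rw [ha, add_zero]
      · right; rw [ha]; exact ⟨by ring, dvd_mul_right _ _⟩
    · rw [e2]
      split_ifs
      · rcases hb with hb | hb
        · left; rw [hb, Nat.sub_zero]
        · right
          refine ⟨?_, dvd_mul_right _ _⟩
          simp only
          rw [hb, ← Nat.mul_succ]
          congr 1
          omega
      · exact Or.inl rfl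

theorem ladder_aligned {p : ℕ × ℕ} (h : p.1 ≤ p.2) (s : ℕ) : Aligned s (ladder p s) := by
  induction s with
  | zero => exact ⟨h, Or.inr ⟨by simp, by simp⟩⟩
  | succ s ih => exact (cutEnds_spec ih).1

theorem ladder_le {p : ℕ × ℕ} (h : p.1 ≤ p.2) (s : ℕ) :
    p.1 ≤ (ladder p s).1 ∧ (ladder p s).2 ≤ p.2 := by
  induction s with
  | zero => exact ⟨le_rfl, le_rfl⟩
  | succ s ih =>
    have := cutEnds_spec (ladder_aligned h s)
    exact ⟨ih.1.trans this.2.1, this.2.2.1.trans ih.2⟩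

/-- The variables that cutting into blocks changes. -/
def expandVars : List Var :=
  [vSrc, vDst, vRem, vNum, vPos, vl, vr, vc, vs, vPw]

/-- One step of cutting the interval from `vl` to `vr` into aligned blocks, for `vPw = 2 ^ vs` and
`vPos = vs * vMj`. -/
def cutStep {ι : Type} : Prog ι :=
  vc ::= vl / vPw % const 2 * .less vl vr ;; .store vDst (vPos + vl) ;;
  vl ::= vl + vc * vPw ;; .store (vDst + const 1) (vPos + vl) ;;
  vc ::= vr / vPw % const 2 * .less vl vr ;; .store (vDst + const 3) (vPos + vr) ;;
  vr ::= vr - vc * vPw ;; .store (vDst + const 2) (vPos + vr) ;;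
  vDst ::= vDst + const 4 ;; vs ::= vs + const 1 ;; vPw ::= vPw * const 2 ;; vPos ::= vPos + vMj

/-- Cut each interval in the buffer at `vX` into aligned blocks. -/
def expand {ι : Type} : Prog ι :=
  forEach (const 2)
    (vl ::= .load vSrc ;; vr ::= .load (vSrc + const 1) ;;
      vs ::= const 0 ;; vPw ::= const 1 ;; vPos ::= const 0 ;; .loop (.less vs vH) cutStep) ;;
  vLen ::= vLen * (const 2 * vH) ;; vMj ::= vMj * vH ;; vKb ::= vKb + vM

namespace Machine
variable {ι : Type} {μ : Machine ι}

theorem Wp.cutStep (st : St) {i h : ℕ} {p : ℕ × ℕ} (hp : Aligned i p) (hl : st.env vl = p.1)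
    (hr : st.env vr = p.2) (hs : st.env vs = i) (hpw : st.env vPw = 2 ^ i) (hi : i < h)
    (hsize : st.env vDst + 4 ≤ μ.size) (hw : μ.size + 4 < 2 ^ μ.w) (hhw : 2 ^ h < 2 ^ μ.w)
    (hw1 : st.env vPos + p.2 < 2 ^ μ.w) (hw2 : st.env vPos + st.env vMj < 2 ^ μ.w) :
    μ.Wp Domination.cutStep st fun s' t => t ≤ 150 ∧ s'.env vs = i + 1 ∧
      s'.env vPw = 2 ^ (i + 1) ∧ s'.env vPos = st.env vPos + st.env vMj ∧
      s'.env vl = (cutEnds i p).1 ∧ s'.env vr = (cutEnds i p).2 ∧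
      s'.env vDst = st.env vDst + 4 ∧
      (∀ v, v ∉ [vc, vl, vr, vDst, vs, vPw, vPos] → s'.env v = st.env v) ∧ s'.out = st.out ∧
      (∀ a, a < st.env vDst ∨ st.env vDst + 4 ≤ a → s'.mem a = st.mem a) ∧
      Holds s'.mem (st.env vDst) (flat [(st.env vPos + p.1, st.env vPos + (cutEnds i p).1),
        (st.env vPos + (cutEnds i p).2, st.env vPos + p.2)]) := by
  have one_lt := μ.one_lt_two_pow
  obtain ⟨l, r⟩ := p
  simp only at hl hr hw1
  obtain ⟨hal', hmono1, hmono2, -⟩ := cutEnds_spec hp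
  have q1 : l + l / 2 ^ i % 2 * (if l < r then 1 else 0) * 2 ^ i = (cutEnds i (l, r)).1 := rfl
  have q2 : r - r / 2 ^ i % 2 * (if (cutEnds i (l, r)).1 < r then 1 else 0) * 2 ^ i =
      (cutEnds i (l, r)).2 := rfl
  have c1 : l / 2 ^ i % 2 * (if l < r then 1 else 0) ≤ 1 := by
    have := Nat.mod_lt (l / 2 ^ i) two_pos
    split_ifs <;> omega
  have c2 : r / 2 ^ i % 2 * (if (cutEnds i (l, r)).1 < r then 1 else 0) ≤ 1 := by
    have := Nat.mod_lt (r / 2 ^ i) two_pos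
    split_ifs <;> omega
  have c3 : r / 2 ^ i % 2 * (if (cutEnds i (l, r)).1 < r then 1 else 0) * 2 ^ i ≤ r := by
    refine le_trans ?_ (Nat.div_mul_le_self r (2 ^ i))
    refine Nat.mul_le_mul_right _ ?_
    have := Nat.mod_le (r / 2 ^ i) 2
    split_ifs <;> omega
  have hpw2 : 2 ^ i * 2 ≤ 2 ^ h := by
    rw [← pow_succ]; exact Nat.pow_le_pow_right two_pos hi
  have hih : i < 2 ^ i := Nat.lt_two_pow_self
  have hle1 : l ≤ r := hp.1
  have hle2 := hal'.1
  simp only at hmono1 hmono2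
  -- The cut bits and the new ends become variables, so that the side conditions are linear in these
  -- and the products with `2 ^ i`, as `omega` needs.
  generalize hg1 : l / 2 ^ i % 2 * (if l < r then 1 else 0) = g1 at *
  generalize hg2 : r / 2 ^ i % 2 * (if (cutEnds i (l, r)).1 < r then 1 else 0) = g2 at *
  generalize (cutEnds i (l, r)).1 = l' at *
  generalize (cutEnds i (l, r)).2 = r' at *
  have hl1 : l / 2 ^ i % 2 < 2 := Nat.mod_lt _ two_pos
  have hr1 : r / 2 ^ i % 2 < 2 := Nat.mod_lt _ two_pos
  clear hal' hp
  have two_lt : 2 < 2 ^ μ.w := by omega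
  have m1 : g1 * 2 ^ i < 2 ^ μ.w := by omega
  have m2 : g2 * 2 ^ i < 2 ^ μ.w := by omega
  have b1 : g1 < 2 ^ μ.w := by omega
  have b2 : g2 < 2 ^ μ.w := by omega
  have p1 : st.env vPos + l < 2 ^ μ.w := by omega
  have p2 : st.env vPos + l' < 2 ^ μ.w := by omega
  have p3 : st.env vPos + r' < 2 ^ μ.w := by omega
  have l1 : l' < 2 ^ μ.w := by omega
  apply Vc.wp
  simp only [Domination.cutStep, Vc, Expr.ok_add, Expr.ok_var, Expr.ok_const, Expr.eval_add,
    Expr.ok_sub,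
    Expr.eval_var, Expr.eval_const, St.env_set, St.env_put, true_and, reduceCtorEq, if_false,
    if_true, Expr.eval_sub, Expr.eval_mul, Expr.eval_div, Expr.eval_mod, Expr.eval_less,
    Expr.ok_mul, Expr.ok_div, Expr.ok_mod, Expr.ok_less, and_true,
    Expr.cost_add, Expr.cost_var, Expr.cost_const, Expr.cost_sub, Expr.cost_mul,
    Expr.cost_div, Expr.cost_mod, Expr.cost_less, St.out_set, St.out_put,
    hl, hr, hs, hpw, q1, q2, hg1, hg2, one_lt, two_lt, m1, m2, b1, b2, p1, p2, p3, l1, hw1, hw2, c3]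
  refine ⟨by omega, by omega, by omega, ⟨by omega, by omega⟩, by omega, by omega, by omega,
    ⟨by omega, by omega⟩, by omega, by omega, by norm_num, by ring, ?_, ?_, ?_⟩
  · intro v hv
    simp only [List.mem_cons, not_or] at hv
    simp [hv]
  · intro a ha
    simp only [St.mem_set, St.mem_put]
    rw [if_neg (by omega), if_neg (by omega), if_neg (by omega), if_neg (by omega)]
  · simp only [flat_cons, flat_nil, holds_cons, St.mem_put, St.mem_set, add_assoc, Nat.reduceAdd]
    simp [holds_nil]

/-- Empty blocks are written too, so every interval yields exactly 2h blocks. The length of the list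
thus does not depend on the query, and an interval needs 4h words of output. Advancing `vKb` moves
on to the coordinates of the next layer. -/
theorem Wp.expand (s0 : St) (I : List (ℕ × ℕ)) (B h M : ℕ) (hh : s0.env vH = h)
    (hM : s0.env vMj = M)
    (hXY : s0.env vX + B ≤ s0.env vY ∨ s0.env vY + B ≤ s0.env vX)
    (hlen : s0.env vLen = I.length) (hX : Holds s0.mem (s0.env vX) (flat I))
    (hB : I.length * (4 * h) ≤ B) (hh1 : 1 ≤ h) (hXs : s0.env vX + B ≤ μ.size)
    (hYs : s0.env vY + B ≤ μ.size) (hw : μ.size + 4 < 2 ^ μ.w)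
    (hI : ∀ p ∈ I, p.1 ≤ p.2 ∧ p.2 ≤ M)
    (hMw : M * h < 2 ^ μ.w) (hhw : 2 ^ h < 2 ^ μ.w) (h2w : 2 * h < 2 ^ μ.w)
    (hkb : s0.env vKb + s0.env vM < 2 ^ μ.w) :
    μ.Wp Domination.expand s0 fun s' t => t ≤ I.length * (200 * h + 100) + 100 ∧
      (∀ v, v ∉ expandVars → v ∉ [vX, vY, vLen, vMj, vKb] → s'.env v = s0.env v) ∧
      (∀ a, a < s0.env vY ∨ s0.env vY + B ≤ a → s'.mem a = s0.mem a) ∧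
      s'.env vX = s0.env vY ∧ s'.env vY = s0.env vX ∧ s'.out = s0.out ∧
      s'.env vLen = I.length * (2 * h) ∧ s'.env vMj = M * h ∧
      s'.env vKb = s0.env vKb + s0.env vM ∧
      Holds s'.mem (s0.env vY) (flat (I.flatMap (blocks h M))) := by
  have one_lt := μ.one_lt_two_pow
  have w_ne := μ.w_pos.ne'
  have hBI : 2 * I.length ≤ B := by nlinarith
  apply Wp.seq
  refine Wp.mono (Wp.forEach I (fun p => [p.1, p.2]) 2 (const 2) _ expandVars B
    (160 * h + 70) s0 (fun done outs _ out => out = s0.out ∧ outs = flat (done.flatMap (blocks h M)))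
    (by simp) (by simp [expandVars]) (by simp [expandVars]) hXY hlen hX hBI (by omega)
    (fun _ _ => ⟨by simp; omega, rfl⟩) ⟨rfl, rfl⟩ ?_) ?_
  · rintro done x todo outs s e ⟨hout, houts⟩ hF hH hd hs1 hs2 hx
    obtain ⟨hx1, hx2⟩ := hI x (by rw [e]; simp)
    rw [holds_cons, holds_cons] at hx
    obtain ⟨e1, e2, -⟩ := hx
    have hdoneI : done.length + 1 ≤ I.length := by rw [e]; simp
    have hlenouts : outs.length = done.length * (4 * h) := by
      rw [houts, length_flat, List.length_flatMap]; simp; ring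
    have hroom : s0.env vY + outs.length + 4 * h ≤ s0.env vY + B := by
      have := Nat.mul_le_mul_right (4 * h) hdoneI
      rw [Nat.add_mul, one_mul] at this
      omega
    apply Wp.seq; apply Wp.assign (by simp; omega)
    apply Wp.seq; apply Wp.assign (by simp [w_ne]; omega)
    apply Wp.seq; apply Wp.assign (by simp)
    apply Wp.seq; apply Wp.assign (by simp [w_ne])
    apply Wp.seq; apply Wp.assign (by simp)
    let J : ℕ → St → Prop := fun k st => ∃ i, i + k = h ∧ st.env vs = i ∧ st.env vPw = 2 ^ i ∧
      st.env vPos = i * M ∧ st.env vl = (ladder x i).1 ∧ st.env vr = (ladder x i).2 ∧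
      Frame expandVars (s0.env vY) B s0 st ∧
      Holds st.mem (s0.env vY) (outs ++ flat ((List.range i).flatMap (rungs M x))) ∧
      st.env vDst = s0.env vY + outs.length + 4 * i ∧ st.env vSrc = s.env vSrc ∧
      st.env vRem = s.env vRem ∧ st.out = s.out
    refine Wp.mono (Wp.loop J 150 (by simp) ?_ (k := h) ?_) ?_
    · rintro k st ⟨i, hik, j1, j2, j3, j4, j5, jF, jH, j6, j7, j8, j9⟩ hne
      have jh : st.env vH = h := by rw [jF.env _ (by simp [expandVars]), hh]
      have jM : st.env vMj = M := by rw [jF.env _ (by simp [expandVars]), hM]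
      have hlt : i < h := by
        by_contra hlt
        simp [j1, jh, hlt] at hne
      have hle := ladder_le hx1 i
      have hmul : i * M + M ≤ M * h := by
        have := Nat.mul_le_mul_left M (Nat.succ_le_of_lt hlt)
        rw [Nat.mul_succ, mul_comm M i] at this
        exact this
      have hrl : ((List.range i).flatMap (rungs M x)).length = 2 * i := by
        simp [List.length_flatMap, rungs, mul_comm]
      refine ⟨by omega, Wp.mono (Wp.cutStep st (ladder_aligned hx1 i) j4 j5 j1 j2 hlt (by omega) hw
        hhw (by omega) (by omega)) ?_⟩
      rintro s' t ⟨ht, g1, g2, g3, g4, g5, g6, g7, g8, g9, g10⟩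
      refine ⟨ht, i + 1, by omega, g1, g2, ?_, g4, g5, ⟨?_, ?_⟩, ?_, by omega, ?_, ?_, ?_⟩
      · rw [g3, j3, jM]; ring
      · intro v hv
        rw [g7 v, jF.env v hv]
        simp only [expandVars, List.mem_cons, not_or] at hv
        simp [hv]
      · intro a ha
        rw [g9 a (by omega), jF.mem a ha]
      · rw [List.range_succ, List.flatMap_append, flat_append, ← List.append_assoc, holds_append]
        constructor
        · refine jH.congr fun y hy hy' => g9 y (Or.inl ?_)
          rw [List.length_append, length_flat, hrl] at hy'
          omega
        · rw [List.length_append, length_flat, hrl]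
          rw [j3, j6, show s0.env vY + outs.length + 4 * i =
            s0.env vY + (outs.length + 2 * (2 * i)) by ring] at g10
          simpa [rungs, ladder] using g10
      · rw [g7 _ (by simp), j7]
      · rw [g7 _ (by simp), j8]
      · rw [g8, j9]
    · refine ⟨0, by omega, by simp, by simp, by simp, by simp [ladder, e1], by simp [ladder, e2],
        ((((hF.set ?_ _).set ?_ _).set ?_ _).set ?_ _).set ?_ _, ?_, ?_, ?_, ?_, ?_⟩
      all_goals simp [expandVars]
      · exact hH
      · exact hd
    · rintro s' t ⟨ht, hz, k, i, hik, j1, j2, j3, j4, j5, jF, jH, j6, j7, j8, j9⟩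
      have jh : s'.env vH = h := by rw [jF.env _ (by simp [expandVars]), hh]
      have hih : i = h := by
        by_contra hne
        simp [j1, jh, show i < h by omega] at hz
      subst hih
      have hfin : flat ((List.range i).flatMap (rungs M x)) = flat (blocks i M x) := rfl
      refine ⟨?_, jF, j7, j8, flat (blocks i M x), jH, ?_, ?_, ?_⟩
      · simp only [Expr.cost_less, Expr.cost_var, Expr.cost_const, Expr.cost_add,
          Expr.cost_load] at ht ⊢
        omega
      · rw [j6, List.length_append, length_flat, length_blocks]; ring
      · rw [j9, ← hout]
      · rw [houts, List.flatMap_append, flat_append]; simp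
  · rintro s' t ⟨h1, h2, h3, h4, h5, outs, h6, h7, rfl⟩
    have hlen' : s'.env vLen = I.length := by
      rw [h2 _ (by simp [expandVars]) (by simp) (by simp), hlen]
    have hh' : s'.env vH = h := by rw [h2 _ (by simp [expandVars]) (by simp) (by simp), hh]
    have hMj' : s'.env vMj = M := by rw [h2 _ (by simp [expandVars]) (by simp) (by simp), hM]
    have hKb' : s'.env vKb = s0.env vKb := h2 _ (by simp [expandVars]) (by simp) (by simp)
    have hM' : s'.env vM = s0.env vM := h2 _ (by simp [expandVars]) (by simp) (by simp)
    have hlB : I.length * (2 * h) ≤ B := by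
      refine le_trans (Nat.mul_le_mul_left _ ?_) hB; omega
    apply Vc.wp
    simp only [Vc, Expr.ok_add, Expr.ok_var, Expr.ok_const, Expr.eval_add,
      Expr.eval_var, Expr.eval_const, St.env_set, true_and, reduceCtorEq, if_false,
      if_true, Expr.eval_mul, Expr.ok_mul, Expr.cost_add, Expr.cost_var, Expr.cost_const,
      Expr.cost_mul, St.out_set, St.mem_set, hlen', hh', hMj', hKb', hM', h4, h5, h7]
    refine ⟨⟨⟨by omega, h2w⟩, by omega⟩, by omega, by omega, ?_, ?_, h3, h6⟩
    · simp only [Expr.cost_const] at h1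
      have : I.length * (160 * h + 70 + 1 + 20) ≤ I.length * (200 * h + 100) :=
        Nat.mul_le_mul_left _ (by omega)
      omega
    · intro v hv hv'
      simp only [List.mem_cons, not_or] at hv'
      simp [hv', h2 v hv]

end Machine

/-! ## One level of the search for heavy colours -/

/-- With `vLev` fixed, the rank tables in memory describe the maps `f false` and `f true` on the
positions up to `M`. -/
def RankTables {ι : Type} (μ : Machine ι) (s : St) (f : Bool → ℕ → ℕ) (M : ℕ) : Prop :=
  ∀ p ≤ M, ∃ c o x, c = s.env vLev * s.env vNB + p / s.env vB ∧
    x = s.mem (s.env vBits + c) % 2 ^ (p % s.env vB) ∧ o = s.mem (s.env vPop + x) ∧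
    s.env vBits + c < s.env vWB ∧ s.env vPop + x < s.env vWB ∧ s.env vZ0 + c < s.env vWB ∧
    s.env vZ1 + c < s.env vWB ∧ 2 ^ (p % s.env vB) < 2 ^ μ.w ∧ o ≤ p % s.env vB ∧
    s.mem (s.env vZ1 + c) + o = f true p ∧ s.mem (s.env vZ0 + c) + (p % s.env vB - o) = f false p ∧
    f true p ≤ M ∧ f false p ≤ M

/-- The variables that describe the rank tables. -/
def tableVars : List Var := [vLev, vNB, vB, vPop, vBits, vZ0, vZ1, vWB]

theorem RankTables.congr {ι : Type} {μ : Machine ι} {s s' : St} {f : Bool → ℕ → ℕ} {M : ℕ}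
    (h : RankTables μ s f M) (he : ∀ v ∈ tableVars, s'.env v = s.env v)
    (hm : ∀ a < s.env vWB, s'.mem a = s.mem a) : RankTables μ s' f M := by
  intro p hp
  obtain ⟨c, o, x, h1, h2, h3, h4, h5, h6, h7, h8⟩ := h p hp
  have e1 := he vLev (by simp [tableVars])
  have e2 := he vNB (by simp [tableVars])
  have e3 := he vB (by simp [tableVars])
  have e4 := he vPop (by simp [tableVars])
  have e5 := he vBits (by simp [tableVars])
  have e6 := he vZ0 (by simp [tableVars])
  have e7 := he vZ1 (by simp [tableVars])
  have e8 := he vWB (by simp [tableVars])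
  refine ⟨c, o, x, ?_⟩
  rw [e1, e2, e3, e4, e5, e6, e7, e8, hm _ h4, hm _ h5, hm _ h6, hm _ h7]
  exact ⟨h1, h2, h3, h4, h5, h6, h7, h8⟩

/-- Set `x` to the position to which the position at address `a` is mapped. -/
def rank {ι : Type} (β : Bool) (x : Var) (a : Expr) : Prog ι :=
  vPos ::= .load a ;; vc ::= vLev * vNB + vPos / vB ;;
  vs ::= .load (vPop + .load (vBits + vc) % Expr.pow2 (vPos % vB)) ;;
  x ::= if β then .load (vZ1 + vc) + vs else .load (vZ0 + vc) + (vPos % vB - vs)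

/-- Map `vJ` intervals at `vMid` to intervals at `vHi`; add up their lengths in `vCnt`. -/
def mapIntervals {ι : Type} (β : Bool) : Prog ι :=
  .loop vJ
    (rank β vl vMid ;; rank β vr (vMid + const 1) ;; .store vHi vl ;; .store (vHi + const 1) vr ;;
      vCnt ::= vCnt + (vr - vl) ;; vMid ::= vMid + const 2 ;; vHi ::= vHi + const 2 ;;
      vJ ::= vJ - const 1)

/-- The total length of a list of intervals. -/
def total (I : List (ℕ × ℕ)) : ℕ := (I.map fun p => p.2 - p.1).sum

theorem total_le {I : List (ℕ × ℕ)} {M : ℕ} (h : ∀ p ∈ I, p.2 ≤ M) : total I ≤ I.length * M := by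
  refine (List.sum_le_card_nsmul _ M ?_).trans (by simp)
  simp only [List.mem_map]
  rintro _ ⟨p, hp, rfl⟩
  exact (Nat.sub_le _ _).trans (h p hp)

namespace Machine
variable {ι : Type} {μ : Machine ι}

/-- Constant time: the word that contains position `p` is masked to the bits before `p`, their
number is looked up, and the count stored for the start of the word is added. -/
theorem Wp.rank (s : St) {f : Bool → ℕ → ℕ} {M p : ℕ} (β : Bool) (x : Var) (a : Expr)
    (hf : RankTables μ s f M) (ha : a.Ok μ s) (ha' : a.eval s < μ.size) (hp : s.mem (a.eval s) = p)
    (hpM : p ≤ M) (hWB : s.env vWB ≤ μ.size) (hw : μ.size < 2 ^ μ.w) (hMw : M < 2 ^ μ.w) :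
    μ.Wp (Domination.rank β x a) s fun s' t => t ≤ a.cost + 60 ∧ s'.env x = f β p ∧
      (∀ v, v ∉ [x, vPos, vc, vs] → s'.env v = s.env v) ∧ s'.mem = s.mem ∧ s'.out = s.out := by
  obtain ⟨c, o, y, h1, h2, h3, h4, h5, h6, h7, h8, h9, h10, h11, h12, h13⟩ := hf p hpM
  have hc : s.env vLev * s.env vNB ≤ c := by rw [h1]; exact Nat.le_add_right _ _
  have b1 : s.env vLev * s.env vNB < 2 ^ μ.w := by omega
  have b2 : c < 2 ^ μ.w := by omega
  have b3 : s.env vBits + c < 2 ^ μ.w := by omega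
  have b4 : s.env vPop + y < 2 ^ μ.w := by omega
  have b5 : s.env vZ0 + c < 2 ^ μ.w := by omega
  have b6 : s.env vZ1 + c < 2 ^ μ.w := by omega
  have b7 : f true p < 2 ^ μ.w := by omega
  have b8 : f false p < 2 ^ μ.w := by omega
  have d1 : s.env vBits + c < μ.size := by omega
  have d2 : s.env vPop + y < μ.size := by omega
  have d3 : s.env vZ0 + c < μ.size := by omega
  have d4 : s.env vZ1 + c < μ.size := by omega
  apply Vc.wp
  cases β <;>
  simp only [Domination.rank, Vc, Expr.ok_add, Expr.ok_var, Expr.eval_add, Expr.ok_sub,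
    Expr.eval_var, St.env_set, true_and, reduceCtorEq, if_false, St.mem_set,
    if_true, Expr.eval_sub, Expr.eval_mul, Expr.eval_div, Expr.eval_mod, Expr.eval_load,
    Expr.ok_mul, Expr.ok_div, Expr.ok_mod, Expr.ok_load, Expr.eval_pow2, Expr.ok_pow2, and_true,
    Expr.cost_add, Expr.cost_var, Expr.cost_sub, Expr.cost_mul, Expr.cost_load,
    Expr.cost_div, Expr.cost_mod, Expr.cost_pow2, St.out_set, hp, ← h1, ← h2, ← h3,
    ha, ha', b1, b2, b3, b4, b5, b6, b7, b8, d1, d2, d3, d4, h8, h9, h10, h11, Bool.false_eq_true]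
  all_goals
    refine ⟨by omega, ?_⟩
    intro v hv
    simp only [List.mem_cons, not_or] at hv
    simp [hv]

/-- Monotonicity of `f β` makes the images intervals again, so the subtraction that yields a length
never underflows. -/
theorem Wp.mapIntervals (s0 : St) {f : Bool → ℕ → ℕ} {M : ℕ} (β : Bool) (I : List (ℕ × ℕ))
    (Y B : ℕ) (hf : RankTables μ s0 f M) (hmono : ∀ p q, p ≤ q → f β p ≤ f β q)
    (hI : ∀ p ∈ I, p.1 ≤ p.2 ∧ p.2 ≤ M) (hJ : s0.env vJ = I.length) (hcnt : s0.env vCnt = 0)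
    (hS : Holds s0.mem (s0.env vMid) (flat I))
    (hSY : s0.env vMid + 2 * I.length ≤ Y ∨ Y + B ≤ s0.env vMid)
    (hY : Y ≤ s0.env vHi) (hYB : s0.env vHi + 2 * I.length ≤ Y + B)
    (hWBY : s0.env vWB ≤ Y) (hYsize : Y + B ≤ μ.size) (hSsize : s0.env vMid + 2 * I.length ≤ μ.size)
    (hw : μ.size + 2 < 2 ^ μ.w) (hMw : M < 2 ^ μ.w) (hIM : I.length * M < 2 ^ μ.w) :
    μ.Wp (Domination.mapIntervals β) s0 fun s' t => t ≤ I.length * 250 + 10 ∧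
      Frame [vl, vr, vPos, vc, vs, vCnt, vMid, vHi, vJ] Y B s0 s' ∧ s'.out = s0.out ∧
      (∀ a, a < s0.env vHi → s'.mem a = s0.mem a) ∧
      s'.env vMid = s0.env vMid + 2 * I.length ∧ s'.env vHi = s0.env vHi + 2 * I.length ∧
      s'.env vCnt = total (I.map fun p => (f β p.1, f β p.2)) ∧
      Holds s'.mem (s0.env vHi) (flat (I.map fun p => (f β p.1, f β p.2))) := by
  have one_lt := μ.one_lt_two_pow
  have w_ne := μ.w_pos.ne'
  let K : ℕ → St → Prop := fun k s => ∃ done todo, I = done ++ todo ∧ todo.length = k ∧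
    Frame [vl, vr, vPos, vc, vs, vCnt, vMid, vHi, vJ] Y B s0 s ∧ s.out = s0.out ∧
    (∀ a, a < s0.env vHi → s.mem a = s0.mem a) ∧
    s.env vMid = s0.env vMid + 2 * done.length ∧ s.env vHi = s0.env vHi + 2 * done.length ∧
    s.env vCnt = total (done.map fun p => (f β p.1, f β p.2)) ∧ s.env vJ = k ∧
    Holds s.mem (s0.env vHi) (flat (done.map fun p => (f β p.1, f β p.2)))
  refine Wp.mono (Wp.loop K 230 (by simp) ?_ (k := I.length)
    ⟨[], I, rfl, rfl, .refl _ _ _ _, rfl, fun _ _ => rfl, by simp, by simp, by simpa [total],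
      hJ, holds_nil _ _⟩) ?_
  · rintro k s ⟨done, todo, e, hk, hF, hout, hlow, k1, k2, k3, k4, hH⟩ hne
    rw [Expr.eval_var, k4] at hne
    obtain ⟨x, todo, rfl⟩ : ∃ x l, todo = x :: l := by
      cases todo with
      | nil => exact absurd hk.symm hne
      | cons x l => exact ⟨x, l, rfl⟩
    have hlenI : I.length = done.length + (todo.length + 1) := by rw [e]; simp
    obtain ⟨hx1, hx2⟩ := hI x (by rw [e]; simp)
    have hSs : Holds s.mem (s0.env vMid) (flat I) := by
      refine hS.congr fun y h1 h2 => hF.mem y ?_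
      rw [length_flat] at h2
      omega
    rw [e, flat_append, holds_append, flat_cons, holds_cons, holds_cons, length_flat, ← k1] at hSs
    obtain ⟨-, e1, e2, -⟩ := hSs
    have hWs : s.env vWB = s0.env vWB := hF.env _ (by simp)
    have hfs : RankTables μ s f M := by
      refine hf.congr (fun v hv => hF.env v ?_) fun a ha => hF.mem a (Or.inl (by omega))
      intro hv'
      simp only [tableVars, List.mem_cons, List.not_mem_nil, or_false] at hv
      rcases hv with rfl | rfl | rfl | rfl | rfl | rfl | rfl | rfl <;> simp at hv'
    have htot : total (done.map fun p => (f β p.1, f β p.2)) + M ≤ I.length * M := by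
      have h1 : total (done.map fun p => (f β p.1, f β p.2)) ≤ done.length * M := by
        refine (total_le (M := M) ?_).trans (by simp)
        simp only [List.mem_map]
        rintro _ ⟨p, hp, rfl⟩
        obtain ⟨c, o, y, -, -, -, -, -, -, -, -, -, -, -, h12, h13⟩ :=
          hf p.2 (hI p (by rw [e]; simp [hp])).2
        cases β
        · exact h13
        · exact h12
      have h2 := Nat.mul_le_mul_right M (show done.length + 1 ≤ I.length by omega)
      rw [Nat.add_mul, one_mul] at h2
      omega
    refine ⟨by omega, ?_⟩
    apply Wp.seq
    refine Wp.mono (Wp.rank s β vl vMid hfs (Expr.ok_var _ _ _) (by simp; omega) e1 (by omega)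
      (by omega) (by omega) hMw) ?_
    rintro s1 t1 ⟨ht1, v1, env1, m1, o1⟩
    have hMid1 : s1.env vMid = s.env vMid := env1 _ (by simp)
    have hfs1 : RankTables μ s1 f M := by
      refine hfs.congr (fun v hv => env1 v ?_) fun a ha => by rw [m1]
      intro hv'
      simp only [tableVars, List.mem_cons, List.not_mem_nil, or_false] at hv
      rcases hv with rfl | rfl | rfl | rfl | rfl | rfl | rfl | rfl <;> simp at hv'
    apply Wp.seq
    refine Wp.mono (Wp.rank s1 (p := x.2) β vr (vMid + const 1) hfs1 (by simp [w_ne, hMid1]; omega)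
      (by simp [hMid1]; omega) (by simp [hMid1, m1, e2]) (by omega)
      (by rw [env1 _ (by simp)]; omega) (by omega) hMw) ?_
    rintro s2 t2 ⟨ht2, v2, env2, m2, o2⟩
    have vl2 : s2.env vl = f β x.1 := by rw [env2 _ (by simp), v1]
    have vMid2 : s2.env vMid = s.env vMid := by rw [env2 _ (by simp), hMid1]
    have vHi2 : s2.env vHi = s.env vHi := by rw [env2 _ (by simp), env1 _ (by simp)]
    have vCnt2 : s2.env vCnt = s.env vCnt := by rw [env2 _ (by simp), env1 _ (by simp)]
    have vJ2 : s2.env vJ = todo.length + 1 := by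
      rw [env2 _ (by simp), env1 _ (by simp), k4, ← hk]; rfl
    have hfx := hmono _ _ hx1
    have hfM : f β x.2 ≤ M := by
      obtain ⟨c, o, y, -, -, -, -, -, -, -, -, -, -, -, h12, h13⟩ := hf x.2 hx2
      cases β
      · exact h13
      · exact h12
    simp only [List.length_cons] at hk
    simp only [Expr.cost_var, Expr.cost_add, Expr.cost_const] at ht1 ht2
    have two_lt : 2 < 2 ^ μ.w := by omega
    apply Vc.wp
    simp only [Vc, Expr.ok_add, Expr.ok_var, Expr.ok_const, Expr.eval_add, Expr.ok_sub,
      Expr.eval_var, Expr.eval_const, St.env_set, St.env_put, true_and, reduceCtorEq, if_false,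
      Expr.eval_sub, Expr.cost_add, Expr.cost_var, Expr.cost_const, Expr.cost_sub,
      vl2, v2, vMid2, vHi2, vCnt2, vJ2, one_lt, two_lt, hfx]
    refine ⟨by omega, by omega, by omega, by omega, by omega, by omega, by omega, by omega,
      done ++ [x], todo, by simp [e], by omega, ⟨?_, ?_⟩, ?_, ?_, ?_, ?_, ?_, ?_, ?_⟩
    · intro v hv
      have hv' := hF.env v hv
      simp only [List.mem_cons, not_or, List.not_mem_nil, not_false_eq_true, and_true] at hv
      simp only [St.env_set, St.env_put, hv, if_false]
      rw [env2 _ (by simp [hv]), env1 _ (by simp [hv]), hv']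
    · intro a ha
      simp only [St.mem_set, St.mem_put, m2, m1]
      rw [if_neg (by omega), if_neg (by omega), hF.mem a ha]
    · simp only [St.out_set, St.out_put, o2, o1, hout]
    · intro a ha
      simp only [St.mem_set, St.mem_put, m2, m1]
      rw [if_neg (by omega), if_neg (by omega), hlow a ha]
    · simp; omega
    · simp; omega
    · simp [k3, total]
    · simp; omega
    · rw [List.map_append, flat_append, holds_append]
      constructor
      · refine hH.congr fun y h1 h2 => ?_
        rw [length_flat, List.length_map] at h2
        simp only [St.mem_set, St.mem_put, m2, m1]
        rw [if_neg (by omega), if_neg (by omega)]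
      · rw [length_flat, List.length_map, ← k2]
        simp [holds_cons, holds_nil, St.mem_put]
  · rintro s' t ⟨ht, hz, k, done, todo, e, hk, hF, hout, hlow, k1, k2, k3, k4, hH⟩
    rw [Expr.eval_var, k4] at hz
    subst hz
    obtain rfl : todo = [] := List.length_eq_zero_iff.1 hk
    obtain rfl : I = done := by simpa using e
    simp only [Expr.cost_var] at ht
    exact ⟨by omega, hF, hout, hlow, k1, k2, k3, hH⟩

end Machine

/-- The words that represent a path together with a list of intervals. -/
def nodeWords (x : ℕ × List (ℕ × ℕ)) : List ℕ := flat x.2 ++ [x.1]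

@[simp] theorem length_nodeWords (x : ℕ × List (ℕ × ℕ)) :
    (nodeWords x).length = 2 * x.2.length + 1 := by
  simp [nodeWords]

/-- A child of a node: extend the path by a bit with weight `pw`, and map the intervals. -/
def childNode (f : Bool → ℕ → ℕ) (pw : ℕ) (x : ℕ × List (ℕ × ℕ)) (β : Bool) :
    ℕ × List (ℕ × ℕ) :=
  (x.1 + if β then pw else 0, x.2.map fun p => (f β p.1, f β p.2))

/-- The children for which `thr` of the number of elements exceeds `acc`. -/
def heavyChildren (thr : ℕ → ℕ) (acc : ℕ) (f : Bool → ℕ → ℕ) (pw : ℕ)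
    (x : ℕ × List (ℕ × ℕ)) : List (ℕ × List (ℕ × ℕ)) :=
  ([false, true].map (childNode f pw x)).filter fun y => acc < thr (total y.2)

/-- Write a child of the node at `vSrc` to `vDst`, and keep it if it is heavy. -/
def child {ι : Type} (β : Bool) : Prog ι :=
  vJ ::= vNl ;; vCnt ::= const 0 ;; vMid ::= vSrc ;; vHi ::= vDst ;; mapIntervals β ;;
  .store vHi (if β then .load vMid + vPw else .load vMid) ;;
  .ite (.less vAcc (.load (vThr + vCnt))) (vDst ::= vHi + const 1 ;; vNum ::= vNum + const 1) .skip

/-- The variables that `child` changes. -/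
def childVars : List Var := [vl, vr, vPos, vc, vs, vCnt, vMid, vHi, vJ, vDst, vNum]

/-- Replace the nodes in the buffer at `vX` by their heavy children. -/
def level {ι : Type} : Prog ι :=
  forEach (vNl * const 2 + const 1) (child false ;; child true) ;;
  vLen ::= vNum ;; vLev ::= vLev + const 1 ;; vPw ::= vPw * const 2

/-- The variables that `level` changes, besides `vX`, `vY`, `vLen`, `vLev` and `vPw`. -/
def levelVars : List Var := vSrc :: vRem :: childVars

/-- The number of words that `n` nodes with `L` intervals occupy. -/
theorem length_flatMap_nodeWords {xs : List (ℕ × List (ℕ × ℕ))} {L : ℕ}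
    (h : ∀ x ∈ xs, x.2.length = L) : (xs.flatMap nodeWords).length = xs.length * (2 * L + 1) := by
  induction xs with
  | nil => simp
  | cons x xs ih =>
    rw [List.flatMap_cons, List.length_append, ih fun y hy => h y (by simp [hy]),
      length_nodeWords, h x (by simp), List.length_cons]
    ring

namespace Machine
variable {ι : Type} {μ : Machine ι}

/-- A child is written in full behind the kept nodes before its weight is known, and a light child
is dropped by not advancing `vDst`. A buffer therefore needs room for one node more than is ever
kept. -/
theorem Wp.child (s : St) {f : Bool → ℕ → ℕ} {M : ℕ} (β : Bool) (x : ℕ × List (ℕ × ℕ))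
    (Y B : ℕ) (hf : RankTables μ s f M) (hmono : ∀ p q, p ≤ q → f β p ≤ f β q)
    (hI : ∀ p ∈ x.2, p.1 ≤ p.2 ∧ p.2 ≤ M) (hNl : s.env vNl = x.2.length)
    (hS : Holds s.mem (s.env vSrc) (nodeWords x))
    (hSY : s.env vSrc + (2 * x.2.length + 1) ≤ Y ∨ Y + B ≤ s.env vSrc)
    (hY : Y ≤ s.env vDst) (hYB : s.env vDst + (2 * x.2.length + 1) ≤ Y + B)
    (hWBY : s.env vWB ≤ Y) (hYsize : Y + B ≤ μ.size)
    (hSsize : s.env vSrc + (2 * x.2.length + 1) ≤ μ.size)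
    (hw : μ.size + 2 < 2 ^ μ.w) (hMw : M < 2 ^ μ.w) (hIM : x.2.length * M < 2 ^ μ.w)
    (hpw : x.1 + s.env vPw < 2 ^ μ.w) (hnum : s.env vNum + 1 < 2 ^ μ.w)
    (hthr : s.env vThr + total (childNode f (s.env vPw) x β).2 < s.env vWB) :
    μ.Wp (Domination.child β) s fun s' t => t ≤ x.2.length * 250 + 80 ∧
      Frame childVars Y B s s' ∧ s'.out = s.out ∧ (∀ a, a < s.env vDst → s'.mem a = s.mem a) ∧
      s'.env vDst = s.env vDst + (([childNode f (s.env vPw) x β].filter fun y =>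
        s.env vAcc < s.mem (s.env vThr + total y.2)).flatMap nodeWords).length ∧
      s'.env vNum = s.env vNum + ([childNode f (s.env vPw) x β].filter fun y =>
        s.env vAcc < s.mem (s.env vThr + total y.2)).length ∧
      Holds s'.mem (s.env vDst) (([childNode f (s.env vPw) x β].filter fun y =>
        s.env vAcc < s.mem (s.env vThr + total y.2)).flatMap nodeWords) := by
  have one_lt := μ.one_lt_two_pow
  have w_ne := μ.w_pos.ne'
  have hS' := hS
  rw [nodeWords, holds_append, length_flat, holds_cons] at hS'
  obtain ⟨hS1, hS2, -⟩ := hS'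
  apply Wp.seq; apply Wp.assign (Expr.ok_var _ _ _)
  apply Wp.seq; apply Wp.assign (by simp)
  apply Wp.seq; apply Wp.assign (Expr.ok_var _ _ _)
  apply Wp.seq; apply Wp.assign (Expr.ok_var _ _ _)
  apply Wp.seq
  refine Wp.mono (Wp.mapIntervals _ β x.2 Y B (hf.congr ?_ fun _ _ => rfl) hmono hI
    (by simp [hNl]) (by simp) (by simpa using hS1) (by simp; omega) (by simpa using hY)
    (by simp; omega) (by simpa using hWBY) hYsize (by simp; omega) hw hMw hIM) ?_
  · intro v hv
    simp only [tableVars, List.mem_cons, List.not_mem_nil, or_false] at hv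
    rcases hv with rfl | rfl | rfl | rfl | rfl | rfl | rfl | rfl <;> simp
  rintro s1 t1 ⟨ht1, hF1, out1, low1, g1, g2, g3, g4⟩
  simp only [St.env_set, reduceCtorEq, if_false, if_true, Expr.eval_var, St.mem_set, St.out_set]
    at out1 low1 g1 g2 g4
  have hF : Frame childVars Y B s s1 := by
    refine ⟨fun v hv => ?_, fun a ha => by rw [hF1.mem a ha]; rfl⟩
    simp only [childVars, List.mem_cons, not_or] at hv
    rw [hF1.env v (by simp [hv])]
    simp [hv]
  have eNum : s1.env vNum = s.env vNum := by rw [hF1.env _ (by simp)]; simp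
  have eDst : s1.env vDst = s.env vDst := by rw [hF1.env _ (by simp)]; simp
  have ePw : s1.env vPw = s.env vPw := hF.env _ (by simp [childVars])
  have eAcc : s1.env vAcc = s.env vAcc := hF.env _ (by simp [childVars])
  have eThr : s1.env vThr = s.env vThr := hF.env _ (by simp [childVars])
  have eCnt : s1.env vCnt = total (childNode f (s.env vPw) x β).2 := g3
  have hmid : s1.mem (s.env vSrc + 2 * x.2.length) = x.1 := by
    rw [hF.mem _ (by omega), hS2]
  have hval : (if β then .load vMid + vPw else .load vMid : Expr).eval s1 =
      (childNode f (s.env vPw) x β).1 := by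
    cases β <;> simp [g1, hmid, childNode, ePw]
  have hok : (if β then .load vMid + vPw else .load vMid : Expr).Ok μ s1 := by
    cases β <;> simp [g1, hmid, ePw] <;> omega
  have hcost : (if β then .load vMid + vPw else .load vMid : Expr).cost ≤ 6 := by
    cases β <;> simp
  generalize (if β then .load vMid + vPw else .load vMid : Expr) = e at hval hok hcost ⊢
  have hthr1 : s1.mem (s.env vThr + total (childNode f (s.env vPw) x β).2) =
      s.mem (s.env vThr + total (childNode f (s.env vPw) x β).2) := hF.mem _ (by omega)
  have hthrw : s.env vThr + total (childNode f (s.env vPw) x β).2 < 2 ^ μ.w := by omega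
  have hthrs : s.env vThr + total (childNode f (s.env vPw) x β).2 < μ.size := by omega
  have hne : s.env vThr + total (childNode f (s.env vPw) x β).2 ≠
      s.env vDst + 2 * x.2.length := by omega
  apply Vc.wp
  simp only [Vc, Expr.ok_add, Expr.ok_var, Expr.ok_const, Expr.eval_add,
    Expr.eval_var, Expr.eval_const, St.env_set, St.env_put, true_and, reduceCtorEq, if_false,
    if_true, Expr.eval_load, Expr.ok_load, Expr.eval_less, Expr.ok_less,
    Expr.cost_add, Expr.cost_var, Expr.cost_const, Expr.cost_load, Expr.cost_less,
    St.out_set, St.out_put, St.mem_set, St.mem_put, hok, hval, g2, eNum, eDst, eAcc, eThr,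
    eCnt, hthr1, hthrw, hthrs, one_lt, hnum, hne, out1]
  have hput : Frame childVars Y B s
      (s1.put (s.env vDst + 2 * x.2.length) (childNode f (s.env vPw) x β).1) :=
    hF.put (by omega) (by omega) _
  have hlow : ∀ a < s.env vDst, (if a = s.env vDst + 2 * x.2.length then
      (childNode f (s.env vPw) x β).1 else s1.mem a) = s.mem a := by
    intro a ha
    rw [if_neg (by omega), low1 a ha]
  refine ⟨by omega, fun hne => ?_, fun heq => ?_⟩
  · have hlt : s.env vAcc < s.mem (s.env vThr + total (childNode f (s.env vPw) x β).2) := by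
      by_contra hlt
      simp [hlt] at hne
    have hlen : (nodeWords (childNode f (s.env vPw) x β)).length = 2 * x.2.length + 1 := by
      simp [childNode]
    rw [List.filter_cons_of_pos (by simpa using hlt)]
    simp only [List.filter_nil, List.flatMap_cons, List.flatMap_nil, List.append_nil, hlen,
      List.length_cons, List.length_nil]
    refine ⟨by omega, by omega, (hput.set (by simp [childVars]) _).set (by simp [childVars]) _,
      hlow, by omega, trivial, ?_⟩
    rw [nodeWords, holds_append]
    constructor
    · refine g4.congr fun y h1 h2 => ?_
      simp only [length_flat, List.length_map] at h2
      simp only [St.mem_put]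
      rw [if_neg (by omega)]
    · simp [holds_cons, holds_nil, childNode, St.mem_put]
  · have hlt : ¬ s.env vAcc < s.mem (s.env vThr + total (childNode f (s.env vPw) x β).2) := by
      intro hlt
      simp [hlt] at heq
    rw [List.filter_cons_of_neg (by simpa using hlt)]
    exact ⟨by omega, hput, hlow, rfl, rfl, holds_nil _ _⟩

/-- `A` bounds the number of nodes before and after the step; the extra node in `A + 1` is the child
that is being tried. -/
theorem Wp.level (s0 : St) {f : Bool → ℕ → ℕ} {M L A B : ℕ} (xs : List (ℕ × List (ℕ × ℕ)))
    (hf : RankTables μ s0 f M) (hmono : ∀ β p q, p ≤ q → f β p ≤ f β q)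
    (hI : ∀ x ∈ xs, x.2.length = L ∧ ∀ p ∈ x.2, p.1 ≤ p.2 ∧ p.2 ≤ M) (hNl : s0.env vNl = L)
    (hXY : s0.env vX + B ≤ s0.env vY ∨ s0.env vY + B ≤ s0.env vX)
    (hlen : s0.env vLen = xs.length) (hX : Holds s0.mem (s0.env vX) (xs.flatMap nodeWords))
    (hB : (A + 1) * (2 * L + 1) ≤ B) (hA : xs.length ≤ A)
    (hWBX : s0.env vWB ≤ s0.env vX) (hWBY : s0.env vWB ≤ s0.env vY)
    (hXs : s0.env vX + B ≤ μ.size) (hYs : s0.env vY + B ≤ μ.size)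
    (hw : μ.size + 2 < 2 ^ μ.w) (hMw : M < 2 ^ μ.w) (hIM : L * M < 2 ^ μ.w)
    (hpw : ∀ x ∈ xs, x.1 + s0.env vPw < 2 ^ μ.w) (hpw2 : s0.env vPw * 2 < 2 ^ μ.w)
    (hlev : s0.env vLev + 1 < 2 ^ μ.w)
    (hthr : ∀ x ∈ xs, ∀ β, s0.env vThr + total (childNode f (s0.env vPw) x β).2 < s0.env vWB)
    (ys : List (ℕ × List (ℕ × ℕ)))
    (hys : ys = xs.flatMap (heavyChildren (fun c => s0.mem (s0.env vThr + c)) (s0.env vAcc) f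
      (s0.env vPw))) (hysA : ys.length ≤ A) :
    μ.Wp Domination.level s0 fun s' t => t ≤ xs.length * (L * 500 + 200) + 100 ∧
      (∀ v, v ∉ levelVars → v ∉ [vX, vY, vLen, vLev, vPw] → s'.env v = s0.env v) ∧
      (∀ a, a < s0.env vY ∨ s0.env vY + B ≤ a → s'.mem a = s0.mem a) ∧
      s'.env vX = s0.env vY ∧ s'.env vY = s0.env vX ∧ s'.out = s0.out ∧
      s'.env vLen = ys.length ∧ s'.env vLev = s0.env vLev + 1 ∧ s'.env vPw = s0.env vPw * 2 ∧
      Holds s'.mem (s0.env vY) (ys.flatMap nodeWords) := by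
  have one_lt := μ.one_lt_two_pow
  have w_ne := μ.w_pos.ne'
  set thr : ℕ → ℕ := fun c => s0.mem (s0.env vThr + c) with hthrdef
  set g := heavyChildren thr (s0.env vAcc) f (s0.env vPw) with hg
  have hFl : A * (2 * L + 1) + (2 * L + 1) ≤ B := by
    rw [Nat.add_mul, one_mul] at hB; exact hB
  have hgL : ∀ zs : List (ℕ × List (ℕ × ℕ)), (∀ x ∈ zs, x.2.length = L) →
      ∀ x ∈ zs.flatMap g, x.2.length = L := by
    intro zs h x hx
    obtain ⟨y, hy, hxy⟩ := List.mem_flatMap.1 hx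
    obtain ⟨β, -, rfl⟩ := List.mem_map.1 (List.mem_filter.1 hxy).1
    simpa [childNode] using h y hy
  apply Wp.seq
  refine Wp.mono (Wp.forEach xs nodeWords (2 * L + 1) _ _ levelVars B (L * 500 + 165) s0
    (fun done outs num out => out = s0.out ∧ outs = (done.flatMap g).flatMap nodeWords ∧
      num = (done.flatMap g).length)
    (fun x hx => by rw [length_nodeWords, (hI x hx).1]) (by simp [levelVars, childVars])
    (by simp [levelVars, childVars]) hXY hlen hX ?_ (by omega) ?_ ⟨rfl, rfl, rfl⟩ ?_) ?_
  · rw [mul_comm]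
    exact (Nat.mul_le_mul_right _ hA).trans (by omega)
  · intro s hF
    have : s.env vNl = L := by rw [hF.env _ (by simp [levelVars, childVars]), hNl]
    simp only [Expr.ok_add, Expr.ok_mul, Expr.ok_var, Expr.ok_const, Expr.eval_add, Expr.eval_mul,
      Expr.eval_var, Expr.eval_const, this, true_and]
    omega
  · rintro done x todo outs s e ⟨hout, houts, hnum⟩ hF hH hd hs1 hs2 hx
    obtain ⟨hxL, hxI⟩ := hI x (by rw [e]; simp)
    have hxs : ∀ y ∈ xs, y.2.length = L := fun y hy => (hI y hy).1
    have hdonelen : outs.length = (done.flatMap g).length * (2 * L + 1) := by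
      rw [houts]
      exact length_flatMap_nodeWords (hgL done fun y hy => hxs y (by rw [e]; simp [hy]))
    have henv : ∀ v, v ∉ levelVars → s.env v = s0.env v := hF.env
    have ePw : s.env vPw = s0.env vPw := henv _ (by simp [levelVars, childVars])
    have eAcc : s.env vAcc = s0.env vAcc := henv _ (by simp [levelVars, childVars])
    have eThr : s.env vThr = s0.env vThr := henv _ (by simp [levelVars, childVars])
    have eNl : s.env vNl = L := by rw [henv _ (by simp [levelVars, childVars]), hNl]
    have eWB : s.env vWB = s0.env vWB := henv _ (by simp [levelVars, childVars])
    have htab : ∀ v ∈ tableVars, v ∉ levelVars := by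
      intro v hv
      simp only [tableVars, List.mem_cons, List.not_mem_nil, or_false] at hv
      rcases hv with rfl | rfl | rfl | rfl | rfl | rfl | rfl | rfl <;>
        simp [levelVars, childVars]
    have hfs : RankTables μ s f M :=
      hf.congr (fun v hv => henv v (htab v hv)) fun a ha => hF.mem a (Or.inl (by omega))
    have hmem : ∀ a < s0.env vWB, s.mem a = s0.mem a := fun a ha => hF.mem a (Or.inl (by omega))
    have hxth := hthr x (by rw [e]; simp)
    -- The threshold table lies below the working space. So both children are tested against the
    -- thresholds of the initial state, although the buffer has changed in between.
    have hflt : ∀ (s' : St), s'.env vAcc = s0.env vAcc → s'.env vThr = s0.env vThr →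
        (∀ a < s0.env vWB, s'.mem a = s0.mem a) → ∀ β,
        ([childNode f (s0.env vPw) x β].filter fun y =>
          s'.env vAcc < s'.mem (s'.env vThr + total y.2)) =
        [childNode f (s0.env vPw) x β].filter fun y => s0.env vAcc < thr (total y.2) := by
      intro s' h1 h2 h3 β
      refine List.filter_congr fun y hy => ?_
      obtain rfl := List.mem_singleton.1 hy
      simp only [h1, h2, hthrdef, h3 _ (hxth β)]
    set G : Bool → List (ℕ × List (ℕ × ℕ)) := fun β =>
      [childNode f (s0.env vPw) x β].filter fun y => s0.env vAcc < thr (total y.2) with hG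
    have hgx : g x = G false ++ G true := by
      rw [hG, ← List.filter_append]; rfl
    have hGL : ∀ β, ((G β).flatMap nodeWords).length = (G β).length * (2 * L + 1) := by
      intro β
      refine length_flatMap_nodeWords fun y hy => ?_
      obtain rfl := List.mem_singleton.1 (List.mem_filter.1 hy).1
      simpa [childNode] using hxL
    -- The children kept so far form an initial part of the final list, so the bound on the final
    -- list also bounds the intermediate output.
    have hcount : (done.flatMap g).length + ((G false).length + (G true).length) ≤ A := by
      refine le_trans ?_ hysA
      rw [hys, e, List.flatMap_append, List.flatMap_cons, hgx]
      simp only [List.length_append]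
      omega
    have hroom0 : outs.length + (2 * L + 1) ≤ B := by
      have := Nat.mul_le_mul_right (2 * L + 1) (show (done.flatMap g).length ≤ A by omega)
      omega
    have hroom1 : outs.length + ((G false).flatMap nodeWords).length + (2 * L + 1) ≤ B := by
      have := Nat.mul_le_mul_right (2 * L + 1)
        (show (done.flatMap g).length + (G false).length ≤ A by omega)
      rw [Nat.add_mul] at this
      rw [hGL]
      omega
    have hAB : A ≤ A * (2 * L + 1) := Nat.le_mul_of_pos_right _ (by omega)
    have hnumA : s.env vNum + ((G false).length + (G true).length) ≤ A := by omega
    apply Wp.seq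
    refine Wp.mono (Wp.child s false x (s0.env vY) B hfs (hmono false) hxI (by omega) hx
      (by rw [hxL]; omega) (by omega) (by rw [hxL]; omega) (by omega) hYs (by rw [hxL]; omega) hw
      hMw (by rw [hxL]; exact hIM) (by rw [ePw]; exact hpw x (by rw [e]; simp)) (by omega)
      (by rw [eThr, ePw, eWB]; exact hxth false)) ?_
    rintro s1 t1 ⟨ht1, hF1, hout1, hlow1, hd1, hn1, hH1⟩
    rw [ePw, hflt s eAcc eThr hmem] at hd1 hn1 hH1
    change _ = _ + (List.flatMap nodeWords (G false)).length at hd1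
    change _ = _ + (G false).length at hn1
    change Holds _ _ (List.flatMap nodeWords (G false)) at hH1
    have eAcc1 : s1.env vAcc = s0.env vAcc := by rw [hF1.env _ (by simp [childVars]), eAcc]
    have eThr1 : s1.env vThr = s0.env vThr := by rw [hF1.env _ (by simp [childVars]), eThr]
    have ePw1 : s1.env vPw = s0.env vPw := by rw [hF1.env _ (by simp [childVars]), ePw]
    have eNl1 : s1.env vNl = L := by rw [hF1.env _ (by simp [childVars]), eNl]
    have eWB1 : s1.env vWB = s0.env vWB := by rw [hF1.env _ (by simp [childVars]), eWB]
    have eSrc1 : s1.env vSrc = s.env vSrc := hF1.env _ (by simp [childVars])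
    have eRem1 : s1.env vRem = s.env vRem := hF1.env _ (by simp [childVars])
    have hmem1 : ∀ a < s0.env vWB, s1.mem a = s0.mem a := fun a ha => by
      rw [hF1.mem a (Or.inl (by omega)), hmem a ha]
    have hfs1 : RankTables μ s1 f M := hfs.congr (fun v hv => hF1.env v fun h =>
      htab v hv (by simp only [levelVars, List.mem_cons]; exact Or.inr (Or.inr h)))
      fun a ha => hF1.mem a (Or.inl (by omega))
    have hx1 : Holds s1.mem (s1.env vSrc) (nodeWords x) := by
      rw [eSrc1]
      refine hx.congr fun y h1 h2 => hF1.mem y ?_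
      rw [length_nodeWords, hxL] at h2
      omega
    refine Wp.mono (Wp.child s1 true x (s0.env vY) B hfs1 (hmono true) hxI (by omega) hx1
      (by rw [hxL, eSrc1]; omega) (by omega) (by rw [hxL]; omega) (by omega) hYs
      (by rw [hxL]; omega) hw
      hMw (by rw [hxL]; exact hIM) (by rw [ePw1]; exact hpw x (by rw [e]; simp)) (by omega)
      (by rw [eThr1, ePw1, eWB1]; exact hxth true)) ?_
    rintro s2 t2 ⟨ht2, hF2, hout2, hlow2, hd2, hn2, hH2⟩
    rw [ePw1, hflt s1 eAcc1 eThr1 hmem1] at hd2 hn2 hH2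
    change _ = _ + (List.flatMap nodeWords (G true)).length at hd2
    change _ = _ + (G true).length at hn2
    change Holds _ _ (List.flatMap nodeWords (G true)) at hH2
    have hsub : ∀ v ∈ childVars, v ∈ levelVars := fun v hv => by
      simp only [levelVars, List.mem_cons]; exact Or.inr (Or.inr hv)
    refine ⟨?_, (hF.trans hF1 hsub).trans hF2 hsub, ?_, ?_,
      (G false).flatMap nodeWords ++ (G true).flatMap nodeWords, ?_, ?_, ?_, ?_, ?_⟩
    · rw [hxL] at ht1 ht2; omega
    · rw [hF2.env _ (by simp [childVars]), eSrc1]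
    · rw [hF2.env _ (by simp [childVars]), eRem1]
    · rw [holds_append, holds_append, ← hd, ← hd1]
      refine ⟨?_, ?_, hH2⟩
      · refine hH.congr fun y h1 h2 => ?_
        rw [hlow2 y (by omega), hlow1 y (by omega)]
      · exact hH1.congr fun y h1 h2 => hlow2 y (by omega)
    · rw [hd2, hd1, hd]
      simp only [List.length_append]
      omega
    · rw [hout2, hout1, hout]
    · rw [houts, List.flatMap_append, List.flatMap_append]
      simp [hgx]
    · rw [hn2, hn1, hnum, List.flatMap_append, List.length_append]
      simp [hgx]
      omega
  · rintro s' t ⟨h1, h2, h3, h4, h5, outs, h6, h7, rfl, h8⟩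
    have e1 : s'.env vLev = s0.env vLev := h2 _ (by simp [levelVars, childVars]) (by simp) (by simp)
    have e2 : s'.env vPw = s0.env vPw := h2 _ (by simp [levelVars, childVars]) (by simp) (by simp)
    have two_lt : 2 < 2 ^ μ.w := by omega
    apply Vc.wp
    simp only [Vc, Expr.ok_add, Expr.ok_var, Expr.ok_const, Expr.eval_add,
      Expr.eval_var, Expr.eval_const, St.env_set, true_and, reduceCtorEq, if_false,
      if_true, Expr.eval_mul, Expr.ok_mul, Expr.cost_add, Expr.cost_var, Expr.cost_const,
      Expr.cost_mul, St.out_set, St.mem_set, h4, h5, h7, h8, e1, e2, one_lt, two_lt, hlev, hpw2, hys]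
    refine ⟨?_, ?_, h3, h6⟩
    · simp only [Expr.cost_const, Expr.cost_var, Expr.cost_add, Expr.cost_mul] at h1
      have : xs.length * (L * 500 + 165 + (2 + 1 + 1 + 1 + 1) + 20) ≤
        xs.length * (L * 500 + 200) := Nat.mul_le_mul_left _ (by omega)
      omega
    · intro v hv hv'
      simp only [List.mem_cons, not_or] at hv'
      simp [hv', h2 v hv]

end Machine

/-! ## The layers of the range tree -/

/-- Layer `0` is the list of all points, sorted by the first coordinate.  The next layer consists
of `h` copies of a layer; in copy `s` the blocks of length `2 ^ s` are sorted by the next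
coordinate. -/
noncomputable def layer {n : ℕ} (x : ℕ → Fin n → ℝ) (h : ℕ) : ℕ → List (Fin n)
  | 0 => sortBy (x 0) (List.finRange n)
  | j + 1 => (List.range h).flatMap fun s =>
      chunkSort (x (j + 1)) (2 ^ s) ((layer x h j).length / 2 ^ s) (layer x h j)

theorem length_flatMap_range {α : Type*} (g : ℕ → List α) (h M : ℕ)
    (hg : ∀ s < h, (g s).length = M) : ((List.range h).flatMap g).length = h * M := by
  induction h with
  | zero => simp
  | succ h ih =>
    rw [List.range_succ, List.flatMap_append, List.length_append, ih fun s hs => hg s (by omega)]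
    simp [hg h (by omega)]
    ring

theorem slice_flatMap_range {α : Type*} (g : ℕ → List α) {h M s a b : ℕ}
    (hg : ∀ s < h, (g s).length = M) (hs : s < h) (hb : b ≤ M) :
    slice ((List.range h).flatMap g) (s * M + a) (s * M + b) = slice (g s) a b := by
  induction h with
  | zero => omega
  | succ h ih =>
    have hlen := length_flatMap_range g h M fun s hs => hg s (by omega)
    rw [List.range_succ, List.flatMap_append]
    rcases (Nat.lt_succ_iff.1 hs).eq_or_lt with rfl | hlt
    · rw [slice_append_right hlen]
      simp
    · rw [slice_append_left, ih (fun s hs => hg s (by omega)) hlt]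
      rw [hlen]
      have := Nat.mul_le_mul_right M (Nat.succ_le_of_lt hlt)
      rw [Nat.succ_mul] at this
      omega

variable {n : ℕ} (x : ℕ → Fin n → ℝ) (h : ℕ)

theorem length_layer (j : ℕ) : (layer x h j).length = n * h ^ j := by
  induction j with
  | zero => simp [layer, (sortBy_perm _ _).length_eq]
  | succ j ih =>
    rw [layer, length_flatMap_range _ h (n * h ^ j) fun s _ => by rw [length_chunkSort, ih],
      pow_succ]
    ring

/-- Copy `s` starts at offset `s * (n * h ^ j)`. Divisibility makes the slice the block with number
l / 2^s of that copy, and since it fits into the layer it is among the complete blocks, which are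
sorted. -/
theorem slice_layer_succ {j s l : ℕ} (hs : s < h) (hl : 2 ^ s ∣ l) (hM : l + 2 ^ s ≤ n * h ^ j) :
    slice (layer x h (j + 1)) (s * (n * h ^ j) + l) (s * (n * h ^ j) + (l + 2 ^ s)) =
      sortBy (x (j + 1)) (slice (layer x h j) l (l + 2 ^ s)) := by
  obtain ⟨i, rfl⟩ := hl
  have hi : 2 ^ s * i + 2 ^ s = (i + 1) * 2 ^ s := by ring
  rw [layer, slice_flatMap_range _ (fun s _ => by rw [length_chunkSort, length_layer]) hs hM, hi,
    mul_comm (2 ^ s) i]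
  refine slice_chunkSort _ _ _ _ ?_ ?_
  · rw [length_layer, ← Nat.succ_le_iff, Nat.le_div_iff_mul_le (by positivity), ← Nat.add_one, ← hi]
    exact hM
  · rw [length_layer, ← hi]; exact hM

/-- A block of a layer is sorted by the coordinate that belongs to the layer. -/
def SortedBlock (j : ℕ) (p : ℕ × ℕ) : Prop :=
  (slice (layer x h j) p.1 p.2).Pairwise fun a b => x j a ≤ x j b

/-- The two alternatives are exactly what `cutEnds_spec` provides at either end: nothing is cut off,
or one full aligned block of length 2^s. -/
theorem slice_rung {j s a b : ℕ} (hs : s < h) (hab : b = a ∨ b = a + 2 ^ s ∧ 2 ^ s ∣ a)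
    (hM : b ≤ n * h ^ j) :
    (slice (layer x h (j + 1)) (s * (n * h ^ j) + a) (s * (n * h ^ j) + b)).Perm
      (slice (layer x h j) a b) ∧
    SortedBlock x h (j + 1) (s * (n * h ^ j) + a, s * (n * h ^ j) + b) := by
  rw [SortedBlock]
  rcases hab with rfl | ⟨rfl, hd⟩
  · simp [slice_self]
  · rw [slice_layer_succ x h hs hd hM]
    exact ⟨sortBy_perm _ _, sortBy_pairwise _ _⟩

/-- What is required of the blocks into which intervals of layer `j - 1` are cut. -/
def GoodBlock (j : ℕ) (p : ℕ × ℕ) : Prop :=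
  p.1 ≤ p.2 ∧ p.2 - p.1 < 2 ^ h ∧ p.2 ≤ n * h ^ j ∧ SortedBlock x h j p

/-- What is required of the intervals of layer `j`. -/
def GoodInterval (n h j : ℕ) (p : ℕ × ℕ) : Prop :=
  p.1 ≤ p.2 ∧ p.2 - p.1 < 2 ^ h ∧ p.2 ≤ n * h ^ j

theorem rungs_good {j s : ℕ} {p : ℕ × ℕ} (hp : GoodInterval n h j p) (hs : s < h) :
    (∀ q ∈ rungs (n * h ^ j) p s, GoodBlock x h (j + 1) q) ∧
    ((rungs (n * h ^ j) p s).flatMap fun q => slice (layer x h (j + 1)) q.1 q.2).Perm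
      (slice (layer x h j) (ladder p s).1 (ladder p (s + 1)).1 ++
        slice (layer x h j) (ladder p (s + 1)).2 (ladder p s).2) := by
  have hal := ladder_aligned hp.1 s
  have hal1 : (ladder p (s + 1)).1 ≤ (ladder p (s + 1)).2 := (ladder_aligned hp.1 (s + 1)).1
  have hle := ladder_le hp.1 s
  obtain ⟨-, h1, h2, h3, h4⟩ := cutEnds_spec hal
  change _ ≤ (ladder p (s + 1)).1 at h1
  change (ladder p (s + 1)).2 ≤ _ at h2
  change (ladder p (s + 1)).1 = _ ∨ (ladder p (s + 1)).1 = _ ∧ _ at h3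
  change (ladder p (s + 1)).2 = _ ∨ _ = (ladder p (s + 1)).2 + _ ∧ _ ∣ (ladder p (s + 1)).2 at h4
  have hM := hp.2.2
  have hp2 := hp.2.1
  have hsM : s * (n * h ^ j) + n * h ^ j ≤ n * h ^ (j + 1) := by
    have := Nat.mul_le_mul_right (n * h ^ j) (Nat.succ_le_of_lt hs)
    rw [Nat.succ_mul] at this
    exact this.trans_eq (by ring)
  have r1 := slice_rung x h (j := j) hs h3 (by omega)
  have r2 := slice_rung x h (j := j) hs (h4.imp_left Eq.symm) (by omega)
  constructor
  · intro q hq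
    simp only [rungs, List.mem_cons, List.not_mem_nil, or_false] at hq
    rcases hq with rfl | rfl
    · exact ⟨by simp only; omega, by simp only; omega, by simp only; omega, r1.2⟩
    · exact ⟨by simp only; omega, by simp only; omega, by simp only; omega, r2.2⟩
  · simp only [rungs, List.flatMap_cons, List.flatMap_nil, List.append_nil]
    exact r1.1.append r2.1

/-- By induction on s, the blocks of the first s steps hold the two outer parts of the interval, up
to what remains as `ladder p s`. After h steps nothing remains, and the two outer parts meet. -/
theorem blocks_good {j : ℕ} {p : ℕ × ℕ} (hp : GoodInterval n h j p) :
    (∀ q ∈ blocks h (n * h ^ j) p, GoodBlock x h (j + 1) q) ∧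
    ((blocks h (n * h ^ j) p).flatMap fun q => slice (layer x h (j + 1)) q.1 q.2).Perm
      (slice (layer x h j) p.1 p.2) := by
  constructor
  · intro q hq
    obtain ⟨s, hs, hq⟩ := List.mem_flatMap.1 hq
    exact (rungs_good x h hp (List.mem_range.1 hs)).1 q hq
  · have key : ∀ s ≤ h, (((List.range s).flatMap (rungs (n * h ^ j) p)).flatMap
        fun q => slice (layer x h (j + 1)) q.1 q.2).Perm
        (slice (layer x h j) p.1 (ladder p s).1 ++ slice (layer x h j) (ladder p s).2 p.2) := by
      intro s
      induction s with
      | zero => intro _; simp [ladder, slice_self]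
      | succ s ih =>
        intro hs
        have hal := ladder_aligned hp.1 s
        have hle := ladder_le hp.1 s
        obtain ⟨-, h1, h2, -⟩ := cutEnds_spec hal
        change _ ≤ (ladder p (s + 1)).1 at h1
        change (ladder p (s + 1)).2 ≤ _ at h2
        rw [List.range_succ, List.flatMap_append, List.flatMap_append]
        simp only [List.flatMap_cons, List.flatMap_nil, List.append_nil]
        refine ((ih (by omega)).append (rungs_good x h hp hs).2).trans ?_
        rw [← slice_append hle.1 h1, ← slice_append h2 hle.2]
        simp only [List.append_assoc]
        refine List.Perm.append_left _ ?_
        refine List.perm_append_comm.trans ?_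
        simp only [List.append_assoc]
        exact List.Perm.refl _
    have hh := key h le_rfl
    have hal := ladder_aligned hp.1 h
    have hle := ladder_le hp.1 h
    -- If not empty, the remainder would have ends that are distinct multiples of 2^h, although the
    -- original interval is shorter than 2^h.
    have heq : (ladder p h).1 = (ladder p h).2 := by
      rcases hal.2 with e | ⟨⟨a, ha⟩, ⟨b, hb⟩⟩
      · exact e
      · have h1 := hal.1
        have h2 := hp.2.1
        have h3 : 2 ^ h * b - 2 ^ h * a < 2 ^ h := by omega
        rw [← Nat.mul_sub] at h3
        have h4 : b - a < 1 := lt_of_mul_lt_mul_left (by simpa using h3) (Nat.zero_le (2 ^ h))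
        have h5 : a ≤ b := by
          rw [ha, hb] at h1
          exact le_of_mul_le_mul_left h1 (by positivity)
        rw [ha, hb, show a = b by omega]
    rw [← heq, slice_append hle.1 (by rw [heq]; exact hle.2)] at hh
    exact hh

/-- Restricting a sorted block to an interval of keys is filtering. -/
theorem slice_cut {α : Type*} (xs : List α) (f : α → ℝ) {κ : ℕ → ℝ} {lo hi : ℝ} {p p' : ℕ × ℕ}
    (hκ : ∀ a v, xs[a]? = some v → κ a = f v) (hc : Cut κ lo hi p p') :
    slice xs p'.1 p'.2 = (slice xs p.1 p.2).filter fun v => lo ≤ f v ∧ f v ≤ hi := by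
  obtain ⟨h1, h2, h3, h4⟩ := hc
  have e1 : (slice xs p.1 p'.1).filter (fun v => lo ≤ f v ∧ f v ≤ hi) = [] := by
    refine List.filter_eq_nil_iff.2 fun v hv => ?_
    obtain ⟨i, i1, i2, i3⟩ := mem_slice.1 hv
    have := mt (h4 i (by omega) (by omega)).2 (by omega)
    simpa [hκ i v i3] using this
  have e2 : (slice xs p'.1 p'.2).filter (fun v => lo ≤ f v ∧ f v ≤ hi) = slice xs p'.1 p'.2 := by
    refine List.filter_eq_self.2 fun v hv => ?_
    obtain ⟨i, i1, i2, i3⟩ := mem_slice.1 hv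
    simpa [hκ i v i3] using (h4 i (by omega) (by omega)).1 ⟨i1, i2⟩
  have e3 : (slice xs p'.2 p.2).filter (fun v => lo ≤ f v ∧ f v ≤ hi) = [] := by
    refine List.filter_eq_nil_iff.2 fun v hv => ?_
    obtain ⟨i, i1, i2, i3⟩ := mem_slice.1 hv
    have := mt (h4 i (by omega) (by omega)).2 (by omega)
    simpa [hκ i v i3] using this
  rw [← slice_append h1 (h2.trans h3), ← slice_append h2 h3, List.filter_append,
    List.filter_append, e1, e2, e3]
  simp

theorem flatMap_slice_cut {α : Type*} (xs : List α) (f : α → ℝ) {κ : ℕ → ℝ} {lo hi : ℝ}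
    {I J : List (ℕ × ℕ)} (hκ : ∀ a v, xs[a]? = some v → κ a = f v)
    (hc : List.Forall₂ (Cut κ lo hi) I J) :
    (J.flatMap fun p => slice xs p.1 p.2) =
      (I.flatMap fun p => slice xs p.1 p.2).filter fun v => lo ≤ f v ∧ f v ≤ hi := by
  induction hc with
  | nil => rfl
  | cons hc _ ih =>
    rw [List.flatMap_cons, List.flatMap_cons, List.filter_append,
      ih, slice_cut xs f hκ hc]

theorem flatMap_blocks_perm {j : ℕ} {I : List (ℕ × ℕ)} (hI : ∀ p ∈ I, GoodInterval n h j p) :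
    ((I.flatMap (blocks h (n * h ^ j))).flatMap fun q => slice (layer x h (j + 1)) q.1 q.2).Perm
      (I.flatMap fun p => slice (layer x h j) p.1 p.2) := by
  induction I with
  | nil => simp
  | cons p I ih =>
    rw [List.flatMap_cons, List.flatMap_append, List.flatMap_cons]
    exact (blocks_good x h (hI p (by simp))).2.append (ih fun q hq => hI q (by simp [hq]))

theorem SortedBlock.key_le {j : ℕ} {p : ℕ × ℕ} (hp : SortedBlock x h j p)
    (hl : p.2 ≤ n * h ^ j) {κ : ℕ → ℝ} (hκ : ∀ a v, (layer x h j)[a]? = some v → κ a = x j v)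
    {a b : ℕ} (ha : p.1 ≤ a) (hab : a ≤ b) (hb : b < p.2) : κ a ≤ κ b := by
  have hlen := length_layer x h j
  have hlt : b < (layer x h j).length := by omega
  rw [hκ a _ (List.getElem?_eq_getElem (by omega)), hκ b _ (List.getElem?_eq_getElem hlt)]
  rcases hab.eq_or_lt with rfl | hab
  · exact le_rfl
  · have h1 := List.pairwise_iff_getElem.1 hp (a - p.1) (b - p.1)
      (by rw [length_slice (by omega)]; omega) (by rw [length_slice (by omega)]; omega) (by omega)
    simpa [slice, show p.1 + (a - p.1) = a by omega, show p.1 + (b - p.1) = b by omega] using h1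

/-! ## The wavelet matrix -/

/-- Level `l + 1` of the wavelet matrix: the elements of level `l` with bit `l` zero, then those
with bit `l` one. -/
def wave (S : List ℕ) : ℕ → List ℕ
  | 0 => S
  | l + 1 => (wave S l).filter (fun v => ! v.testBit l) ++ (wave S l).filter fun v => v.testBit l

/-- The position on level `l + 1` of the elements with bit `β` that correspond to the position `p`
on level `l`. -/
def posMap (S : List ℕ) (l : ℕ) (β : Bool) (p : ℕ) : ℕ :=
  if β then
    (wave S l).countP (fun v => ! v.testBit l) + ((wave S l).take p).countP fun v => v.testBit l
  else ((wave S l).take p).countP fun v => ! v.testBit l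

variable (S : List ℕ)

theorem length_wave (l : ℕ) : (wave S l).length = S.length := by
  induction l with
  | zero => rfl
  | succ l ih =>
    rw [wave, List.length_append, ← ih, ← List.countP_eq_length_filter,
      ← List.countP_eq_length_filter, add_comm]
    have := List.length_eq_countP_add_countP (fun v => v.testBit l) (l := wave S l)
    rw [this]
    congr 2
    funext v
    simp

theorem posMap_mono (l : ℕ) (β : Bool) {p q : ℕ} (h : p ≤ q) :
    posMap S l β p ≤ posMap S l β q := by
  have key : ∀ P : ℕ → Bool, ((wave S l).take p).countP P ≤ ((wave S l).take q).countP P :=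
    fun P => (List.take_sublist_take_left h).countP_le
  cases β
  · exact key _
  · exact Nat.add_le_add_left (key _) _

theorem posMap_le (l : ℕ) (β : Bool) (p : ℕ) : posMap S l β p ≤ S.length := by
  have h1 : ∀ P : ℕ → Bool, ((wave S l).take p).countP P ≤ (wave S l).countP P :=
    fun P => (List.take_sublist _ _).countP_le
  have h2 := length_wave S (l + 1)
  rw [wave, List.length_append, ← List.countP_eq_length_filter,
      ← List.countP_eq_length_filter] at h2
  have h3 := h1 fun v => v.testBit l
  have h4 := h1 fun v => ! v.testBit l
  cases β
  · simp only [posMap, Bool.false_eq_true, if_false]; omega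
  · simp only [posMap, if_true]; omega

/-- The partition is stable, so on level l + 1 the elements with bit β keep their order, the ones
shifted by the number of all zeros. The ends of the image are then prefix counts, and `slice_filter`
applies within each half. -/
theorem slice_posMap (l : ℕ) (β : Bool) {p q : ℕ} (h : p ≤ q) :
    slice (wave S (l + 1)) (posMap S l β p) (posMap S l β q) =
      (slice (wave S l) p q).filter fun v => v.testBit l == β := by
  cases β
  · simp only [posMap, Bool.false_eq_true, if_false, wave]
    rw [slice_append_left, slice_filter _ _ h]
    · congr 1
      funext v
      simp
    · rw [← List.countP_eq_length_filter]
      exact (List.take_sublist _ _).countP_le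
  · simp only [posMap, if_true, wave]
    rw [slice_append_right (List.countP_eq_length_filter).symm, slice_filter _ _ h]
    congr 1
    funext v
    simp

/-! ## Heavy nodes -/

/-- The heavy nodes on level `l`, for the intervals `J` of positions in `S`. -/
def heavyNodes (thr : ℕ → ℕ) (acc : ℕ) (J : List (ℕ × ℕ)) : ℕ → List (ℕ × List (ℕ × ℕ))
  | 0 => [(0, J)]
  | l + 1 => (heavyNodes thr acc J l).flatMap (heavyChildren thr acc (posMap S l) (2 ^ l))

/-- The elements of `S` at the positions in the intervals `J`. -/
def elements (J : List (ℕ × ℕ)) : List ℕ := J.flatMap fun p => slice S p.1 p.2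

variable {S} {thr : ℕ → ℕ} {acc : ℕ} {J : List (ℕ × ℕ)}

theorem length_elements (hJ : ∀ p ∈ J, p.2 ≤ S.length) : (elements S J).length = total J := by
  rw [elements, List.length_flatMap, total]
  congr 1
  exact List.map_congr_left fun p hp => length_slice (hJ p hp)

/-- What is required of the nodes on level `l`. -/
structure GoodNode (S : List ℕ) (J : List (ℕ × ℕ)) (l : ℕ) (x : ℕ × List (ℕ × ℕ)) : Prop where
  path_lt : x.1 < 2 ^ l
  length_eq : x.2.length = J.length
  le : ∀ p ∈ x.2, p.1 ≤ p.2 ∧ p.2 ≤ S.length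
  elements_eq : elements (wave S l) x.2 = (elements S J).filter fun v => v % 2 ^ l == x.1

theorem mod_two_pow_succ_eq (v l : ℕ) :
    v % 2 ^ (l + 1) = v % 2 ^ l + if v.testBit l then 2 ^ l else 0 := by
  rw [Nat.mod_pow_succ, Nat.testBit_eq_decide_div_mod_eq]
  have := Nat.mod_two_eq_zero_or_one (v / 2 ^ l)
  rcases this with e | e <;> simp [e]

/-- The residue modulo 2^l and bit l together are the residue modulo 2^(l+1), so filtering by the
bit refines the class of the node to the class of the child. -/
theorem GoodNode.child {l : ℕ} {x : ℕ × List (ℕ × ℕ)} (h : GoodNode S J l x) (β : Bool) :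
    GoodNode S J (l + 1) (childNode (posMap S l) (2 ^ l) x β) := by
  refine ⟨?_, ?_, ?_, ?_⟩
  · have := h.path_lt
    rw [pow_succ]
    simp only [childNode]
    split_ifs <;> omega
  · simp [childNode, h.length_eq]
  · simp only [childNode, List.mem_map]
    rintro _ ⟨p, hp, rfl⟩
    exact ⟨posMap_mono S l β (h.le p hp).1, posMap_le S l β _⟩
  · have h1 : elements (wave S (l + 1)) (childNode (posMap S l) (2 ^ l) x β).2 =
        (elements (wave S l) x.2).filter fun v => v.testBit l == β := by
      simp only [elements, childNode, List.flatMap_map]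
      have hle := h.le
      generalize x.2 = I at hle
      induction I with
      | nil => rfl
      | cons p I ih =>
        rw [List.flatMap_cons, List.flatMap_cons, List.filter_append,
          ih fun q hq => hle q (by simp [hq]), slice_posMap S l β (hle p (by simp)).1]
    rw [h1, h.elements_eq, List.filter_filter]
    refine List.filter_congr fun v _ => ?_
    have h2 := h.path_lt
    have h3 : v % 2 ^ l < 2 ^ l := Nat.mod_lt _ (by positivity)
    rw [mod_two_pow_succ_eq]
    simp only [childNode]
    rw [Bool.eq_iff_iff]
    simp only [Bool.and_eq_true, beq_iff_eq]
    cases hb : v.testBit l <;> cases β <;> simp <;> omega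

theorem heavyNodes_good (hJ : ∀ p ∈ J, p.1 ≤ p.2 ∧ p.2 ≤ S.length) (l : ℕ) :
    ∀ x ∈ heavyNodes S thr acc J l, GoodNode S J l x := by
  induction l with
  | zero =>
    intro x hx
    obtain rfl := List.mem_singleton.1 hx
    exact ⟨by simp, rfl, hJ, by simp [elements, wave, Nat.mod_one]⟩
  | succ l ih =>
    intro x hx
    obtain ⟨y, hy, hxy⟩ := List.mem_flatMap.1 hx
    obtain ⟨β, -, rfl⟩ := List.mem_map.1 (List.mem_filter.1 hxy).1
    exact (ih y hy).child β

/-- Connects what the machine adds up, the lengths of intervals, with the size of a residue class.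
-/
theorem GoodNode.total_eq {l : ℕ} {x : ℕ × List (ℕ × ℕ)} (h : GoodNode S J l x) :
    total x.2 = (elements S J).countP fun v => v % 2 ^ l == x.1 := by
  rw [← length_elements (S := wave S l) (fun p hp => by rw [length_wave]; exact (h.le p hp).2),
    h.elements_eq, List.countP_eq_length_filter]

/-- By construction a node is kept only if its ancestors below the root were kept. This imposes
nothing extra: the class modulo a smaller power of two contains the given class, and `thr` is
monotone. The root is kept without a test, so the characterization starts at level 1. -/
theorem mem_heavyNodes_succ (hthr : Monotone thr) (hJ : ∀ p ∈ J, p.1 ≤ p.2 ∧ p.2 ≤ S.length)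
    (l c : ℕ) : c ∈ (heavyNodes S thr acc J (l + 1)).map Prod.fst ↔ c < 2 ^ (l + 1) ∧
      acc < thr ((elements S J).countP fun v => v % 2 ^ (l + 1) == c) := by
  have forward : ∀ l, ∀ x ∈ heavyNodes S thr acc J (l + 1),
      acc < thr ((elements S J).countP fun v => v % 2 ^ (l + 1) == x.1) := by
    intro l x hx
    have hg := heavyNodes_good hJ (l + 1) x hx
    obtain ⟨y, hy, hxy⟩ := List.mem_flatMap.1 hx
    rw [← hg.total_eq]
    simpa using (List.mem_filter.1 hxy).2
  have backward : ∀ l c : ℕ, c < 2 ^ (l + 1) →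
      acc < thr ((elements S J).countP fun v => v % 2 ^ (l + 1) == c) →
      c % 2 ^ l ∈ (heavyNodes S thr acc J l).map Prod.fst →
      c ∈ (heavyNodes S thr acc J (l + 1)).map Prod.fst := by
    intro l c hc h hm
    obtain ⟨y, hy, hyc⟩ := List.mem_map.1 hm
    have hgy := (heavyNodes_good hJ l y hy).child (c.testBit l)
    have hpath : (childNode (posMap S l) (2 ^ l) y (c.testBit l)).1 = c := by
      rw [childNode, hyc]
      simp only
      rw [← mod_two_pow_succ_eq, Nat.mod_eq_of_lt hc]
    refine List.mem_map.2 ⟨_, List.mem_flatMap.2 ⟨y, hy, List.mem_filter.2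
      ⟨List.mem_map.2 ⟨c.testBit l, by simp, rfl⟩, ?_⟩⟩, hpath⟩
    rw [hgy.total_eq, hpath]
    simpa using h
  induction l generalizing c with
  | zero =>
    constructor
    · intro h
      obtain ⟨x, hx, rfl⟩ := List.mem_map.1 h
      exact ⟨(heavyNodes_good hJ _ x hx).path_lt, forward _ x hx⟩
    · rintro ⟨h1, h2⟩
      exact backward 0 c h1 h2 (by simp [heavyNodes, Nat.mod_one])
  | succ l ih =>
    constructor
    · intro h
      obtain ⟨x, hx, rfl⟩ := List.mem_map.1 h
      exact ⟨(heavyNodes_good hJ _ x hx).path_lt, forward _ x hx⟩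
    · rintro ⟨h1, h2⟩
      refine backward (l + 1) c h1 h2 ((ih _).2 ⟨Nat.mod_lt _ (by positivity),
        h2.trans_le (hthr (List.countP_mono_left fun v _ hv => ?_))⟩)
      simp only [beq_iff_eq] at hv ⊢
      rw [← hv, Nat.mod_mod_of_dvd _ (pow_dvd_pow 2 (by omega))]

/-- Reduction modulo 2^l recovers the parent's path, so children of different nodes differ, and the
two children of one node differ in bit l. -/
theorem heavyNodes_nodup (hJ : ∀ p ∈ J, p.1 ≤ p.2 ∧ p.2 ≤ S.length) (l : ℕ) :
    ((heavyNodes S thr acc J l).map Prod.fst).Nodup := by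
  induction l with
  | zero => simp [heavyNodes]
  | succ l ih =>
    rw [heavyNodes, List.map_flatMap, List.nodup_flatMap]
    have hg := heavyNodes_good (thr := thr) (acc := acc) hJ l
    have hmod : ∀ x ∈ heavyNodes S thr acc J l,
        ∀ c ∈ (heavyChildren thr acc (posMap S l) (2 ^ l) x).map Prod.fst, c % 2 ^ l = x.1 := by
      intro x hx c hc
      obtain ⟨y, hy, rfl⟩ := List.mem_map.1 hc
      obtain ⟨β, -, rfl⟩ := List.mem_map.1 (List.mem_filter.1 hy).1
      have := (hg x hx).path_lt
      cases β <;> simp [childNode, Nat.mod_eq_of_lt this]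
    constructor
    · intro x _
      refine List.Sublist.nodup (List.filter_sublist.map Prod.fst) ?_
      have : 0 < 2 ^ l := by positivity
      simp [childNode]
    · rw [List.Nodup, List.pairwise_map] at ih
      refine ih.imp_of_mem fun {x y} hx hy hne => ?_
      refine List.disjoint_left.2 fun c hc hc' => hne ?_
      rw [← hmod x hx c hc, ← hmod y hy c hc']

/-- An element `v` contributes only to the count for `g v`, and this value occurs at most once in
`P`. -/
theorem sum_countP_le {α : Type*} (g : α → ℕ) (T : List α) {P : List ℕ} (hP : P.Nodup) :
    (P.map fun p => T.countP fun v => g v == p).sum ≤ T.length := by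
  induction T with
  | nil => simp
  | cons v T ih =>
    simp only [List.countP_cons, List.sum_map_add, List.length_cons]
    refine Nat.add_le_add ih ?_
    have h1 : (P.map fun p => if (g v == p) = true then 1 else 0).sum = P.count (g v) := by
      clear ih hP
      induction P with
      | nil => rfl
      | cons p P ih =>
        rw [List.map_cons, List.sum_cons, ih, List.count_cons]
        by_cases h : g v = p
        · simp [h, add_comm]
        · simp [h, Ne.symm h]
    rw [h1]
    exact List.nodup_iff_count_le_one.1 hP _

/-- The threshold function: the number of all elements is less than `threshold τ n c` if and only if
`c` of them are at least a fraction `1 / τ`. -/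
noncomputable def threshold (τ : ℝ) (n c : ℕ) : ℕ :=
  if c = 0 then 0 else min ⌊τ * c⌋₊ n + 1

theorem threshold_mono {τ : ℝ} (hτ : 0 ≤ τ) (n : ℕ) : Monotone (threshold τ n) := by
  intro a b hab
  simp only [threshold]
  split_ifs with h1 h2 h2
  · exact le_rfl
  · exact Nat.zero_le _
  · omega
  · refine Nat.add_le_add_right (min_le_min_right _ (Nat.floor_le_floor ?_)) 1
    exact mul_le_mul_of_nonneg_left (by exact_mod_cast hab) hτ

/-- Replaces the comparison with the real number τ by one look-up. The value 0 at `c = 0` rules out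
empty classes even if the rectangle is empty. The cap at `n` keeps the entries word-sized and is
harmless because `N ≤ n`. -/
theorem lt_threshold {τ : ℝ} (hτ : 0 ≤ τ) {n N c : ℕ} (hN : N ≤ n) :
    N < threshold τ n c ↔ 0 < c ∧ (N : ℝ) ≤ τ * c := by
  rw [threshold]
  split_ifs with h
  · simp [h]
  · rw [Nat.lt_succ_iff, le_min_iff, Nat.le_floor_iff (by positivity)]
    simp only [hN, and_true, Nat.pos_of_ne_zero h, true_and]

/-- Let N be the number of elements in all intervals. Each of k heavy classes has at least N / τ
elements and they are disjoint, so k N ≤ τ N; divide by N. If N = 0, no nonempty class exists. Heavy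
classes are nonempty, so also k ≤ N ≤ n, which makes the buffer size independent of how large τ is.
-/
theorem length_heavyNodes_le {τ : ℝ} (hτ : 1 ≤ τ) {n : ℕ} (hn : 1 ≤ n)
    (hJ : ∀ p ∈ J, p.1 ≤ p.2 ∧ p.2 ≤ S.length) (hJn : total J ≤ n) (l : ℕ) :
    (heavyNodes S (threshold τ n) (total J) J l).length ≤ min ⌊τ⌋₊ n := by
  have hτ0 : (0 : ℝ) ≤ τ := by linarith
  cases l with
  -- The root is kept even if it is not heavy; the bound 1 for it comes from 1 ≤ τ and 1 ≤ n.
  | zero => exact le_min (Nat.le_floor (by simpa [heavyNodes] using hτ)) hn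
  | succ l =>
    set H := heavyNodes S (threshold τ n) (total J) J (l + 1) with hH
    set cnt : ℕ → ℕ := fun c => (elements S J).countP fun v => v % 2 ^ (l + 1) == c with hcnt
    have hlen : (elements S J).length = total J := length_elements fun p hp => (hJ p hp).2
    have hheavy : ∀ c ∈ H.map Prod.fst, 0 < cnt c ∧ (total J : ℝ) ≤ τ * cnt c := by
      intro c hc
      exact (lt_threshold hτ0 hJn).1
        ((mem_heavyNodes_succ (threshold_mono hτ0 n) hJ l c).1 hc).2
    have hsum : ((H.map Prod.fst).map cnt).sum ≤ total J := by
      rw [← hlen]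
      exact sum_countP_le (fun v => v % 2 ^ (l + 1)) _ (heavyNodes_nodup hJ (l + 1))
    rw [← List.length_map (f := Prod.fst)]
    generalize H.map Prod.fst = P at hheavy hsum
    have h1 : P.length ≤ (P.map cnt).sum := by
      have := List.card_nsmul_le_sum (P.map cnt) 1 (by
        simp only [List.mem_map]
        rintro _ ⟨c, hc, rfl⟩
        exact (hheavy c hc).1)
      simpa using this
    refine le_min (Nat.le_floor ?_) (by omega)
    have h2 : (P.length : ℝ) * total J ≤ τ * (P.map cnt).sum := by
      clear hsum h1
      induction P with
      | nil => simp
      | cons c P ih =>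
        have e1 := ih fun c' hc' => hheavy c' (by simp [hc'])
        have e2 := (hheavy c (by simp)).2
        simp only [List.length_cons, List.map_cons, List.sum_cons]
        rw [Nat.cast_succ, Nat.cast_add]
        linarith
    rcases Nat.eq_zero_or_pos (total J) with h0 | h0
    · have : P.length = 0 := by omega
      rw [this]; simpa using hτ0
    · have h3 : (P.length : ℝ) * total J ≤ τ * total J := by
        refine h2.trans (mul_le_mul_of_nonneg_left ?_ hτ0)
        exact_mod_cast hsum
      exact le_of_mul_le_mul_right h3 (by exact_mod_cast h0)

/-! ## Rank tables -/

/-- The bits at positions `q * b, …, q * b + b - 1` of level `l` of the wavelet matrix, in one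
word. -/
def packedBits (S : List ℕ) (b l q : ℕ) : ℕ :=
  Nat.ofBits fun i : Fin b => ((wave S l).getD (q * b + i) 0).testBit l

/-- The number of ones among the lowest `b` bits. -/
def popCount (b v : ℕ) : ℕ := (List.range b).countP fun i => v.testBit i

theorem popCount_le (b v : ℕ) : popCount b v ≤ b := by
  simpa [popCount] using List.countP_le_length (p := fun i => v.testBit i) (l := List.range b)

theorem slice_eq_map_range (xs : List ℕ) {a j : ℕ} (h : a + j ≤ xs.length) :
    slice xs a (a + j) = (List.range j).map fun i => xs.getD (a + i) 0 := by
  apply List.ext_getElem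
  · rw [length_slice h]; simp
  · intro i h1 h2
    simp only [List.length_map, List.length_range] at h2
    simp [slice, List.getElem?_eq_getElem (show a + i < xs.length by omega)]

/-- Reduction modulo 2^j clears all bits from position j on, so a table that counts `b` bits also
counts the first j of them. -/
theorem popCount_packedBits (S : List ℕ) {b l q j : ℕ} (hj : j ≤ b) (h : q * b + j ≤ S.length) :
    popCount b (packedBits S b l q % 2 ^ j) =
      (slice (wave S l) (q * b) (q * b + j)).countP fun v => v.testBit l := by
  rw [slice_eq_map_range _ (by rwa [length_wave]), List.countP_map, popCount]
  obtain ⟨k, rfl⟩ := Nat.exists_eq_add_of_le hj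
  rw [List.range_add, List.countP_append, Nat.add_eq_left.2]
  · refine List.countP_congr fun i hi => ?_
    rw [List.mem_range] at hi
    simp [packedBits, Nat.testBit_mod_two_pow, hi, Nat.testBit_ofBits_lt _ i (by omega : i < j + k)]
  · rw [List.countP_eq_zero]
    intro i hi
    obtain ⟨i, -, rfl⟩ := List.mem_map.1 hi
    simp [Nat.testBit_mod_two_pow]

theorem countP_take_add (xs : List ℕ) (P : ℕ → Bool) {a p : ℕ} (h : a ≤ p) :
    (xs.take p).countP P = (xs.take a).countP P + (slice xs a p).countP P := by
  rw [← List.countP_append, slice]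
  conv_lhs => rw [← List.take_append_drop a (xs.take p)]
  rw [List.take_take, Nat.min_eq_left h]

/-- Ones and zeros in a stretch of length j add up to j, so a single bit count serves both children.
-/
theorem posMap_add (S : List ℕ) {l a j : ℕ} (h : a + j ≤ S.length) :
    (slice (wave S l) a (a + j)).countP (fun v => v.testBit l) ≤ j ∧
    posMap S l true a + (slice (wave S l) a (a + j)).countP (fun v => v.testBit l) =
      posMap S l true (a + j) ∧
    posMap S l false a + (j - (slice (wave S l) a (a + j)).countP fun v => v.testBit l) =
      posMap S l false (a + j) := by
  have h1 : (slice (wave S l) a (a + j)).length = j := by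
    rw [length_slice (by rwa [length_wave])]; omega
  have h2 := List.length_eq_countP_add_countP (fun v => v.testBit l)
    (l := slice (wave S l) a (a + j))
  have h3 : (fun v : ℕ => decide ¬ v.testBit l = true) = fun v => ! v.testBit l := by
    funext v; simp
  rw [h3] at h2
  refine ⟨by omega, ?_, ?_⟩
  · simp only [posMap, if_true]
    rw [countP_take_add _ _ (Nat.le_add_right a j), add_assoc]
  · simp only [posMap, Bool.false_eq_true, if_false]
    rw [countP_take_add _ _ (Nat.le_add_right a j)]
    omega

/-! ## The layout of the memory -/

/-- The numbers and tables from which the memory is made up. -/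
structure Layout where
  n : ℕ
  h : ℕ
  b : ℕ
  M : ℕ
  NB : ℕ
  B : ℕ
  thr : ℕ → ℕ
  col : ℕ → ℕ
  pop : ℕ → ℕ
  bits : ℕ → ℕ → ℕ
  z0 : ℕ → ℕ → ℕ
  z1 : ℕ → ℕ → ℕ

/-- The variables that stay fixed during a query. -/
def globalVars : List Var :=
  [vN, vH, vB, vM, vNB, vThr, vCol, vPop, vBits, vZ0, vZ1, vWB, vWC, vEnd]

namespace Layout
variable (P : Layout)

/-- The start of the working space. -/
def start : ℕ := 14 + (P.n + 1) + P.n + (P.n + 1) + P.h * P.NB + P.h * P.NB + P.h * P.NB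

/-- The number of memory words. -/
def size : ℕ := P.start + P.B + P.B

/-- The values of the fixed variables. -/
def env : Var → ℕ
  | vN => P.n
  | vH => P.h
  | vB => P.b
  | vM => P.M
  | vNB => P.NB
  | vThr => 14
  | vCol => 14 + (P.n + 1)
  | vPop => 14 + (P.n + 1) + P.n
  | vBits => 14 + (P.n + 1) + P.n + (P.n + 1)
  | vZ0 => 14 + (P.n + 1) + P.n + (P.n + 1) + P.h * P.NB
  | vZ1 => 14 + (P.n + 1) + P.n + (P.n + 1) + P.h * P.NB + P.h * P.NB
  | vWB => P.start
  | vWC => P.start + P.B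
  | vEnd => P.start + P.B + P.B
  | _ => 0

/-- The words. -/
def mem (a : ℕ) : ℕ :=
  if a < 14 then (globalVars.map P.env).getD a 0
  else if a < P.env vCol then P.thr (a - P.env vThr)
  else if a < P.env vPop then P.col (a - P.env vCol)
  else if a < P.env vBits then P.pop (a - P.env vPop)
  else if a < P.env vZ0 then P.bits ((a - P.env vBits) / P.NB) ((a - P.env vBits) % P.NB)
  else if a < P.env vZ1 then P.z0 ((a - P.env vZ0) / P.NB) ((a - P.env vZ0) % P.NB)
  else if a < P.env vWB then P.z1 ((a - P.env vZ1) / P.NB) ((a - P.env vZ1) % P.NB)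
  else 0

theorem env_eq : P.env vThr = 14 ∧ P.env vCol = P.env vThr + (P.n + 1) ∧
    P.env vPop = P.env vCol + P.n ∧ P.env vBits = P.env vPop + (P.n + 1) ∧
    P.env vZ0 = P.env vBits + P.h * P.NB ∧ P.env vZ1 = P.env vZ0 + P.h * P.NB ∧
    P.env vWB = P.env vZ1 + P.h * P.NB ∧ P.start = P.env vWB :=
  ⟨rfl, rfl, rfl, rfl, rfl, rfl, rfl, rfl⟩

theorem mem_thr {c : ℕ} (hc : c ≤ P.n) : P.mem (P.env vThr + c) = P.thr c := by
  have := P.env_eq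
  rw [mem, if_neg (by omega), if_pos (by omega), Nat.add_sub_cancel_left]

theorem mem_col {c : ℕ} (hc : c < P.n) : P.mem (P.env vCol + c) = P.col c := by
  have := P.env_eq
  rw [mem, if_neg (by omega), if_neg (by omega), if_pos (by omega), Nat.add_sub_cancel_left]

theorem mem_pop {c : ℕ} (hc : c ≤ P.n) : P.mem (P.env vPop + c) = P.pop c := by
  have := P.env_eq
  rw [mem, if_neg (by omega), if_neg (by omega), if_neg (by omega), if_pos (by omega),
    Nat.add_sub_cancel_left]

theorem index_lt {l q : ℕ} (hl : l < P.h) (hq : q < P.NB) : l * P.NB + q < P.h * P.NB := by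
  have := Nat.mul_le_mul_right P.NB (Nat.succ_le_of_lt hl)
  rw [Nat.succ_mul] at this
  omega

theorem index_div {l q : ℕ} (hq : q < P.NB) :
    (l * P.NB + q) / P.NB = l ∧ (l * P.NB + q) % P.NB = q := by
  have h0 : 0 < P.NB := by omega
  rw [mul_comm, Nat.mul_add_div h0, Nat.mul_add_mod, Nat.div_eq_of_lt hq, Nat.mod_eq_of_lt hq]
  simp

theorem mem_bits {l q : ℕ} (hl : l < P.h) (hq : q < P.NB) :
    P.mem (P.env vBits + (l * P.NB + q)) = P.bits l q := by
  have := P.index_lt hl hq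
  obtain ⟨h1, h2⟩ := P.index_div (l := l) hq
  have := P.env_eq
  rw [mem, if_neg (by omega), if_neg (by omega), if_neg (by omega), if_neg (by omega),
    if_pos (by omega), Nat.add_sub_cancel_left, h1, h2]

theorem mem_z0 {l q : ℕ} (hl : l < P.h) (hq : q < P.NB) :
    P.mem (P.env vZ0 + (l * P.NB + q)) = P.z0 l q := by
  have := P.index_lt hl hq
  obtain ⟨h1, h2⟩ := P.index_div (l := l) hq
  have := P.env_eq
  rw [mem, if_neg (by omega), if_neg (by omega), if_neg (by omega), if_neg (by omega),
    if_neg (by omega), if_pos (by omega), Nat.add_sub_cancel_left, h1, h2]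

theorem mem_z1 {l q : ℕ} (hl : l < P.h) (hq : q < P.NB) :
    P.mem (P.env vZ1 + (l * P.NB + q)) = P.z1 l q := by
  have := P.index_lt hl hq
  obtain ⟨h1, h2⟩ := P.index_div (l := l) hq
  have := P.env_eq
  rw [mem, if_neg (by omega), if_neg (by omega), if_neg (by omega), if_neg (by omega),
    if_neg (by omega), if_neg (by omega), if_pos (by omega), Nat.add_sub_cancel_left, h1, h2]

theorem mem_work {a : ℕ} (ha : P.start ≤ a) : P.mem a = 0 := by
  have := P.env_eq
  rw [mem, if_neg (by omega), if_neg (by omega), if_neg (by omega), if_neg (by omega),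
    if_neg (by omega), if_neg (by omega), if_neg (by omega)]

/-- The words are bounded if the numbers and tables are. -/
theorem mem_lt {W : ℕ} (h0 : 0 < W) (hsize : P.size < W) (hb : P.b < W) (hM : P.M < W)
    (hh : P.h < W) (hNB : P.NB < W)
    (hthr : ∀ c, P.thr c < W) (hcol : ∀ c < P.n, P.col c < W) (hpop : ∀ c, P.pop c < W)
    (hbits : ∀ l q, P.bits l q < W) (hz0 : ∀ l q, P.z0 l q < W) (hz1 : ∀ l q, P.z1 l q < W)
    (a : ℕ) : P.mem a < W := by
  have henv : ∀ v, P.env v < W := by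
    intro v
    simp only [size, start] at hsize
    cases v <;> simp only [env, start] <;> omega
  rw [mem]
  split_ifs with h1 h2 h3
  · rw [List.getD_eq_getElem _ _ (by simpa [globalVars] using h1), List.getElem_map]
    exact henv _
  · exact hthr _
  · refine hcol _ ?_
    simp only [env] at h2 h3 ⊢
    omega
  · exact hpop _
  · exact hbits _ _
  · exact hz0 _ _
  · exact hz1 _ _
  · exact h0

/-- The layout holds the rank tables of the list `S`. -/
structure RankData (S : List ℕ) : Prop where
  b_pos : 0 < P.b
  two_pow_b : 2 ^ P.b ≤ P.n
  M_eq : P.M = S.length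
  NB_eq : P.NB = P.M / P.b + 1
  pop_eq : P.pop = popCount P.b
  bits_eq : P.bits = packedBits S P.b
  z0_eq : ∀ l q, P.z0 l q = posMap S l false (q * P.b)
  z1_eq : ∀ l q, P.z1 l q = posMap S l true (q * P.b)

/-- Interval ends are exclusive, so p = M occurs; the summand 1 in `NB = M / b + 1` provides a word
for it. The masked word is less than 2^b ≤ n, hence a valid index into the table of bit counts. -/
theorem RankData.rankTables {P : Layout} {S : List ℕ} (hP : P.RankData S) {ι : Type}
    {μ : Machine ι} {s : St} {l : ℕ} (hl : l < P.h) (hs : s.env vLev = l)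
    (henv : ∀ v ∈ globalVars, s.env v = P.env v) (hmem : ∀ a < P.start, s.mem a = P.mem a)
    (hw : P.n < 2 ^ μ.w) : RankTables μ s (posMap S l) P.M := by
  intro p hp
  have e2 := henv vNB (by simp [globalVars])
  have e3 := henv vB (by simp [globalVars])
  have e4 := henv vPop (by simp [globalVars])
  have e5 := henv vBits (by simp [globalVars])
  have e6 := henv vZ0 (by simp [globalVars])
  have e7 := henv vZ1 (by simp [globalVars])
  have e8 := henv vWB (by simp [globalVars])
  have hq : p / P.b < P.NB := by
    rw [hP.NB_eq]
    exact Nat.lt_succ_of_le (Nat.div_le_div_right hp)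
  have hidx := P.index_lt hl hq
  have hj : p % P.b < P.b := Nat.mod_lt _ hP.b_pos
  have hpb : p / P.b * P.b + p % P.b = p := by rw [mul_comm]; exact Nat.div_add_mod p P.b
  have hx : packedBits S P.b l (p / P.b) % 2 ^ (p % P.b) < 2 ^ (p % P.b) :=
    Nat.mod_lt _ (by positivity)
  have hpow : 2 ^ (p % P.b) ≤ 2 ^ P.b := Nat.pow_le_pow_right two_pos hj.le
  have hxn := hP.two_pow_b
  have hsum := posMap_add S (l := l) (a := p / P.b * P.b) (j := p % P.b)
    (by rw [hpb, ← hP.M_eq]; exact hp)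
  rw [← popCount_packedBits S hj.le (by rw [hpb, ← hP.M_eq]; exact hp), hpb] at hsum
  have hst : P.env vBits + P.h * P.NB + P.h * P.NB + P.h * P.NB = P.start := rfl
  have hst0 : P.env vZ0 = P.env vBits + P.h * P.NB := rfl
  have hst1 : P.env vZ1 = P.env vBits + P.h * P.NB + P.h * P.NB := rfl
  have hst2 : P.env vBits = P.env vPop + (P.n + 1) := rfl
  have hst3 : P.env vWB = P.start := rfl
  refine ⟨l * P.NB + p / P.b, popCount P.b (packedBits S P.b l (p / P.b) % 2 ^ (p % P.b)),
    packedBits S P.b l (p / P.b) % 2 ^ (p % P.b), ?_, ?_, ?_, ?_, ?_, ?_, ?_, ?_, ?_, ?_, ?_,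
    ?_, ?_⟩
  · rw [hs, e2, e3]; rfl
  · rw [e5, e3, hmem _ (by omega), P.mem_bits hl hq, hP.bits_eq]; rfl
  · rw [e4, hmem _ (by omega), P.mem_pop (by omega), hP.pop_eq]
  · omega
  · omega
  · omega
  · omega
  · rw [e3]
    exact lt_of_le_of_lt (hpow.trans hxn) hw
  · rw [e3]; exact hsum.1
  · rw [e7, hmem _ (by omega), P.mem_z1 hl hq, hP.z1_eq]
    exact hsum.2.1
  · rw [e6, e3, hmem _ (by omega), P.mem_z0 hl hq, hP.z0_eq]
    exact hsum.2.2
  · rw [hP.M_eq]; exact posMap_le S l true p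
  · rw [hP.M_eq]; exact posMap_le S l false p

end Layout

/-! ## The query program -/

/-- Load consecutive words, from address `i` on, into variables. -/
def loadVars {ι : Type} : ℕ → List Var → Prog ι
  | _, [] => .skip
  | i, v :: ws => v ::= .load (const i) ;; loadVars (i + 1) ws

/-- Initialize the fixed variables, and put the interval of all positions into the first buffer. -/
def setUp {ι : Type} : Prog ι :=
  loadVars 0 globalVars ;;
  vX ::= vWB ;; vY ::= vWC ;; vLen ::= const 1 ;; vMj ::= vN ;;
  .store vX (const 0) ;; .store (vX + const 1) vN

/-- The search in the range tree, up to coordinate `j`. -/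
def stages {d : ℕ} : (j : ℕ) → j < d → Prog (Fin d ⊕ Fin d)
  | 0, h => search ⟨0, h⟩
  | j + 1, h => stages j (Nat.lt_of_succ_lt h) ;; expand ;; search ⟨j + 1, h⟩

/-- Turn the list of intervals into the root node of the search for heavy colours. -/
def makeRoot {ι : Type} : Prog ι :=
  vAcc ::= vNum ;; vNl ::= vLen ;; .store (vX + vLen * const 2) (const 0) ;; vLen ::= const 1 ;;
  vLev ::= const 0 ;; vPw ::= const 1

/-- Report the colours that belong to the nodes. -/
def report {ι : Type} : Prog ι :=
  .loop vLen
    (.emit (.load (vCol + .load (vX + vNl * const 2))) ;; vX ::= vX + (vNl * const 2 + const 1) ;;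
      vLen ::= vLen - const 1)

/-- Reset the working space. -/
def cleanUp {ι : Type} : Prog ι :=
  vSrc ::= vWB ;; .loop (.less vSrc vEnd) (.store vSrc (const 0) ;; vSrc ::= vSrc + const 1)

/-- The query program in dimension `e + 1`. -/
def query (e : ℕ) : Prog (Fin (e + 1) ⊕ Fin (e + 1)) :=
  setUp ;; stages e (Nat.lt_succ_self e) ;; makeRoot ;; .loop (.less vLev vH) level ;;
  report ;; cleanUp

/-- What holds throughout a query. -/
structure Base (P : Layout) (s : St) : Prop where
  env : ∀ v ∈ globalVars, s.env v = P.env v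
  mem : ∀ a < P.start, s.mem a = P.mem a
  buffers : s.env vX = P.start ∧ s.env vY = P.start + P.B ∨
    s.env vX = P.start + P.B ∧ s.env vY = P.start
  out : s.out = []

theorem Base.facts {P : Layout} {s : St} (h : Base P s) :
    (s.env vX + P.B ≤ s.env vY ∨ s.env vY + P.B ≤ s.env vX) ∧ s.env vX + P.B ≤ P.size ∧
      s.env vY + P.B ≤ P.size ∧ P.start ≤ s.env vX ∧ P.start ≤ s.env vY := by
  have := h.buffers
  rw [Layout.size]
  omega

theorem Base.swap {P : Layout} {s s' : St} (h : Base P s)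
    (he : ∀ v ∈ globalVars, s'.env v = s.env v)
    (hm : ∀ a, a < s.env vY ∨ s.env vY + P.B ≤ a → s'.mem a = s.mem a)
    (hX : s'.env vX = s.env vY) (hY : s'.env vY = s.env vX) (ho : s'.out = s.out) : Base P s' := by
  refine ⟨fun v hv => by rw [he v hv, h.env v hv], fun a ha => ?_, ?_, by rw [ho, h.out]⟩
  · rw [hm a (Or.inl (lt_of_lt_of_le ha h.facts.2.2.2.2)), h.mem a ha]
  · rw [hX, hY]
    exact h.buffers.symm.imp And.symm And.symm

/-- The machine `μ` holds the layout `P` for the points `x` with colour codes `code`; the query is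
the rectangle with bounds `lo` and `hi`. -/
structure Setting (e : ℕ) (μ : Machine (Fin (e + 1) ⊕ Fin (e + 1))) (P : Layout)
    (x : ℕ → Fin P.n → ℝ) (code : Fin P.n → ℕ) (τ : ℝ) (lo hi : ℕ → ℝ) (L A : ℕ) : Prop where
  size_eq : μ.size = P.size
  size_lt : P.size + 14 < 2 ^ μ.w
  keySize_eq : μ.keySize = (e + 1) * P.M
  keySize_lt : μ.keySize + P.M < 2 ^ μ.w
  key_eq : ∀ j ≤ e, ∀ a v, (layer x P.h j)[a]? = some v → μ.key (j * P.M + a) = x j v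
  lo_eq : ∀ j, μ.q (.inl j) = lo j
  hi_eq : ∀ j, μ.q (.inr j) = hi j
  n_lt : P.n < 2 ^ P.h
  h_pos : 1 ≤ P.h
  n_pos : 1 ≤ P.n
  pow_h_lt : 2 ^ P.h * 2 < 2 ^ μ.w
  h_lt : 2 * P.h < 2 ^ μ.w
  M_eq : P.M = P.n * P.h ^ e
  L_eq : L = (2 * P.h) ^ e
  A_eq : A = min ⌊τ⌋₊ P.n
  B_eq : P.B = (A + 1) * (2 * L + 1)
  LM_lt : L * P.M < 2 ^ μ.w
  M_lt : 2 * P.M + 2 < 2 ^ μ.w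
  Mh_lt : P.M * P.h < 2 ^ μ.w
  code_lt : ∀ v, code v < P.n
  one_le : 1 ≤ τ
  thr_eq : P.thr = threshold τ P.n
  rankData : P.RankData ((layer x P.h e).map code)

/-! ### Correctness and running time of the range tree phase -/

namespace Machine

/-- One program serves all `n` and τ, so sizes and addresses cannot be constants in it; they are
read from the head of the memory. -/
theorem Wp.loadVars {ι : Type} {μ : Machine ι} (ws : List Var) (hvs : ws.Nodup) (i : ℕ) (s : St)
    (hi : i + ws.length ≤ μ.size) (hw : μ.size < 2 ^ μ.w) :
    μ.Wp (Domination.loadVars i ws) s fun s' t => t ≤ 4 * ws.length + 1 ∧ s'.mem = s.mem ∧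
      s'.out = s.out ∧ (∀ v ∉ ws, s'.env v = s.env v) ∧
      ∀ k (hk : k < ws.length), s'.env ws[k] = s.mem (i + k) := by
  induction ws generalizing i s with
  | nil => exact Wp.skip ⟨by simp, rfl, rfl, fun _ _ => rfl, by simp⟩
  | cons v ws ih =>
    rw [List.nodup_cons] at hvs
    simp only [List.length_cons] at hi ⊢
    refine Wp.seq (Wp.assign ⟨by simp; omega, by simp; omega⟩ ?_)
    refine (ih hvs.2 (i + 1) _ (by omega)).mono ?_
    rintro s' t ⟨ht, hm, ho, he, hk⟩
    refine ⟨by simp; omega, hm, ho, fun y hy => ?_, fun k hlt => ?_⟩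
    · rw [List.mem_cons, not_or] at hy
      rw [he y hy.2]
      simp [hy.1]
    · rcases k with - | k
      · rw [List.getElem_cons_zero, he v hvs.1]
        simp
      · rw [List.getElem_cons_succ, hk k (by omega)]
        simp only [St.mem_set]
        congr 1
        omega

section
variable {e : ℕ} {μ : Machine (Fin (e + 1) ⊕ Fin (e + 1))} {P : Layout} {x : ℕ → Fin P.n → ℝ}
  {code : Fin P.n → ℕ} {τ : ℝ} {lo hi : ℕ → ℝ} {L A : ℕ}

theorem _root_.Domination.Setting.three_le (H : Setting e μ P x code τ lo hi L A) :
    1 ≤ A ∧ 1 ≤ L ∧ 3 ≤ P.B := by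
  have hA : 1 ≤ A := by
    rw [H.A_eq]
    exact le_min (Nat.le_floor (by simpa using H.one_le)) H.n_pos
  have hL : 1 ≤ L := by
    rw [H.L_eq]
    exact Nat.one_le_pow _ _ (by have := H.h_pos; omega)
  refine ⟨hA, hL, ?_⟩
  rw [H.B_eq]
  calc 3 ≤ 1 * 3 := by norm_num
    _ ≤ _ := Nat.mul_le_mul (by omega) (by omega)

theorem Wp.setUp (H : Setting e μ P x code τ lo hi L A) (s : St) (henv : ∀ v, s.env v = 0)
    (hmem : s.mem = P.mem) (hout : s.out = []) :
    μ.Wp Domination.setUp s fun s' t => t ≤ 100 ∧ Base P s' ∧ s'.env vLen = 1 ∧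
      s'.env vMj = P.n ∧ s'.env vKb = 0 ∧ Holds s'.mem (s'.env vX) (flat [(0, P.n)]) := by
  have hB := H.three_le
  have hs : P.size = P.start + P.B + P.B := rfl
  have h14 : 14 ≤ P.start := by simp only [Layout.start]; omega
  have hw := H.size_lt
  have hsz := H.size_eq
  have one_lt := μ.one_lt_two_pow
  have pos : 0 < 2 ^ μ.w := by omega
  apply Wp.seq
  refine (Wp.loadVars globalVars (by decide) 0 s (by simp [globalVars]; omega) (by omega)).mono ?_
  rintro s1 t1 ⟨ht1, hm1, ho1, he1, hk1⟩
  have hglob : ∀ v ∈ globalVars, s1.env v = P.env v := by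
    intro v hv
    obtain ⟨k, hk, rfl⟩ := List.mem_iff_getElem.1 hv
    rw [hk1 k hk, hmem, zero_add, Layout.mem, if_pos (show k < 14 from hk)]
    simp [List.getElem?_eq_getElem hk]
  have eN : s1.env vN = P.n := hglob vN (by simp [globalVars])
  have eWB : s1.env vWB = P.start := hglob vWB (by simp [globalVars])
  have eWC : s1.env vWC = P.start + P.B := hglob vWC (by simp [globalVars])
  apply Vc.wp
  simp only [Vc, Expr.ok_add, Expr.ok_var, Expr.ok_const, Expr.eval_add, Expr.eval_var,
    Expr.eval_const, St.env_set, St.env_put, true_and, reduceCtorEq, if_false, if_true,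
    Expr.cost_add, Expr.cost_var, Expr.cost_const, eN, eWB, eWC, hsz]
  have ht : t1 ≤ 4 * 14 + 1 := ht1
  refine ⟨one_lt, by omega, pos, ⟨one_lt, by omega⟩, by omega, by omega, ⟨?_, ?_, ?_, ?_⟩, ?_⟩
  · intro v hv
    rw [← hglob v hv]
    simp only [globalVars, List.mem_cons, List.not_mem_nil, or_false] at hv
    rcases hv with rfl | rfl | rfl | rfl | rfl | rfl | rfl | rfl | rfl | rfl | rfl | rfl | rfl |
      rfl <;> simp
  · intro a ha
    simp only [St.mem_put, St.mem_set]
    rw [if_neg (by omega), if_neg (by omega), hm1, hmem]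
  · simp
  · simp [ho1, hout]
  · refine ⟨?_, ?_⟩
    -- `vKb` has not been assigned: it is zero because all registers start at zero, and the
    -- coordinates for layer 0 start at address 0.
    · rw [he1 _ (by decide), henv]
    · simp only [flat_cons, flat_nil, holds_cons, St.mem_put, St.mem_set]
      simp [holds_nil]

/-- The state after the search for coordinates `0, …, j - 1` or `0, …, j`: the buffer holds the
intervals `J` of layer `j`, which contain the points `T`. -/
structure _root_.Domination.StageState (P : Layout) (x : ℕ → Fin P.n → ℝ) (j : ℕ) (J : List (ℕ × ℕ))
    (T : List (Fin P.n)) (s : St) : Prop extends Base P s where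
  length_eq : J.length = (2 * P.h) ^ j
  good : ∀ p ∈ J, GoodInterval P.n P.h j p
  perm : (J.flatMap fun p => slice (layer x P.h j) p.1 p.2).Perm T
  len_eq : s.env vLen = J.length
  mj_eq : s.env vMj = P.n * P.h ^ j
  kb_eq : s.env vKb = j * P.M
  holds : Holds s.mem (s.env vX) (flat J)

theorem _root_.Domination.Setting.layer_le (H : Setting e μ P x code τ lo hi L A) {j : ℕ}
    (hj : j ≤ e) : P.n * P.h ^ j ≤ P.M ∧ (2 * P.h) ^ j ≤ L := by
  rw [H.M_eq, H.L_eq]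
  have := H.h_pos
  exact ⟨Nat.mul_le_mul_left _ (Nat.pow_le_pow_right H.h_pos hj),
    Nat.pow_le_pow_right (by omega) hj⟩

theorem globalVars_search : ∀ v ∈ globalVars, v ∉ searchVars ∧ v ≠ vX ∧ v ≠ vY := by decide

theorem globalVars_expand : ∀ v ∈ globalVars, v ∉ expandVars ∧ v ∉ [vX, vY, vLen, vMj, vKb] := by
  decide

theorem globalVars_level : ∀ v ∈ globalVars, v ∉ levelVars ∧ v ∉ [vX, vY, vLen, vLev, vPw] := by
  decide

theorem _root_.Domination.exists_of_forall₂_mem {α β : Type*} {R : α → β → Prop} {xs : List α}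
    {ys : List β} (h : List.Forall₂ R xs ys) {y : β} (hy : y ∈ ys) : ∃ x ∈ xs, R x y := by
  obtain ⟨i, hi, rfl⟩ := List.mem_iff_getElem.1 hy
  have hi' : i < xs.length := by rw [h.length_eq]; exact hi
  exact ⟨xs[i], List.getElem_mem _, h.get hi' hi⟩

open Classical in
theorem Wp.search_stage (H : Setting e μ P x code τ lo hi L A) {j : ℕ} (hj : j < e + 1)
    {I : List (ℕ × ℕ)} {T : List (Fin P.n)} {s : St} (hs : StageState P x j I T s)
    (hI : ∀ p ∈ I, SortedBlock x P.h j p) :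
    μ.Wp (Domination.search ⟨j, hj⟩) s fun s' t => t ≤ (2 * P.h) ^ j * (100 * P.h + 200) + 50 ∧
      ∃ J, StageState P x j J (T.filter fun v => lo j ≤ x j v ∧ x j v ≤ hi j) s' ∧
        s'.env vNum = total J := by
  obtain ⟨hM, hL⟩ := H.layer_le (Nat.le_of_lt_succ hj)
  obtain ⟨hxy, hXs, hYs, -, -⟩ := hs.facts
  have hsz := H.size_eq
  have hw := H.size_lt
  have hMlt := H.M_lt
  have hkey : j * P.M + P.M ≤ μ.keySize := by
    rw [H.keySize_eq, ← Nat.succ_mul]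
    exact Nat.mul_le_mul_right _ hj
  have hκ : ∀ a v, (layer x P.h j)[a]? = some v → μ.key (s.env vKb + a) = x j v := by
    intro a v hav
    rw [hs.kb_eq]
    exact H.key_eq j (Nat.le_of_lt_succ hj) a v hav
  have hkw := H.keySize_lt
  have hB : 2 * L ≤ P.B := by
    obtain ⟨hA, -, -⟩ := H.three_le
    rw [H.B_eq]
    calc 2 * L ≤ 1 * (2 * L + 1) := by omega
      _ ≤ _ := Nat.mul_le_mul_right _ (by omega)
  refine (Wp.search ⟨j, hj⟩ s I P.B P.h (P.n * P.h ^ j) hxy hs.len_eq hs.holds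
    (by rw [hs.length_eq]; omega) (by omega) (by omega) (by omega) ?_ (by omega)
    (by rw [hs.kb_eq]; omega) (by omega) ?_).mono ?_
  · intro p hp
    obtain ⟨h1, h2, h3⟩ := hs.good p hp
    exact ⟨h1, h2, h3, fun a b ha hab hb => (hI p hp).key_le x P.h h3 hκ ha hab hb⟩
  · rw [hs.length_eq]
    exact (Nat.mul_le_mul hL hM).trans_lt H.LM_lt
  · rintro s' t ⟨ht, he, hm, hX, hY, ho, J, hJ, hcut, hnum⟩
    have hbase := hs.toBase.swap
      (fun v hv => he v (globalVars_search v hv).1 (globalVars_search v hv).2.1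
        (globalVars_search v hv).2.2) hm hX hY ho
    rw [hs.length_eq] at ht
    refine ⟨ht, J, ⟨hbase, ?_, ?_, ?_, ?_, ?_, ?_, ?_⟩, hnum⟩
    · rw [← hcut.length_eq, hs.length_eq]
    · intro p' hp'
      obtain ⟨p, hp, hc1, hc2, hc3, -⟩ := exists_of_forall₂_mem hcut hp'
      obtain ⟨h1, h2, h3⟩ := hs.good p hp
      exact ⟨hc2, by omega, by omega⟩
    · rw [flatMap_slice_cut _ (x j) hκ hcut, H.lo_eq, H.hi_eq]
      exact hs.perm.filter _
    · rw [he _ (by decide) (by decide) (by decide), hs.len_eq, hcut.length_eq]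
    · rw [he _ (by decide) (by decide) (by decide), hs.mj_eq]
    · rw [he _ (by decide) (by decide) (by decide), hs.kb_eq]
    · rw [hX]; exact hJ

theorem Wp.expand_stage (H : Setting e μ P x code τ lo hi L A) {j : ℕ} (hj : j + 1 ≤ e)
    {I : List (ℕ × ℕ)} {T : List (Fin P.n)} {s : St} (hs : StageState P x j I T s) :
    μ.Wp Domination.expand s fun s' t => t ≤ (2 * P.h) ^ j * (200 * P.h + 100) + 100 ∧
      ∃ J, StageState P x (j + 1) J T s' ∧ ∀ p ∈ J, SortedBlock x P.h (j + 1) p := by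
  obtain ⟨hM, hL⟩ := H.layer_le hj
  obtain ⟨hxy, hXs, hYs, -, -⟩ := hs.facts
  have hsz := H.size_eq
  have hw := H.size_lt
  have hkw := H.keySize_lt
  have hlay : P.n * P.h ^ j * P.h = P.n * P.h ^ (j + 1) := by rw [pow_succ, mul_assoc]
  have hpow : (2 * P.h) ^ (j + 1) = (2 * P.h) ^ j * (2 * P.h) := pow_succ _ _
  have hB : 2 * L ≤ P.B := by
    obtain ⟨hA, -, -⟩ := H.three_le
    rw [H.B_eq]
    calc 2 * L ≤ 1 * (2 * L + 1) := by omega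
      _ ≤ _ := Nat.mul_le_mul_right _ (by omega)
  have hjM : j * P.M ≤ μ.keySize := by
    rw [H.keySize_eq]
    exact Nat.mul_le_mul_right _ (by omega)
  have hMlt := H.M_lt
  have eM : s.env vM = P.M := hs.env vM (by simp [globalVars])
  refine (Wp.expand s I P.B P.h (P.n * P.h ^ j) (hs.env vH (by simp [globalVars])) hs.mj_eq hxy
    hs.len_eq hs.holds ?_ H.h_pos (by omega) (by omega) (by omega)
    (fun p hp => ⟨(hs.good p hp).1, (hs.good p hp).2.2⟩) (by omega)
    (by have := H.pow_h_lt; omega) H.h_lt (by rw [hs.kb_eq, eM]; omega)).mono ?_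
  · rw [hs.length_eq]
    have : (2 * P.h) ^ j * (4 * P.h) = 2 * ((2 * P.h) ^ j * (2 * P.h)) := by ring
    omega
  · rintro s' t ⟨ht, he, hm, hX, hY, ho, hlen, hmj, hkb, hJ⟩
    have hbase := hs.toBase.swap
      (fun v hv => he v (globalVars_expand v hv).1 (globalVars_expand v hv).2) hm hX hY ho
    have hgood : ∀ p ∈ I.flatMap (blocks P.h (P.n * P.h ^ j)), GoodBlock x P.h (j + 1) p := by
      intro q hq
      obtain ⟨p, hp, hq⟩ := List.mem_flatMap.1 hq
      exact (blocks_good x P.h (hs.good p hp)).1 q hq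
    rw [hs.length_eq] at ht
    have hlen' : (I.flatMap (blocks P.h (P.n * P.h ^ j))).length = I.length * (2 * P.h) := by
      rw [List.length_flatMap]
      simp
    refine ⟨ht, _, ⟨hbase, ?_, ?_, ?_, ?_, ?_, ?_, ?_⟩, fun p hp => (hgood p hp).2.2.2⟩
    · rw [hlen', hs.length_eq, hpow]
    · exact fun p hp => ⟨(hgood p hp).1, (hgood p hp).2.1, (hgood p hp).2.2.1⟩
    · exact (flatMap_blocks_perm x P.h hs.good).trans hs.perm
    · rw [hlen, hlen']
    · rw [hmj, hlay]
    · rw [hkb, hs.kb_eq, eM, Nat.succ_mul]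
    · rw [hX]; exact hJ

open Classical in
/-- The points whose coordinates `0, …, j` lie between the bounds. -/
noncomputable def _root_.Domination.pointsUpTo {n : ℕ} (x : ℕ → Fin n → ℝ) (lo hi : ℕ → ℝ) (j : ℕ) :
    List (Fin n) :=
  (List.finRange n).filter fun v => ∀ i ≤ j, lo i ≤ x i v ∧ x i v ≤ hi i

open Classical in
theorem _root_.Domination.filter_pointsUpTo {n : ℕ} (x : ℕ → Fin n → ℝ) (lo hi : ℕ → ℝ) (j : ℕ) :
    (pointsUpTo x lo hi j).filter (fun v => lo (j + 1) ≤ x (j + 1) v ∧ x (j + 1) v ≤ hi (j + 1)) =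
      pointsUpTo x lo hi (j + 1) := by
  rw [pointsUpTo, pointsUpTo, List.filter_filter]
  refine List.filter_congr fun v _ => ?_
  rw [← Bool.decide_and, decide_eq_decide]
  constructor
  · rintro ⟨h1, h2⟩ i hi
    rcases Nat.le_succ_iff.1 hi with h | rfl
    · exact h2 i h
    · exact h1
  · exact fun h => ⟨h _ le_rfl, fun i hi => h i (by omega)⟩

theorem _root_.Domination.slice_layer_zero_perm {n : ℕ} (x : ℕ → Fin n → ℝ) (h : ℕ) :
    ([(0, n)].flatMap fun p => slice (layer x h 0) p.1 p.2) = layer x h 0 := by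
  have : (layer x h 0).length = n := by simpa using length_layer x h 0
  simp [slice, this]

/-- Each further coordinate multiplies the number of intervals by 2h, and a binary search in one
interval takes O(h) steps. No stage costs more than the order of the last one, so j + 1 times that
is enough. -/
theorem Wp.stages (H : Setting e μ P x code τ lo hi L A) {s : St} (hb : Base P s)
    (hlen : s.env vLen = 1) (hmj : s.env vMj = P.n) (hkb : s.env vKb = 0)
    (hX : Holds s.mem (s.env vX) (flat [(0, P.n)])) {j : ℕ} (hj : j < e + 1) :
    μ.Wp (Domination.stages j hj) s fun s' t => t ≤ (j + 1) * ((2 * P.h) ^ j * (600 * P.h)) ∧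
      ∃ J, StageState P x j J (pointsUpTo x lo hi j) s' ∧ s'.env vNum = total J := by
  classical
  have h1 := H.h_pos
  induction j with
  | zero =>
    have hs : StageState P x 0 [(0, P.n)] (List.finRange P.n) s := by
      refine ⟨hb, by simp, ?_, ?_, by simpa using hlen, by simpa using hmj, by simpa using hkb, hX⟩
      · intro p hp
        obtain rfl := List.mem_singleton.1 hp
        exact ⟨Nat.zero_le _, by simpa using H.n_lt, by simp⟩
      · rw [slice_layer_zero_perm]
        exact sortBy_perm _ _
    refine (Wp.search_stage H hj hs ?_).mono ?_
    · intro p hp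
      obtain rfl := List.mem_singleton.1 hp
      have := slice_layer_zero_perm x P.h
      rw [SortedBlock]
      simp only [List.flatMap_cons, List.flatMap_nil, List.append_nil] at this
      rw [this]
      exact sortBy_pairwise _ _
    · rintro s' t ⟨ht, J, hJ, hnum⟩
      refine ⟨by simp only [pow_zero] at ht ⊢; omega, J, ?_, hnum⟩
      have : pointsUpTo x lo hi 0 =
          (List.finRange P.n).filter fun v => lo 0 ≤ x 0 v ∧ x 0 v ≤ hi 0 := by
        simp [pointsUpTo]
      rwa [this]
  | succ j ih =>
    refine Wp.seq ((ih (by omega)).mono ?_)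
    rintro s1 t1 ⟨ht1, J1, hJ1, -⟩
    refine Wp.seq ((Wp.expand_stage H (by omega) hJ1).mono ?_)
    rintro s2 t2 ⟨ht2, J2, hJ2, hsort⟩
    refine (Wp.search_stage H hj hJ2 hsort).mono ?_
    rintro s3 t3 ⟨ht3, J3, hJ3, hnum⟩
    rw [filter_pointsUpTo] at hJ3
    refine ⟨?_, J3, hJ3, hnum⟩
    have hpos : 1 ≤ (2 * P.h) ^ j := Nat.one_le_pow _ _ (by omega)
    have hpow : (2 * P.h) ^ (j + 1) = (2 * P.h) ^ j * (2 * P.h) := pow_succ _ _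
    rw [hpow] at ht3 ⊢
    generalize (2 * P.h) ^ j = K at *
    generalize P.h = h at *
    have e1 : K * 1 ≤ K * h := Nat.mul_le_mul_left _ h1
    have e2 : K * h * 1 ≤ K * h * h := Nat.mul_le_mul_left _ h1
    have e3 : K * (200 * h + 100) = 200 * (K * h) + 100 * K := by ring
    have e4 : K * (2 * h) * (100 * h + 200) = 200 * (K * h * h) + 400 * (K * h) := by ring
    have e5 : K * (2 * h) * (600 * h) = 1200 * (K * h * h) := by ring
    have e6 : K * (600 * h) = 600 * (K * h) := by ring
    have e7 := Nat.mul_le_mul_left (j + 1) (show K * (600 * h) ≤ K * (2 * h) * (600 * h) by omega)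
    rw [Nat.add_mul (j + 1) 1, one_mul]
    omega

end
end Machine

/-! ### Correctness and running time of the search for heavy colours -/

theorem heavyChildren_congr {thr thr' : ℕ → ℕ} {acc : ℕ} {f : Bool → ℕ → ℕ} {pw : ℕ}
    {x : ℕ × List (ℕ × ℕ)}
    (h : ∀ β, thr (total (childNode f pw x β).2) = thr' (total (childNode f pw x β).2)) :
    heavyChildren thr acc f pw x = heavyChildren thr' acc f pw x := by
  refine List.filter_congr fun y hy => ?_
  obtain ⟨β, -, rfl⟩ := List.mem_map.1 hy
  rw [h]

/-- The state on level `l` of the search for heavy colours. -/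
structure LevelState (P : Layout) (S : List ℕ) (J : List (ℕ × ℕ)) (l : ℕ) (s : St) : Prop
    extends Base P s where
  lev_eq : s.env vLev = l
  pw_eq : s.env vPw = 2 ^ l
  nl_eq : s.env vNl = J.length
  acc_eq : s.env vAcc = total J
  len_eq : s.env vLen = (heavyNodes S P.thr (total J) J l).length
  holds : Holds s.mem (s.env vX) ((heavyNodes S P.thr (total J) J l).flatMap nodeWords)

/-- What is known about the intervals that the search in the range tree finds. -/
structure GoodIntervals (P : Layout) (S : List ℕ) (J : List (ℕ × ℕ)) (L : ℕ) : Prop where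
  length_eq : J.length = L
  le : ∀ p ∈ J, p.1 ≤ p.2 ∧ p.2 ≤ S.length
  total_le : total J ≤ P.n

/-- Keeps the index into the threshold table, which has `n + 1` entries, within range. -/
theorem GoodIntervals.child_total_le {P : Layout} {S : List ℕ} {J : List (ℕ × ℕ)} {L l : ℕ}
    (h : GoodIntervals P S J L) {x : ℕ × List (ℕ × ℕ)} (hx : GoodNode S J l x) (β : Bool) :
    total (childNode (posMap S l) (2 ^ l) x β).2 ≤ P.n := by
  rw [(hx.child β).total_eq]
  refine List.countP_le_length.trans ?_
  rw [length_elements fun p hp => (h.le p hp).2]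
  exact h.total_le

namespace Machine
variable {e : ℕ} {μ : Machine (Fin (e + 1) ⊕ Fin (e + 1))} {P : Layout} {x : ℕ → Fin P.n → ℝ}
  {code : Fin P.n → ℕ} {τ : ℝ} {lo hi : ℕ → ℝ} {L A : ℕ}

theorem _root_.Domination.Setting.length_codes (H : Setting e μ P x code τ lo hi L A) :
    ((layer x P.h e).map code).length = P.M := by
  rw [List.length_map, length_layer, H.M_eq]

theorem Wp.level_step (H : Setting e μ P x code τ lo hi L A) {J : List (ℕ × ℕ)}
    (hJ : GoodIntervals P ((layer x P.h e).map code) J L) {l : ℕ} (hl : l < P.h) {s : St}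
    (hs : LevelState P ((layer x P.h e).map code) J l s) :
    μ.Wp Domination.level s fun s' t => t ≤ A * (L * 500 + 200) + 100 ∧
      LevelState P ((layer x P.h e).map code) J (l + 1) s' := by
  set S := (layer x P.h e).map code with hS
  have hSM : S.length = P.M := H.length_codes
  obtain ⟨hxy, hXs, hYs, hWX, hWY⟩ := hs.facts
  have hgood := heavyNodes_good (thr := P.thr) (acc := total J) hJ.le l
  have hlenA : ∀ l, (heavyNodes S P.thr (total J) J l).length ≤ A := by
    intro l
    rw [H.A_eq, H.thr_eq]
    exact length_heavyNodes_le H.one_le H.n_pos hJ.le hJ.total_le l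
  have hw := H.size_lt
  have hpow : 2 ^ l * 2 ≤ 2 ^ P.h := by
    rw [← pow_succ]
    exact Nat.pow_le_pow_right two_pos hl
  have hpow2 := H.pow_h_lt
  have eWB : s.env vWB = P.start := hs.env _ (by simp [globalVars])
  have eThr : s.env vThr = 14 := hs.env _ (by simp [globalVars])
  have hstart : 14 + (P.n + 1) ≤ P.start := by simp only [Layout.start]; omega
  have hchild : ∀ y ∈ heavyNodes S P.thr (total J) J l, ∀ β,
      total (childNode (posMap S l) (s.env vPw) y β).2 ≤ P.n := by
    intro y hy β
    rw [hs.pw_eq]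
    exact hJ.child_total_le (hgood y hy) β
  -- The program reads thresholds from memory, which agrees with `P.thr` only up to index `n`; the
  -- totals of the children stay in that range.
  have hstep : heavyNodes S P.thr (total J) J (l + 1) =
      (heavyNodes S P.thr (total J) J l).flatMap (heavyChildren
        (fun c => s.mem (s.env vThr + c)) (s.env vAcc) (posMap S l) (s.env vPw)) := by
    rw [heavyNodes, hs.acc_eq, hs.pw_eq]
    refine List.flatMap_congr fun y hy => heavyChildren_congr fun β => ?_
    have h1 := hchild y hy β
    rw [hs.pw_eq] at h1
    rw [eThr, hs.mem _ (by omega)]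
    exact (P.mem_thr h1).symm
  have hMlt := H.M_lt
  have hLM := H.LM_lt
  have h2h := H.h_lt
  refine (Wp.level s (f := posMap S l) (M := P.M) (L := L) (A := A) (B := P.B) _
    (H.rankData.rankTables hl hs.lev_eq hs.env hs.mem (by have := H.n_lt; omega))
    (fun β p q hpq => posMap_mono S l β hpq)
    (fun y hy => ⟨(hgood y hy).length_eq.trans hJ.length_eq,
      fun p hp => ⟨((hgood y hy).le p hp).1, by rw [← hSM]; exact ((hgood y hy).le p hp).2⟩⟩)
    (hs.nl_eq.trans hJ.length_eq) hxy hs.len_eq hs.holds H.B_eq.ge (hlenA l) (eWB.trans_le hWX)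
    (eWB.trans_le hWY) (by rw [H.size_eq]; exact hXs) (by rw [H.size_eq]; exact hYs)
    (by rw [H.size_eq]; omega) (by omega) hLM ?_ (by rw [hs.pw_eq]; omega)
    (by rw [hs.lev_eq]; omega) ?_ _ hstep (hlenA (l + 1))).mono ?_
  · intro y hy
    have := (hgood y hy).path_lt
    rw [hs.pw_eq]
    omega
  · intro y hy β
    have := hchild y hy β
    rw [eThr, eWB]
    omega
  · rintro s' t ⟨ht, he, hm, hX, hY, ho, hlen, hlev, hpw, hH⟩
    have hbase := hs.toBase.swap
      (fun v hv => he v (globalVars_level v hv).1 (globalVars_level v hv).2) hm hX hY ho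
    refine ⟨?_, hbase, ?_, ?_, ?_, ?_, hlen, ?_⟩
    · have := Nat.mul_le_mul_right (L * 500 + 200) (hlenA l)
      omega
    · rw [hlev, hs.lev_eq]
    · rw [hpw, hs.pw_eq, pow_succ]
    · rw [he _ (by decide) (by decide), hs.nl_eq]
    · rw [he _ (by decide) (by decide), hs.acc_eq]
    · rw [hX]; exact hH

theorem Wp.makeRoot (H : Setting e μ P x code τ lo hi L A) {J : List (ℕ × ℕ)}
    {T : List (Fin P.n)} {s : St} (hs : StageState P x e J T s) (hnum : s.env vNum = total J)
    (S : List ℕ) : μ.Wp Domination.makeRoot s fun s' t => t ≤ 50 ∧ LevelState P S J 0 s' := by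
  obtain ⟨hA, hL, hB3⟩ := H.three_le
  obtain ⟨hxy, hXs, hYs, hWX, hWY⟩ := hs.facts
  have hw := H.size_lt
  have one_lt := μ.one_lt_two_pow
  have hlen : J.length = L := by rw [hs.length_eq, H.L_eq]
  have hB : 2 * L + 1 ≤ P.B := by
    rw [H.B_eq]
    calc 2 * L + 1 ≤ 1 * (2 * L + 1) := by omega
      _ ≤ _ := Nat.mul_le_mul_right _ (by omega)
  have hsz := H.size_eq
  have h2 : 2 < 2 ^ μ.w := by omega
  apply Vc.wp
  simp only [Domination.makeRoot, Vc, Expr.ok_add, Expr.ok_mul, Expr.ok_var, Expr.ok_const,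
    Expr.eval_add, Expr.eval_mul, Expr.eval_var, Expr.eval_const, St.env_set, true_and,
    reduceCtorEq, if_false, Expr.cost_add, Expr.cost_mul, Expr.cost_var, Expr.cost_const,
    hs.len_eq, hnum, hlen, hsz]
  refine ⟨⟨⟨h2, by omega⟩, by omega⟩, by omega, by omega, one_lt, by omega, one_lt, by omega,
    ⟨?_, ?_, ?_, ?_⟩, ?_, ?_, ?_, ?_, ?_, ?_⟩
  · intro v hv
    rw [← hs.env v hv]
    simp only [globalVars, List.mem_cons, List.not_mem_nil, or_false] at hv
    rcases hv with rfl | rfl | rfl | rfl | rfl | rfl | rfl | rfl | rfl | rfl | rfl | rfl | rfl |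
      rfl <;> simp
  · intro a ha
    simp only [St.mem_put, St.mem_set]
    rw [if_neg (by omega), hs.mem a ha]
  · simpa using hs.buffers
  · simpa using hs.out
  · simp
  · simp
  · simp [hlen]
  · simp
  · simp [heavyNodes]
  · simp only [heavyNodes, List.flatMap_cons, List.flatMap_nil, List.append_nil, nodeWords,
      holds_append, holds_cons, length_flat, hlen]
    refine ⟨?_, ?_, holds_nil _ _⟩
    · simp only [St.mem_set, St.env_set, St.env_put, reduceCtorEq, if_false]
      refine hs.holds.congr fun y h1 h2 => ?_
      rw [length_flat, hlen] at h2
      simp only [St.mem_put, St.mem_set]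
      rw [if_neg (by omega)]
    · simp [St.mem_put, mul_comm]

theorem Wp.levels (H : Setting e μ P x code τ lo hi L A) {J : List (ℕ × ℕ)}
    (hJ : GoodIntervals P ((layer x P.h e).map code) J L) {s : St}
    (hs : LevelState P ((layer x P.h e).map code) J 0 s) :
    μ.Wp (.loop (.less vLev vH) Domination.level) s fun s' t =>
      t ≤ P.h * (A * (L * 500 + 200) + 100 + 6) + 6 ∧
        LevelState P ((layer x P.h e).map code) J P.h s' := by
  have eH : ∀ {l s}, LevelState P ((layer x P.h e).map code) J l s → s.env vH = P.h :=
    fun h => h.env _ (by simp [globalVars])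
  refine (Wp.loop (fun k s => ∃ l, k + l = P.h ∧ LevelState P ((layer x P.h e).map code) J l s)
    (A * (L * 500 + 200) + 100) (fun _ _ _ => by simp) ?_ (k := P.h) ⟨0, rfl, hs⟩).mono ?_
  · rintro k s ⟨l, hk, hl⟩ hne
    have hlt : l < P.h := by
      by_contra hlt
      simp [hl.lev_eq, eH hl, hlt] at hne
    refine ⟨by omega, (Wp.level_step H hJ hlt hl).mono ?_⟩
    rintro s' t ⟨ht, hl'⟩
    exact ⟨ht, l + 1, by omega, hl'⟩
  · rintro s' t ⟨ht, hz, k, l, hk, hl⟩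
    have hge : ¬ l < P.h := by
      intro hlt
      simp [hl.lev_eq, eH hl, hlt] at hz
    obtain rfl : l = P.h := by omega
    exact ⟨by simpa using ht, hl⟩

theorem Wp.report (H : Setting e μ P x code τ lo hi L A) {S : List ℕ} {J : List (ℕ × ℕ)}
    (hJ : GoodIntervals P S J L) {s : St} (hs : LevelState P S J P.h s)
    (hA : (heavyNodes S P.thr (total J) J P.h).length ≤ A)
    (hpath : ∀ y ∈ heavyNodes S P.thr (total J) J P.h, y.1 < P.n) :
    μ.Wp Domination.report s fun s' t => t ≤ A * 50 + 3 ∧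
      (∀ v ∈ globalVars, s'.env v = P.env v) ∧ (∀ a < P.start, s'.mem a = P.mem a) ∧
      s'.out = ((heavyNodes S P.thr (total J) J P.h).map Prod.fst).map P.col := by
  set H' := heavyNodes S P.thr (total J) J P.h with hH'
  have hgood : ∀ y ∈ H', y.2.length = L := fun y hy =>
    (heavyNodes_good hJ.le P.h y hy).length_eq.trans hJ.length_eq
  have one_lt := μ.one_lt_two_pow
  have hw := H.size_lt
  obtain ⟨hxy, hXs, hYs, hWX, hWY⟩ := hs.facts
  have hBA : A * (2 * L + 1) + (2 * L + 1) = P.B := by rw [H.B_eq]; ring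
  have hsz := H.size_eq
  have e1 := P.env_eq
  have hlenA : H'.length * (2 * L + 1) ≤ A * (2 * L + 1) := Nat.mul_le_mul_right _ hA
  have hsize : P.start ≤ P.size := by simp only [Layout.size]; omega
  refine (Wp.loop (fun k s' => ∃ done todo, H' = done ++ todo ∧ todo.length = k ∧ s'.env vLen = k ∧
    (∀ v ∈ globalVars, s'.env v = P.env v) ∧ s'.mem = s.mem ∧ s'.env vNl = L ∧
    s'.env vX = s.env vX + done.length * (2 * L + 1) ∧ s'.out = (done.map Prod.fst).map P.col)
    40 (fun _ _ _ => by simp) ?_ (k := H'.length) ⟨[], H', rfl, rfl, hs.len_eq, hs.env, rfl,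
      hs.nl_eq.trans hJ.length_eq, by simp, by simpa using hs.out⟩).mono ?_
  · rintro k s' ⟨done, todo, he, hk, hlen, henv, hmem, hnl, hX, hout⟩ hne
    rw [Expr.eval_var, hlen] at hne
    obtain ⟨y, todo, rfl⟩ : ∃ y l, todo = y :: l := by
      cases todo with
      | nil => exact absurd hk.symm hne
      | cons y l => exact ⟨y, l, rfl⟩
    obtain ⟨k, rfl⟩ := Nat.exists_eq_succ_of_ne_zero hne
    have hyL := hgood y (by rw [he]; simp)
    have hyn := hpath y (by rw [he]; simp)
    have hH := hs.holds
    rw [← hH', he, List.flatMap_append, holds_append, List.flatMap_cons, holds_append,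
      length_flatMap_nodeWords fun z hz => hgood z (by rw [he]; simp [hz]), nodeWords,
      holds_append, holds_cons, length_flat, hyL, ← hX] at hH
    have hpathmem : s'.mem (s'.env vX + L * 2) = y.1 := by
      rw [hmem, mul_comm]; exact hH.2.1.2.1
    have hcol : s'.mem (P.env vCol + y.1) = P.col y.1 := by
      rw [hmem, hs.mem _ (by omega), P.mem_col hyn]
    have hdone : done.length * (2 * L + 1) + (2 * L + 1) ≤ H'.length * (2 * L + 1) := by
      rw [← Nat.succ_mul]
      exact Nat.mul_le_mul_right _ (by rw [he]; simp)
    have eCol := henv vCol (by simp [globalVars])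
    have h2 : 2 < 2 ^ μ.w := by omega
    refine ⟨by omega, ?_⟩
    apply Vc.wp
    simp only [Vc, Expr.ok_add, Expr.ok_mul, Expr.ok_sub, Expr.ok_load, Expr.ok_var, Expr.ok_const,
      Expr.eval_add, Expr.eval_mul, Expr.eval_sub, Expr.eval_load, Expr.eval_var, Expr.eval_const,
      St.env_set, true_and, reduceCtorEq, if_false, if_true, Expr.cost_add, Expr.cost_mul,
      Expr.cost_sub, Expr.cost_load, Expr.cost_var, Expr.cost_const, hnl, hpathmem, eCol, hcol,
      hlen, hsz]
    refine ⟨⟨⟨⟨⟨⟨h2, by omega⟩, by omega⟩, by omega⟩, by omega⟩, by omega⟩, ⟨⟨⟨h2, by omega⟩,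
      one_lt, by omega⟩, by omega⟩, ⟨one_lt, by omega⟩, by omega, done ++ [y], todo, by simp [he],
      ?_⟩
    refine ⟨by simpa using hk, ?_, hmem, ?_, ?_⟩
    · intro v hv
      rw [← henv v hv]
      have h1 : v ≠ vLen := by rintro rfl; revert hv; decide
      have h2 : v ≠ vX := by rintro rfl; revert hv; decide
      simp [h1, h2]
    · simp [hX]; ring
    · simp [hout]
  · rintro s' t ⟨ht, hz, k, done, todo, he, hk, hlen, henv, hmem, -, -, hout⟩
    rw [Expr.eval_var, hlen] at hz
    subst hz
    obtain rfl : todo = [] := List.length_eq_zero_iff.1 hk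
    rw [List.append_nil] at he
    refine ⟨?_, henv, fun a ha => by rw [hmem, hs.mem a ha], by rw [he, hout]⟩
    simp only [Expr.cost_var] at ht
    omega

/-- The working space is zero in the stored structure, so overwriting it with zeros restores the
image for the next query. The cost O(B) is O(A L), within the time bound. -/
theorem Wp.cleanUp (H : Setting e μ P x code τ lo hi L A) {s : St}
    (henv : ∀ v ∈ globalVars, s.env v = P.env v) (hmem : ∀ a < P.start, s.mem a = P.mem a) :
    μ.Wp Domination.cleanUp s fun s' t => t ≤ P.B * 50 + 20 ∧
      (∀ a < P.size, s'.mem a = P.mem a) ∧ s'.out = s.out := by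
  have one_lt := μ.one_lt_two_pow
  have hw := H.size_lt
  have hsz := H.size_eq
  have hsize : P.size = P.start + P.B + P.B := rfl
  have eEnd : s.env vEnd = P.size := henv _ (by simp [globalVars])
  have eWB : s.env vWB = P.start := henv _ (by simp [globalVars])
  rw [Domination.cleanUp]
  apply Wp.seq; apply Wp.assign (Expr.ok_var _ _ _)
  refine (Wp.loop (fun k s' => s'.env vSrc + k = P.size ∧ s'.env vEnd = P.size ∧
    P.start ≤ s'.env vSrc ∧ (∀ a < s'.env vSrc, s'.mem a = P.mem a) ∧ s'.out = s.out) 12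
    (fun _ _ _ => by simp) ?_ (k := P.B + P.B) ⟨?_, ?_, ?_, ?_, ?_⟩).mono ?_
  · rintro k s' ⟨h1, h2, h3, h4, h5⟩ hne
    have hlt : s'.env vSrc < P.size := by
      by_contra hlt
      simp [h2, hlt] at hne
    refine ⟨by omega, ?_⟩
    apply Vc.wp
    simp only [Vc, Expr.ok_add, Expr.ok_var, Expr.ok_const, Expr.eval_add, Expr.eval_var,
      Expr.eval_const, St.env_set, St.env_put, true_and, reduceCtorEq, if_false, if_true,
      Expr.cost_add, Expr.cost_var, Expr.cost_const, hsz, h2]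
    refine ⟨by omega, by omega, ⟨one_lt, by omega⟩, by omega, by omega, by omega, ?_, h5⟩
    intro a ha
    simp only [St.mem_put, St.mem_set]
    split_ifs with hae
    · rw [P.mem_work (by omega)]
    · exact h4 a (by omega)
  · simp [eWB]; omega
  · simp [eEnd]
  · simp [eWB]
  · simpa [eWB] using hmem
  · rfl
  · rintro s' t ⟨ht, hz, k, h1, h2, h3, h4, h5⟩
    have hge : ¬ s'.env vSrc < P.size := by
      intro hlt
      simp [h2, hlt] at hz
    simp only [Expr.cost_less, Expr.cost_var] at ht ⊢
    exact ⟨by omega, fun a ha => h4 a (by omega), h5⟩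

theorem Wp.query (H : Setting e μ P x code τ lo hi L A) (s : St) (henv : ∀ v, s.env v = 0)
    (hmem : s.mem = P.mem) (hout : s.out = []) :
    μ.Wp (Domination.query e) s fun s' t =>
      t ≤ 1000 * ((e + 1) * (L * P.h)) + 1000 * (P.h * (A * L)) + 1000 * (A * L) + 1000 * P.h ∧
      (∀ a < P.size, s'.mem a = P.mem a) ∧ ∃ J,
        GoodIntervals P ((layer x P.h e).map code) J L ∧
        (elements ((layer x P.h e).map code) J).Perm ((pointsUpTo x lo hi e).map code) ∧
        s'.out = ((heavyNodes ((layer x P.h e).map code) P.thr (total J) J P.h).map Prod.fst).map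
          P.col := by
  set S := (layer x P.h e).map code with hS
  obtain ⟨hA, hL, hB3⟩ := H.three_le
  refine Wp.seq ((Wp.setUp H s henv hmem hout).mono ?_)
  rintro s1 t1 ⟨ht1, hb, hlen, hmj, hkb, hX⟩
  refine Wp.seq ((Wp.stages H hb hlen hmj hkb hX _).mono ?_)
  rintro s2 t2 ⟨ht2, J, hJ, hnum⟩
  have hperm : (elements S J).Perm ((pointsUpTo x lo hi e).map code) := by
    have h1 : elements S J = (J.flatMap fun p => slice (layer x P.h e) p.1 p.2).map code := by
      rw [elements, List.map_flatMap]
      exact List.flatMap_congr fun p _ => (map_slice _ _ _ _).symm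
    rw [h1]
    exact hJ.perm.map _
  have hle : ∀ p ∈ J, p.1 ≤ p.2 ∧ p.2 ≤ S.length := by
    intro p hp
    obtain ⟨h1, -, h3⟩ := hJ.good p hp
    exact ⟨h1, by rw [hS, List.length_map, length_layer]; exact h3⟩
  have htot : total J ≤ P.n := by
    rw [← length_elements fun p hp => (hle p hp).2, hperm.length_eq, List.length_map, pointsUpTo]
    exact (List.length_filter_le _ _).trans (by simp)
  have hGI : GoodIntervals P S J L := ⟨by rw [hJ.length_eq, H.L_eq], hle, htot⟩
  refine Wp.seq ((Wp.makeRoot H hJ hnum S).mono ?_)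
  rintro s3 t3 ⟨ht3, h3⟩
  refine Wp.seq ((Wp.levels H hGI h3).mono ?_)
  rintro s4 t4 ⟨ht4, h4⟩
  have hlenA : (heavyNodes S P.thr (total J) J P.h).length ≤ A := by
    rw [H.A_eq, H.thr_eq]
    exact length_heavyNodes_le H.one_le H.n_pos hle htot _
  -- A heavy class on level h is nonempty, so its path is a code modulo 2^h. Codes are less than n <
  -- 2^h, so the path is itself a code and a valid index into the colour table.
  have hpath : ∀ y ∈ heavyNodes S P.thr (total J) J P.h, y.1 < P.n := by
    obtain ⟨l, hl⟩ := Nat.exists_eq_succ_of_ne_zero (by have := H.h_pos; omega : P.h ≠ 0)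
    intro y hy
    have hτ : 0 ≤ τ := by have := H.one_le; linarith
    rw [hl, H.thr_eq] at hy
    obtain ⟨-, h2⟩ := (mem_heavyNodes_succ (threshold_mono hτ P.n) hle l y.1).1
      (List.mem_map_of_mem hy)
    have h3 := ((lt_threshold hτ htot).1 h2).1
    obtain ⟨v, hv, hve⟩ := List.countP_pos_iff.1 h3
    obtain ⟨u, -, rfl⟩ := List.mem_map.1 (hperm.mem_iff.1 hv)
    have := H.n_lt
    have hc := H.code_lt u
    simp only [beq_iff_eq] at hve
    rw [hl] at this
    rw [Nat.mod_eq_of_lt (by omega)] at hve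
    omega
  refine Wp.seq ((Wp.report H hGI h4 hlenA hpath).mono ?_)
  rintro s5 t5 ⟨ht5, henv5, hmem5, hout5⟩
  refine (Wp.cleanUp H henv5 hmem5).mono ?_
  rintro s6 t6 ⟨ht6, hmem6, hout6⟩
  refine ⟨?_, hmem6, J, hGI, hperm, hout6.trans hout5⟩
  have hLe := H.L_eq
  have hBe := H.B_eq
  have hh := H.h_pos
  rw [← hLe] at ht2
  generalize P.h = h at *
  generalize P.B = B at *
  -- The total is brought to the monomials (e + 1) L h, h A L, A L and h; lower terms are absorbed
  -- by means of 1 ≤ A, 1 ≤ L and 1 ≤ h.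
  have e1 : (e + 1) * (L * (600 * h)) = 600 * ((e + 1) * (L * h)) := by ring
  have e2 : h * (A * (L * 500 + 200) + 100 + 6) = 500 * (h * (A * L)) + 200 * (h * A) +
    106 * h := by
    ring
  have e3 : h * A * 1 ≤ h * A * L := Nat.mul_le_mul_left _ hL
  have e4 : h * A * L = h * (A * L) := by ring
  have e5 : A * 1 ≤ A * L := Nat.mul_le_mul_left _ hL
  have e6 : (A + 1) * (2 * L + 1) = 2 * (A * L) + A + 2 * L + 1 := by ring
  have e7 : 1 * L ≤ A * L := Nat.mul_le_mul_right _ hA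
  omega

end Machine

/-- A function on `Fin d`, continued by zero. -/
noncomputable def extend {d : ℕ} (f : Fin d → ℝ) (j : ℕ) : ℝ :=
  if h : j < d then f ⟨j, h⟩ else 0

theorem extend_coe {d : ℕ} (f : Fin d → ℝ) (j : Fin d) : extend f j = f j := dif_pos j.2

/-! ## Colour codes -/

section Code
variable {n : ℕ} (col : Fin n → ℕ)

/-- The code of the colour of a point: the least index of a point of that colour. -/
def code (i : Fin n) : ℕ := (List.ofFn col).idxOf (col i)

/-- The colour with a given code. -/
def decode (c : ℕ) : ℕ := (List.ofFn col).getD c 0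

theorem code_lt (i : Fin n) : code col i < n := by
  have : col i ∈ List.ofFn col := List.mem_ofFn.2 ⟨i, rfl⟩
  simpa [code] using List.idxOf_lt_length_iff.2 this

theorem decode_code (i : Fin n) : decode col (code col i) = col i := by
  have : col i ∈ List.ofFn col := List.mem_ofFn.2 ⟨i, rfl⟩
  rw [decode, code, List.getD_eq_getElem _ _ (List.idxOf_lt_length_iff.2 this),
    List.getElem_idxOf]

theorem code_eq_iff (i j : Fin n) : code col i = code col j ↔ col i = col j := by
  constructor
  · intro h
    rw [← decode_code col i, h, decode_code]
  · intro h
    rw [code, h, code]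

theorem decode_lt {W : ℕ} (h : ∀ i, col i < W) {c : ℕ} (hc : c < n) : decode col c < W := by
  rw [decode, List.getD_eq_getElem _ _ (by simpa using hc), List.getElem_ofFn]
  exact h _

end Code

/-! ## The reported colours -/

open Classical in
theorem ncard_eq_countP {n : ℕ} (p : Fin n → Prop) :
    {i | p i}.ncard = (List.finRange n).countP p := by
  rw [Set.ncard_eq_toFinset_card', List.countP_eq_length_filter,
    ← List.toFinset_card_of_nodup ((List.nodup_finRange n).filter _)]
  congr 1
  ext i
  simp

section Report
variable {e n : ℕ} (pt : Fin n → Fin (e + 1) → ℝ) (col : Fin n → ℕ) (lo hi : Fin (e + 1) → ℝ)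

/-- The points in a rectangle. -/
noncomputable def pointsIn : List (Fin n) :=
  pointsUpTo (fun j i => extend (pt i) j) (extend lo) (extend hi) e

open Classical in
theorem pointsIn_eq : pointsIn pt lo hi = (List.finRange n).filter fun i => pt i ∈ rect lo hi := by
  rw [pointsIn, pointsUpTo]
  refine List.filter_congr fun i _ => ?_
  rw [decide_eq_decide]
  constructor
  · intro h j
    have := h j (Nat.le_of_lt_succ j.2)
    simpa only [extend_coe] using this
  · intro h j hj
    have := h ⟨j, Nat.lt_succ_of_le hj⟩
    simpa [extend, Nat.lt_succ_of_le hj] using this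

theorem count_rect : count pt (rect lo hi) = (pointsIn pt lo hi).length := by
  classical
  rw [count, ncard_eq_countP, pointsIn_eq, List.countP_eq_length_filter]

theorem colorCount_rect (c : ℕ) :
    colorCount pt col (rect lo hi) c = (pointsIn pt lo hi).countP fun i => col i == c := by
  classical
  rw [colorCount, ncard_eq_countP, pointsIn_eq, List.countP_filter]
  refine List.countP_congr fun i _ => ?_
  simp [and_comm]

/-- Codes are less than n < 2^h, so on level h a residue class is the class of a single colour and
its count is the colour count. Every heavy path is the code of some point, and decoding is injective
on codes; hence there are no repetitions. -/
theorem report_spec {τ : ℝ} (hτ : 1 ≤ τ) {h : ℕ} (hn : n < 2 ^ h) (hh : 1 ≤ h) {S : List ℕ}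
    {J : List (ℕ × ℕ)} (hJ : ∀ p ∈ J, p.1 ≤ p.2 ∧ p.2 ≤ S.length) (hJn : total J ≤ n)
    (hperm : (elements S J).Perm ((pointsIn pt lo hi).map (code col))) {out : List ℕ}
    (hout : out = ((heavyNodes S (threshold τ n) (total J) J h).map Prod.fst).map (decode col)) :
    out.Nodup ∧ ∀ c, c ∈ out ↔ Dominates τ pt col (rect lo hi) c := by
  have hτ0 : 0 < τ := by linarith
  obtain ⟨l, rfl⟩ := Nat.exists_eq_succ_of_ne_zero (by omega : h ≠ 0)
  have hcount : ∀ u, (elements S J).countP (fun v => v % 2 ^ (l + 1) == code col u) =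
      colorCount pt col (rect lo hi) (col u) := by
    intro u
    rw [hperm.countP_eq, List.countP_map, colorCount_rect]
    refine List.countP_congr fun v _ => ?_
    have := code_lt col v
    simp [Nat.mod_eq_of_lt (show code col v < 2 ^ (l + 1) by omega), code_eq_iff]
  have htotal : total J = count pt (rect lo hi) := by
    rw [← length_elements fun p hp => (hJ p hp).2, hperm.length_eq, List.length_map, count_rect]
  have hmem : ∀ u, code col u ∈ (heavyNodes S (threshold τ n) (total J) J (l + 1)).map Prod.fst ↔
      Dominates τ pt col (rect lo hi) (col u) := by
    intro u
    have := code_lt col u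
    rw [mem_heavyNodes_succ (threshold_mono hτ0.le n) hJ, lt_threshold hτ0.le hJn, hcount, htotal,
      Dominates, div_le_iff₀' hτ0]
    exact and_iff_right (by omega)
  have hcode : ∀ c ∈ (heavyNodes S (threshold τ n) (total J) J (l + 1)).map Prod.fst,
      ∃ u, code col u = c := by
    intro c hc
    obtain ⟨-, h2⟩ := (mem_heavyNodes_succ (threshold_mono hτ0.le n) hJ l c).1 hc
    obtain ⟨v, hv, hve⟩ := List.countP_pos_iff.1 ((lt_threshold hτ0.le hJn).1 h2).1
    obtain ⟨u, -, rfl⟩ := List.mem_map.1 (hperm.mem_iff.1 hv)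
    have := code_lt col u
    simp only [beq_iff_eq] at hve
    rw [Nat.mod_eq_of_lt (by omega)] at hve
    exact ⟨u, hve⟩
  subst hout
  refine ⟨(heavyNodes_nodup hJ _).map_on ?_, fun c => ?_⟩
  · intro c hc c' hc' hcc
    obtain ⟨u, rfl⟩ := hcode c hc
    obtain ⟨u', rfl⟩ := hcode c' hc'
    rw [decode_code, decode_code] at hcc
    exact (code_eq_iff col u u').2 hcc
  · rw [List.mem_map]
    constructor
    · rintro ⟨p, hp, rfl⟩
      obtain ⟨u, rfl⟩ := hcode p hp
      rw [decode_code]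
      exact (hmem u).1 hp
    · intro hc
      have h1 := hc.1
      rw [colorCount_rect] at h1
      obtain ⟨u, -, hu⟩ := List.countP_pos_iff.1 h1
      obtain rfl : col u = c := by simpa using hu
      exact ⟨_, (hmem u).2 hc, decode_code col u⟩

end Report

/-! ## The data structure -/

section Build
variable (e : ℕ) {n : ℕ} (τ : ℝ) (x : ℕ → Fin n → ℝ) (col : Fin n → ℕ)

/-- The number of levels. -/
def height (n : ℕ) : ℕ := Nat.log 2 n + 1

/-- The memory layout of the data structure. -/
noncomputable abbrev buildLayout : Layout where
  n := n
  h := height n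
  b := Nat.log 2 n
  M := n * height n ^ e
  NB := n * height n ^ e / Nat.log 2 n + 1
  B := (min ⌊τ⌋₊ n + 1) * (2 * (2 * height n) ^ e + 1)
  thr := threshold τ n
  col := decode col
  pop := popCount (Nat.log 2 n)
  bits := packedBits ((layer x (height n) e).map (code col)) (Nat.log 2 n)
  z0 l q := posMap ((layer x (height n) e).map (code col)) l false (q * Nat.log 2 n)
  z1 l q := posMap ((layer x (height n) e).map (code col)) l true (q * Nat.log 2 n)

/-- The coordinates in the order in which the data structure stores them. -/
noncomputable def buildKey (a : ℕ) : ℝ :=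
  ((layer x (height n) (a / (n * height n ^ e)))[a % (n * height n ^ e)]?).elim 0
    (x (a / (n * height n ^ e)))

/-- The data structure. -/
noncomputable def build : Image where
  words := (List.range (buildLayout e τ x col).size).map (buildLayout e τ x col).mem
  keys := (List.range ((e + 1) * (n * height n ^ e))).map (buildKey e x)

variable {e τ x col}

/-- The two logarithmic parameters differ by one on purpose: `height n` bits suffice for every code,
whereas `Nat.log 2 n` packed bits still index a table with n + 1 entries. The condition 2 ≤ n makes
the latter positive. -/
theorem height_facts (hn : 2 ≤ n) : 1 ≤ Nat.log 2 n ∧ 2 ^ Nat.log 2 n ≤ n ∧ n < 2 ^ height n ∧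
    height n = Nat.log 2 n + 1 ∧ height n ≤ n := by
  have h1 : 2 ^ Nat.log 2 n ≤ n := Nat.pow_log_le_self 2 (by omega)
  have h2 := Nat.lt_two_pow_self (n := Nat.log 2 n)
  exact ⟨Nat.log_pos (by norm_num) hn, h1, Nat.lt_pow_succ_log_self (by norm_num) n, rfl,
    by rw [height]; omega⟩

theorem build_rankData (hn : 2 ≤ n) :
    (buildLayout e τ x col).RankData ((layer x (height n) e).map (code col)) := by
  obtain ⟨h1, h2, -⟩ := height_facts hn
  refine ⟨h1, h2, ?_, rfl, rfl, rfl, fun _ _ => rfl, fun _ _ => rfl⟩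
  rw [List.length_map, length_layer]

/-- All layers are stored in segments of the length of the last one, so division by that length
recovers the layer; shorter layers are padded. -/
theorem buildKey_eq {j : ℕ} (hj : j ≤ e) {a : ℕ} {v : Fin n}
    (h : (layer x (height n) j)[a]? = some v) :
    buildKey e x (j * (n * height n ^ e) + a) = x j v := by
  have ha : a < n * height n ^ j := by
    rw [← length_layer x (height n) j]
    exact (List.getElem?_eq_some_iff.1 h).1
  have hM : a < n * height n ^ e :=
    ha.trans_le (Nat.mul_le_mul_left _ (Nat.pow_le_pow_right (Nat.succ_pos _) hj))
  have h0 : 0 < n * height n ^ e := by omega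
  rw [buildKey, mul_comm j, Nat.mul_add_div h0, Nat.mul_add_mod, Nat.div_eq_of_lt hM,
    Nat.mod_eq_of_lt hM, add_zero, h]
  rfl

/-! ### Word size, space and time -/

/-- Bounds for the numbers that occur. -/
theorem build_bounds (hn : 2 ≤ n) {Z : ℕ} (hZ : Z = n ^ (3 * e + 4)) :
    (buildLayout e τ x col).size ≤ 27 * Z ∧ (e + 2) * (n * height n ^ e) ≤ Z ∧ n ≤ Z ∧ 1 ≤ Z ∧
      (2 * height n) ^ e * (n * height n ^ e) ≤ Z ∧ n * height n ^ e * height n ≤ Z ∧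
      n * height n ^ e / Nat.log 2 n + 1 ≤ Z := by
  obtain ⟨h1, h2, h3, h4, h5⟩ := height_facts hn
  have hpow : ∀ i ≤ 3 * e + 4, n ^ i ≤ Z := fun i hi => by
    rw [hZ]; exact Nat.pow_le_pow_right (by omega) hi
  have hnZ : n ≤ Z := by simpa using hpow 1 (by omega)
  have hhe : height n ^ e ≤ n ^ e := Nat.pow_le_pow_left h5 e
  have hM : n * height n ^ e ≤ n ^ (e + 1) := by
    rw [pow_succ, mul_comm]; exact Nat.mul_le_mul_right _ hhe
  have hL : (2 * height n) ^ e ≤ n ^ (2 * e) := by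
    rw [pow_mul, sq]
    exact Nat.pow_le_pow_left (Nat.mul_le_mul hn h5) e
  have hn1 : ∀ i, 1 ≤ n ^ i := fun i => Nat.one_le_pow _ _ (by omega)
  have hNB : n * height n ^ e / Nat.log 2 n + 1 ≤ n ^ (e + 2) := by
    have := Nat.div_le_self (n * height n ^ e) (Nat.log 2 n)
    have h6 := hn1 (e + 1)
    have h7 : n ^ (e + 1) * 2 ≤ n ^ (e + 2) := by
      rw [pow_succ n (e + 1)]; exact Nat.mul_le_mul_left _ hn
    omega
  have hhNB : height n * (n * height n ^ e / Nat.log 2 n + 1) ≤ Z := by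
    refine le_trans ?_ (hpow (e + 3) (by omega))
    rw [pow_succ n (e + 2), mul_comm]
    exact Nat.mul_le_mul hNB h5
  have hB : (min ⌊τ⌋₊ n + 1) * (2 * (2 * height n) ^ e + 1) ≤ Z := by
    refine le_trans ?_ (hpow (2 * e + 4) (by omega))
    have e1 : min ⌊τ⌋₊ n + 1 ≤ n ^ 2 := by
      have := min_le_right ⌊τ⌋₊ n
      have : n * 2 ≤ n ^ 2 := by rw [sq]; exact Nat.mul_le_mul_left _ hn
      omega
    have e2 : 2 * (2 * height n) ^ e + 1 ≤ n ^ (2 * e + 2) := by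
      have h6 := hn1 (2 * e)
      have h7 : n ^ (2 * e) * 4 ≤ n ^ (2 * e + 2) := by
        rw [pow_add]
        exact Nat.mul_le_mul_left _ (by rw [sq]; exact Nat.mul_le_mul hn hn)
      omega
    calc _ ≤ n ^ 2 * n ^ (2 * e + 2) := Nat.mul_le_mul e1 e2
      _ = n ^ (2 * e + 4) := by rw [← pow_add]; congr 1; omega
  refine ⟨?_, ?_, hnZ, hZ ▸ hn1 _, ?_, ?_, hNB.trans (hpow _ (by omega))⟩
  -- The constant part is 16; the tables contribute 3 n and three times `height n * NB`, and there
  -- are two buffers. This makes 24 Z, so 27 has slack.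
  · have := hn1 (3 * e + 4)
    rw [← hZ] at this
    simp only [Layout.size, Layout.start]
    omega
  · refine le_trans ?_ (hpow (2 * e + 3) (by omega))
    have e1 : e + 2 ≤ n ^ (e + 2) :=
      Nat.lt_two_pow_self.le.trans (Nat.pow_le_pow_left hn _)
    calc _ ≤ n ^ (e + 2) * n ^ (e + 1) := Nat.mul_le_mul e1 hM
      _ = n ^ (2 * e + 3) := by rw [← pow_add]; congr 1; omega
  · refine le_trans ?_ (hpow (3 * e + 1) (by omega))
    calc _ ≤ n ^ (2 * e) * n ^ (e + 1) := Nat.mul_le_mul hL hM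
      _ = n ^ (3 * e + 1) := by rw [← pow_add]; congr 1; omega
  · refine le_trans ?_ (hpow (e + 2) (by omega))
    rw [pow_succ n (e + 1)]
    exact Nat.mul_le_mul hM h5

/-- 2 ≤ n gives 64 ≤ n^6. The factor 64 covers the memory size, at most 27 n^(3e+4), and the small
additive and multiplicative constants in the overflow conditions. -/
theorem word_bound (hn : 2 ≤ n) {w : ℕ} (hw : n ^ (3 * e + 10) ≤ 2 ^ w) :
    64 * n ^ (3 * e + 4) ≤ 2 ^ w := by
  refine le_trans ?_ hw
  rw [show n ^ (3 * e + 10) = n ^ 6 * n ^ (3 * e + 4) by rw [← pow_add]; congr 1; omega]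
  exact Nat.mul_le_mul_right _ (Nat.pow_le_pow_left hn 6)

theorem build_isWordSized (hn : 2 ≤ n) {w : ℕ} (hw : n ^ (3 * e + 10) ≤ 2 ^ w)
    (hcol : ∀ i, col i < 2 ^ w) : (build e τ x col).IsWordSized w := by
  obtain ⟨hsize, hkey, hnZ, hZ1, hLM, hMh, hNB⟩ :=
    build_bounds (e := e) (τ := τ) (x := x) (col := col) hn rfl
  obtain ⟨h1, h2, h3, h4, h5⟩ := height_facts hn
  have hW := word_bound hn hw
  generalize n ^ (3 * e + 4) = Z at *
  have hM : n * height n ^ e ≤ Z := by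
    refine le_trans ?_ hkey
    exact Nat.le_mul_of_pos_left _ (by omega)
  have hlen : ((layer x (height n) e).map (code col)).length = n * height n ^ e := by
    rw [List.length_map, length_layer]
  intro v hv
  obtain ⟨a, -, rfl⟩ := List.mem_map.1 hv
  refine Layout.mem_lt _ (by omega) (by omega) (by show Nat.log 2 n < _; omega)
    (by show n * height n ^ e < _; omega) (by show height n < _; omega)
    (by show n * height n ^ e / Nat.log 2 n + 1 < _; omega) ?_ (fun c hc => decode_lt col hcol hc)
    ?_ ?_ ?_ ?_ a
  · intro c
    show threshold τ n c < _
    rw [threshold]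
    split_ifs
    · omega
    · have := min_le_right ⌊τ * c⌋₊ n
      omega
  · intro c
    have := popCount_le (Nat.log 2 n) c
    show popCount (Nat.log 2 n) c < _
    omega
  · intro l q
    refine lt_of_lt_of_le (Nat.ofBits_lt_two_pow _) ?_
    show 2 ^ Nat.log 2 n ≤ _
    omega
  · intro l q
    have := posMap_le ((layer x (height n) e).map (code col)) l false (q * Nat.log 2 n)
    show posMap _ l false _ < _
    omega
  · intro l q
    have := posMap_le ((layer x (height n) e).map (code col)) l true (q * Nat.log 2 n)
    show posMap _ l true _ < _
    omega

/-- With b = ⌊log₂ n⌋: h = b + 1 ≤ 2 b, and b / 2 ≤ b log 2 ≤ log n. -/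
theorem height_le (hn : 2 ≤ n) : (height n : ℝ) ≤ 4 * Real.log n := by
  obtain ⟨h1, h2, -, h4, -⟩ := height_facts hn
  have h5 : (Nat.log 2 n : ℝ) * Real.log 2 ≤ Real.log n := by
    rw [← Real.log_pow]
    exact Real.log_le_log (by positivity) (by exact_mod_cast h2)
  have h6 := Real.log_two_gt_d9
  have h7 : (1 : ℝ) ≤ Nat.log 2 n := by exact_mod_cast h1
  have h8 : (Nat.log 2 n : ℝ) * (1 / 2) ≤ Nat.log 2 n * Real.log 2 :=
    mul_le_mul_of_nonneg_left (by linarith) (by linarith)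
  rw [h4]
  push_cast
  linarith

theorem build_space (hn : 2 ≤ n) :
    ((build e τ x col).space : ℝ) ≤
      (30 + e + 12 * 2 ^ e) * 4 ^ e * (n * Real.log n ^ e) := by
  obtain ⟨h1, h2, h3, h4, h5⟩ := height_facts hn
  have hspace : (build e τ x col).space ≤ (30 + e + 12 * 2 ^ e) * (n * height n ^ e) := by
    have hpos : 1 ≤ height n ^ e := Nat.one_le_pow _ _ (by omega)
    have hnM : n * 1 ≤ n * height n ^ e := Nat.mul_le_mul_left _ hpos
    -- This is where packing pays off: h ≤ 2 b, so h levels of M / b words take O(M) words instead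
    -- of O(h M).
    have hNB : height n * (n * height n ^ e / Nat.log 2 n + 1) ≤ 3 * (n * height n ^ e) := by
      have := Nat.mul_div_le (n * height n ^ e) (Nat.log 2 n)
      calc height n * (n * height n ^ e / Nat.log 2 n + 1)
          = height n * (n * height n ^ e / Nat.log 2 n) + height n := by ring
        _ ≤ (2 * Nat.log 2 n) * (n * height n ^ e / Nat.log 2 n) + height n :=
          Nat.add_le_add_right (Nat.mul_le_mul_right _ (by omega)) _
        _ = 2 * (Nat.log 2 n * (n * height n ^ e / Nat.log 2 n)) + height n := by ring
        _ ≤ _ := by omega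
    -- The number of nodes is capped by n, so the buffers stay within the space bound for every τ.
    have hB : (min ⌊τ⌋₊ n + 1) * (2 * (2 * height n) ^ e + 1) ≤
        6 * (2 ^ e * (n * height n ^ e)) := by
      have e1 : min ⌊τ⌋₊ n + 1 ≤ 2 * n := by
        have := min_le_right ⌊τ⌋₊ n
        omega
      have e2 : 1 ≤ (2 * height n) ^ e := Nat.one_le_pow _ _ (by omega)
      calc _ ≤ (2 * n) * (3 * (2 * height n) ^ e) := Nat.mul_le_mul e1 (by omega)
        _ = _ := by rw [mul_pow]; ring
    have hexp : (30 + e + 12 * 2 ^ e) * (n * height n ^ e) = 30 * (n * height n ^ e) +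
        e * (n * height n ^ e) + 12 * (2 ^ e * (n * height n ^ e)) := by ring
    have hkeys : (e + 1) * (n * height n ^ e) = e * (n * height n ^ e) + n * height n ^ e := by ring
    rw [hexp]
    simp only [Image.space, build, List.length_map, List.length_range, Layout.size, Layout.start]
    omega
  have hM : ((n * height n ^ e : ℕ) : ℝ) ≤ 4 ^ e * (n * Real.log n ^ e) := by
    push_cast
    calc (n : ℝ) * height n ^ e ≤ n * (4 * Real.log n) ^ e :=
          mul_le_mul_of_nonneg_left (pow_le_pow_left₀ (by positivity) (height_le hn) e)
            (by positivity)
      _ = _ := by rw [mul_pow]; ring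
  calc ((build e τ x col).space : ℝ) ≤ ((30 + e + 12 * 2 ^ e) * (n * height n ^ e) : ℕ) := by
        exact_mod_cast hspace
    _ = (30 + e + 12 * 2 ^ e) * ((n * height n ^ e : ℕ) : ℝ) := by push_cast; ring
    _ ≤ (30 + e + 12 * 2 ^ e) * (4 ^ e * (n * Real.log n ^ e)) :=
        mul_le_mul_of_nonneg_left hM (by positivity)
    _ = _ := by ring

theorem time_le (hn : 2 ≤ n) (hτ : 1 ≤ τ) {t L A : ℕ} (hL : L = (2 * height n) ^ e)
    (hA : A = min ⌊τ⌋₊ n)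
    (ht : t ≤ 1000 * ((e + 1) * (L * height n)) + 1000 * (height n * (A * L)) + 1000 * (A * L) +
      1000 * height n) :
    (t : ℝ) ≤ 1000 * (e + 4) * 2 ^ e * 4 ^ (e + 1) * (τ * Real.log n ^ (e + 1)) := by
  obtain ⟨h1, h2, h3, h4, h5⟩ := height_facts hn
  have hA1 : 1 ≤ A := by
    rw [hA]
    exact le_min (Nat.le_floor (by simpa using hτ)) (by omega)
  have hL1 : 1 ≤ L := hL ▸ Nat.one_le_pow _ _ (by omega)
  have hAτ : (A : ℝ) ≤ τ := by
    refine le_trans ?_ (Nat.floor_le (by linarith : 0 ≤ τ))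
    exact_mod_cast hA ▸ min_le_left ⌊τ⌋₊ n
  -- Each of the four summands is at most a multiple of A L h: the first contributes the factor e +
  -- 1, and the other three contribute 1 each.
  have hnat : t ≤ 1000 * (e + 4) * (A * (L * height n)) := by
    have e1 : L * height n ≤ A * (L * height n) := Nat.le_mul_of_pos_left _ hA1
    have e2 : height n * (A * L) = A * (L * height n) := by ring
    have e3 : A * L * 1 ≤ A * L * height n := Nat.mul_le_mul_left _ (by omega)
    have e4 : A * L * height n = A * (L * height n) := by ring
    have e5 : 1 * height n ≤ L * height n := Nat.mul_le_mul_right _ hL1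
    have e6 : 1000 * (e + 4) * (A * (L * height n)) =
      1000 * ((e + 1) * (A * (L * height n))) + 3000 * (A * (L * height n)) := by ring
    have e7 := Nat.mul_le_mul_left (e + 1) e1
    omega
  have hLh : ((L * height n : ℕ) : ℝ) ≤ 2 ^ e * (4 * Real.log n) ^ (e + 1) := by
    have : L * height n = 2 ^ e * height n ^ (e + 1) := by rw [hL, mul_pow, pow_succ]; ring
    rw [this]
    push_cast
    exact mul_le_mul_of_nonneg_left (pow_le_pow_left₀ (by positivity) (height_le hn) _)
      (by positivity)
  calc (t : ℝ) ≤ ((1000 * (e + 4) * (A * (L * height n)) : ℕ) : ℝ) := by exact_mod_cast hnat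
    _ = 1000 * (e + 4) * (A * ((L * height n : ℕ) : ℝ)) := by push_cast; ring
    _ ≤ 1000 * (e + 4) * (τ * (2 ^ e * (4 * Real.log n) ^ (e + 1))) :=
        mul_le_mul_of_nonneg_left (mul_le_mul hAτ hLh (by positivity) (by linarith)) (by positivity)
    _ = _ := by rw [mul_pow]; ring

end Build

theorem build_setting {e n : ℕ} (hn : 2 ≤ n) {w : ℕ} (hw : n ^ (3 * e + 10) ≤ 2 ^ w)
    (hw0 : 0 < w) {τ : ℝ} (hτ : 1 ≤ τ) (x : ℕ → Fin n → ℝ) (col : Fin n → ℕ)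
    (lo hi : Fin (e + 1) → ℝ) :
    Setting e ⟨w, (buildLayout e τ x col).size, (e + 1) * (n * height n ^ e), buildKey e x,
      Sum.elim lo hi, hw0⟩ (buildLayout e τ x col) x (code col) τ (extend lo) (extend hi)
      ((2 * height n) ^ e) (min ⌊τ⌋₊ n) := by
  obtain ⟨hsize, hkey, hnZ, hZ1, hLM, hMh, hNB⟩ :=
    build_bounds (e := e) (τ := τ) (x := x) (col := col) hn rfl
  obtain ⟨h1, h2, h3, h4, h5⟩ := height_facts hn
  have hW := word_bound hn hw
  generalize n ^ (3 * e + 4) = Z at *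
  have hM : n * height n ^ e ≤ Z := by
    refine le_trans ?_ hkey
    exact Nat.le_mul_of_pos_left _ (by omega)
  have hpow : 2 ^ height n = 2 ^ Nat.log 2 n * 2 := by rw [h4, pow_succ]
  refine ⟨rfl, ?_, rfl, ?_, ?_, ?_, ?_, h3, ?_, ?_, ?_, ?_, rfl, rfl, rfl, rfl, ?_, ?_, ?_,
    code_lt col, hτ, rfl, build_rankData hn⟩
  · show (buildLayout e τ x col).size + 14 < 2 ^ w
    omega
  · show (e + 1) * (n * height n ^ e) + n * height n ^ e < 2 ^ w
    rw [← Nat.succ_mul]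
    exact lt_of_le_of_lt hkey (by omega)
  · exact fun j hj a v h => buildKey_eq hj h
  · exact fun j => (extend_coe _ j).symm
  · exact fun j => (extend_coe _ j).symm
  · show 1 ≤ height n
    omega
  · show 1 ≤ n
    omega
  · show 2 ^ height n * 2 < 2 ^ w
    omega
  · show 2 * height n < 2 ^ w
    omega
  · show (2 * height n) ^ e * (n * height n ^ e) < 2 ^ w
    omega
  · show 2 * (n * height n ^ e) + 2 < 2 ^ w
    omega
  · show n * height n ^ e * height n < 2 ^ w
    omega

theorem build_answers {e n : ℕ} (hn : 2 ≤ n) {w : ℕ} (hw : n ^ (3 * e + 10) ≤ 2 ^ w)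
    {τ : ℝ} (hτ : 1 ≤ τ) (pt : Fin n → Fin (e + 1) → ℝ) (col : Fin n → ℕ)
    (hcol : ∀ i, col i < 2 ^ w) (lo hi : Fin (e + 1) → ℝ) :
    ∃ (t : ℕ) (out : List ℕ),
      Answers (query e).code w (build e τ (fun j i => extend (pt i) j) col) lo hi t out ∧
      (t : ℝ) ≤ 1000 * (e + 4) * 2 ^ e * 4 ^ (e + 1) * (τ * Real.log n ^ (e + 1)) ∧
      out.Nodup ∧ ∀ c, c ∈ out ↔ Dominates τ pt col (rect lo hi) c := by
  have hW := word_bound hn hw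
  have hZ : 1 ≤ n ^ (3 * e + 4) := Nat.one_le_pow _ _ (by omega)
  have hw0 : 0 < w := by
    by_contra h0
    obtain rfl : w = 0 := by omega
    omega
  set x : ℕ → Fin n → ℝ := fun j i => extend (pt i) j with hx
  have H := build_setting hn hw hw0 hτ x col lo hi
  have hword := build_isWordSized (τ := τ) (x := x) hn hw hcol
  obtain ⟨s', t, σ', hrun, hrep, ht, hmem, J, hJ, hperm, hout⟩ :=
    Machine.Wp.query H ⟨fun _ => 0, (buildLayout e τ x col).mem, []⟩ (fun _ => rfl) rfl rfl
      ⟨fun _ => 0, (build e τ x col).words, []⟩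
      ⟨rfl, rfl, fun _ => rfl, fun _ => by positivity, fun a ha =>
        hword _ (List.mem_map_of_mem (List.mem_range.2 ha))⟩
  obtain ⟨ρ, m, o⟩ := σ'
  have hm : m = (build e τ x col).words := by
    have h1 : m = _ := hrep.mem_eq
    rw [h1, build]
    exact List.map_congr_left fun a ha => hmem a (List.mem_range.1 ha)
  obtain rfl : o = s'.out := hrep.out_eq
  subst hm
  obtain ⟨h1, -, h3, h4, -⟩ := height_facts hn
  exact ⟨t, s'.out, ⟨ρ, hrun⟩, time_le hn hτ rfl rfl ht,
    report_spec pt col lo hi hτ h3 (by omega) hJ.le hJ.total_le hperm hout⟩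

end Domination

theorem theorem5 (d : ℕ) (hd : 1 ≤ d) :
    ∃ (prog : Domination.Cmd (Fin d ⊕ Fin d)) (k : ℕ) (C : ℝ),
      ∀ (n w : ℕ) (τ : ℝ) (pt : Fin n → Fin d → ℝ) (col : Fin n → ℕ),
        2 ≤ n → n ^ k ≤ 2 ^ w → 1 ≤ τ → (∀ i, col i < 2 ^ w) →
        ∃ D : Domination.Image,
          D.IsWordSized w ∧
          (D.space : ℝ) ≤ C * (n * Real.log n ^ (d - 1)) ∧
          ∀ lo hi : Fin d → ℝ, ∃ (t : ℕ) (out : List ℕ),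
            Domination.Answers prog w D lo hi t out ∧
            (t : ℝ) ≤ C * (τ * Real.log n ^ d) ∧
            out.Nodup ∧
            ∀ c, c ∈ out ↔ Domination.Dominates τ pt col (Domination.rect lo hi) c := by
  obtain ⟨e, rfl⟩ := Nat.exists_eq_add_of_le' hd
  -- The program depends on the dimension only. The exponent is the one `word_bound` needs, so words
  -- of 3e + 10 times log₂ n bits are enough, and the constant is the sum of those for space and
  -- time.
  refine ⟨(Domination.query e).code, 3 * e + 10,
    (30 + e + 12 * 2 ^ e) * 4 ^ e + 1000 * (e + 4) * 2 ^ e * 4 ^ (e + 1), ?_⟩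
  intro n w τ pt col hn hw hτ hcol
  have hlog : 0 ≤ Real.log n := Real.log_natCast_nonneg n
  have hτ0 : 0 ≤ τ := by linarith
  refine ⟨Domination.build e τ (fun j i => Domination.extend (pt i) j) col,
    Domination.build_isWordSized hn hw hcol, ?_, fun lo hi => ?_⟩
  · refine (Domination.build_space hn).trans ?_
    rw [Nat.add_sub_cancel]
    exact mul_le_mul_of_nonneg_right (le_add_of_nonneg_right (by positivity)) (by positivity)
  · obtain ⟨t, out, h1, h2, h3⟩ := Domination.build_answers hn hw hτ pt col hcol lo hi
    refine ⟨t, out, h1, h2.trans ?_, h3⟩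
    exact mul_le_mul_of_nonneg_right (le_add_of_nonneg_left (by positivity)) (by positivity)
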